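/- Computation is on a randomized real RAM: a fixed finite program with natural-number index registers, real registers and arrays of reals, in which each operation (addition and truncated subtraction of indices; $+,-,\times,\div,\sqrt{\cdot}$ on exact reals; conversion of an index to a real; comparison; memory access; drawing an independent $\mathcal N(0,1)$ number) takes one step. For $v_1,\dots,v_m\in\mathbb R^n$, $c_1,\dots,c_m\in\mathbb R$, $x_0\in\mathbb R^n$ and $\gamma,\delta\in\mathbb R$, the Edge-Walk with $T$ iterations is the random sequence $X_0=x_0,X_1,\dots,X_T$ in $\mathbb R^n$ defined as follows. For $t=1,\dots,T$ let $$\mathcal C^{\mathrm{var}}_t=\{i\in[n]: |(X_{t-1})_i|\ge 1-\delta\},\qquad \mathcal C^{\mathrm{disc}}_t=\{j\in[m]: |\langle X_{t-1}-x_0,v_j\rangle|\ge c_j-\delta\},$$ $$\mathcal V_t=\{u\in\mathbb R^n: u_i=0\ \forall i\in\mathcal C^{\mathrm{var}}_t,\ \langle u,v_j\rangle=0\ \forall j\in\mathcal C^{\mathrm{disc}}_t\},$$ and $X_t=X_{t-1}+\gamma U_t$, where, conditionally on $X_0,\dots,X_{t-1}$, the vector $U_t$ has the standard Gaussian distribution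 $\mathcal N(\mathcal V_t)$ on $\mathcal V_t$ (the law of $\sum_i g_ib_i$ for an orthonormal basis $(b_i)$ of $\mathcal V_t$ and independent $g_i\sim\mathcal N(0,1)$). The procedure is declared to fail if $|\mathcal C^{\mathrm{disc}}_t|\ge n$ for some $t\in\{1,\dots,T\}$. **Theorem.** (1) There are a program and a constant $C$ such that for all $n\ge 1$, $m,T\ge 0$ and all $v_j,c_j,x_0,\gamma,\delta$ as above, the program always halts within $C\,(Tmn+n^3+Tn^2)$ steps and carries out Edge-Walk: there is a function $(X_0,\dots,X_T)$ of its random draws that is distributed as the Edge-Walk trajectory, such that for every outcome of the draws the program reports failure if $|\mathcal C^{\mathrm{disc}}_t|\ge n$ for some $t\le T$, and otherwise reports success and outputs $X_T$. (2) Consequently, Spencer-type colorings can be found in $\tilde O(mn+n^3)$ time: there are a program and constants $C,d,K$ such that for all $m\ge n\ge 1$ and every real $m\times n$ matrix $A$ with $|a_{i,j}|\le 1$, the program always halts within $C\,(mn+n^3)(1+\ln(mn))^d$ steps and outputs some $x\in\{-1,+1\}^n$, and with probability at least $1/2$ this $x$ satisfies $\|Ax\|_\infty\le K\sqrt{n\ln(em/n)}$.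 -/

import Mathlib

open MeasureTheory ProbabilityTheory

/-! ### A randomized real RAM

A program is a finite command over index registers (natural numbers), real registers, and named
arrays of reals with two indices.  Every arithmetic operation, memory access, comparison and
Gaussian draw costs one step. -/

namespace RealRAM

/-- Index expressions: constants, registers, addition and truncated subtraction. -/
inductive IExpr where
  | lit : ℕ → IExpr
  | reg : ℕ → IExpr
  | add : IExpr → IExpr → IExpr
  | sub : IExpr → IExpr → IExpr

/-- Real expressions: rational constants, registers, array cells, conversion of an index to a real
number, field operations and square root. -/
inductive RExpr where
  | lit : ℚ → RExpr
  | reg : ℕ → RExpr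
  | get : ℕ → IExpr → IExpr → RExpr
  | ofIdx : IExpr → RExpr
  | add : RExpr → RExpr → RExpr
  | sub : RExpr → RExpr → RExpr
  | mul : RExpr → RExpr → RExpr
  | div : RExpr → RExpr → RExpr
  | sqrt : RExpr → RExpr

/-- Tests. -/
inductive Test where
  | idxLt : IExpr → IExpr → Test
  | realLe : RExpr → RExpr → Test
  | not : Test → Test

/-- Programs.  `gauss r` draws a fresh standard Gaussian into the real register `r`. -/
inductive Prog where
  | skip : Prog
  | setI : ℕ → IExpr → Prog
  | setR : ℕ → RExpr → Prog
  | put : ℕ → IExpr → IExpr → RExpr → Prog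
  | gauss : ℕ → Prog
  | seq : Prog → Prog → Prog
  | ite : Test → Prog → Prog → Prog
  | loop : Test → Prog → Prog

/-- The state of the machine; `drawn` is the number of Gaussians drawn so far. -/
@[ext]
structure Store where
  idx : ℕ → ℕ
  real : ℕ → ℝ
  arr : ℕ → ℕ → ℕ → ℝ
  drawn : ℕ

def IExpr.eval (s : Store) : IExpr → ℕ
  | lit k => k
  | reg r => s.idx r
  | add a b => a.eval s + b.eval s
  | sub a b => a.eval s - b.eval s

/-- The number of steps needed to evaluate an index expression. -/
def IExpr.cost : IExpr → ℕ
  | lit _ => 1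
  | reg _ => 1
  | add a b => a.cost + b.cost + 1
  | sub a b => a.cost + b.cost + 1

noncomputable def RExpr.eval (s : Store) : RExpr → ℝ
  | lit q => (q : ℝ)
  | reg r => s.real r
  | get a i j => s.arr a (i.eval s) (j.eval s)
  | ofIdx i => (i.eval s : ℝ)
  | add a b => a.eval s + b.eval s
  | sub a b => a.eval s - b.eval s
  | mul a b => a.eval s * b.eval s
  | div a b => a.eval s / b.eval s
  | sqrt a => Real.sqrt (a.eval s)

def RExpr.cost : RExpr → ℕ
  | lit _ => 1
  | reg _ => 1
  | get _ i j => i.cost + j.cost + 1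
  | ofIdx i => i.cost + 1
  | add a b => a.cost + b.cost + 1
  | sub a b => a.cost + b.cost + 1
  | mul a b => a.cost + b.cost + 1
  | div a b => a.cost + b.cost + 1
  | sqrt a => a.cost + 1

def Test.eval (s : Store) : Test → Prop
  | idxLt a b => a.eval s < b.eval s
  | realLe a b => a.eval s ≤ b.eval s
  | not t => ¬ t.eval s

def Test.cost : Test → ℕ
  | idxLt a b => a.cost + b.cost + 1
  | realLe a b => a.cost + b.cost + 1
  | not t => t.cost + 1

def Store.setI (s : Store) (r v : ℕ) : Store :=
  { s with idx := Function.update s.idx r v }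

def Store.setR (s : Store) (r : ℕ) (v : ℝ) : Store :=
  { s with real := Function.update s.real r v }

def Store.put (s : Store) (a i j : ℕ) (v : ℝ) : Store :=
  { s with arr := fun a' i' j' => if a' = a ∧ i' = i ∧ j' = j then v else s.arr a' i' j' }

/-- `Exec ω p s k s'`: with `ω 0, ω 1, …` as the successive random draws, the program `p` started
in the state `s` halts in the state `s'` after exactly `k` steps. -/
inductive Exec (ω : ℕ → ℝ) : Prog → Store → ℕ → Store → Prop where
  | skip (s : Store) : Exec ω .skip s 1 s
  | setI (r : ℕ) (e : IExpr) (s : Store) :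
      Exec ω (.setI r e) s (e.cost + 1) (s.setI r (e.eval s))
  | setR (r : ℕ) (e : RExpr) (s : Store) :
      Exec ω (.setR r e) s (e.cost + 1) (s.setR r (e.eval s))
  | put (a : ℕ) (i j : IExpr) (e : RExpr) (s : Store) :
      Exec ω (.put a i j e) s (i.cost + j.cost + e.cost + 1)
        (s.put a (i.eval s) (j.eval s) (e.eval s))
  | gauss (r : ℕ) (s : Store) :
      Exec ω (.gauss r) s 1 { s.setR r (ω s.drawn) with drawn := s.drawn + 1 }
  | seq {p q : Prog} {s s' s'' : Store} {k l : ℕ} :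
      Exec ω p s k s' → Exec ω q s' l s'' → Exec ω (.seq p q) s (k + l) s''
  | iteTrue {b : Test} {p q : Prog} {s s' : Store} {k : ℕ} :
      b.eval s → Exec ω p s k s' → Exec ω (.ite b p q) s (b.cost + k) s'
  | iteFalse {b : Test} {p q : Prog} {s s' : Store} {k : ℕ} :
      ¬ b.eval s → Exec ω q s k s' → Exec ω (.ite b p q) s (b.cost + k) s'
  | loopTrue {b : Test} {p : Prog} {s s' s'' : Store} {k l : ℕ} :
      b.eval s → Exec ω p s k s' → Exec ω (.loop b p) s' l s'' →
      Exec ω (.loop b p) s (b.cost + k + l) s''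
  | loopFalse {b : Test} {p : Prog} {s : Store} :
      ¬ b.eval s → Exec ω (.loop b p) s b.cost s

/-- The machine is deterministic once the random draws are fixed. -/
theorem Exec.unique {ω : ℕ → ℝ} {p : Prog} {s s₁ s₂ : Store} {k₁ k₂ : ℕ}
    (h₁ : Exec ω p s k₁ s₁) (h₂ : Exec ω p s k₂ s₂) : k₁ = k₂ ∧ s₁ = s₂ := by
  induction h₁ generalizing k₂ s₂ with
  | skip | setI | setR | put | gauss => cases h₂; exact ⟨rfl, rfl⟩
  | seq _ _ ih ih' =>
    cases h₂ with
    | seq a b =>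
      obtain ⟨rfl, rfl⟩ := ih a
      obtain ⟨rfl, rfl⟩ := ih' b
      exact ⟨rfl, rfl⟩
  | iteTrue hb _ ih =>
    cases h₂ with
    | iteTrue _ a => obtain ⟨rfl, rfl⟩ := ih a; exact ⟨rfl, rfl⟩
    | iteFalse hb' _ => exact absurd hb hb'
  | iteFalse hb _ ih =>
    cases h₂ with
    | iteTrue hb' _ => exact absurd hb' hb
    | iteFalse _ a => obtain ⟨rfl, rfl⟩ := ih a; exact ⟨rfl, rfl⟩
  | loopTrue hb _ _ ih ih' =>
    cases h₂ with
    | loopTrue _ a b =>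
      obtain ⟨rfl, rfl⟩ := ih a
      obtain ⟨rfl, rfl⟩ := ih' b
      exact ⟨rfl, rfl⟩
    | loopFalse hb' => exact absurd hb hb'
  | loopFalse hb =>
    cases h₂ with
    | loopTrue hb' _ _ => exact absurd hb' hb
    | loopFalse _ => exact ⟨rfl, rfl⟩

/-- The law of the random draws: independent standard Gaussians. -/
noncomputable def drawLaw : Measure (ℕ → ℝ) :=
  Measure.infinitePi fun _ : ℕ => gaussianReal 0 1

/-- The entries of a vector, extended by zero. -/
def padVec {n : ℕ} (x : Fin n → ℝ) (i : ℕ) : ℝ :=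
  if hi : i < n then x ⟨i, hi⟩ else 0

/-- The entries of an `m × n` matrix, extended by zero. -/
def padMat {m n : ℕ} (A : Fin m → Fin n → ℝ) (j i : ℕ) : ℝ :=
  if hj : j < m then padVec (A ⟨j, hj⟩) i else 0

end RealRAM

/-! ### The Edge-Walk procedure -/

/-- The data of Edge-Walk: constraint vectors `v j`, thresholds `c j`, the starting point `x₀`,
the step size `γ` and the slack `δ`. -/
structure EdgeWalkData (n m : ℕ) where
  v : Fin m → EuclideanSpace ℝ (Fin n)
  c : Fin m → ℝ
  x₀ : EuclideanSpace ℝ (Fin n)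
  γ : ℝ
  δ : ℝ

namespace EdgeWalkData

variable {n m : ℕ} (D : EdgeWalkData n m)

open Classical in
/-- The variable constraints nearly hit at `x`. -/
noncomputable def nearVar (x : EuclideanSpace ℝ (Fin n)) : Finset (Fin n) :=
  Finset.univ.filter fun i => 1 - D.δ ≤ |x i|

open Classical in
/-- The discrepancy constraints nearly hit at `x`. -/
noncomputable def nearDisc (x : EuclideanSpace ℝ (Fin n)) : Finset (Fin m) :=
  Finset.univ.filter fun j => D.c j - D.δ ≤ |inner ℝ (x - D.x₀) (D.v j)|

/-- The vectors orthogonal to the variable constraints in `I` and the discrepancy constraints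
in `J`. -/
def orthTo (I : Finset (Fin n)) (J : Finset (Fin m)) :
    Submodule ℝ (EuclideanSpace ℝ (Fin n)) where
  carrier := {u | (∀ i ∈ I, u i = 0) ∧ ∀ j ∈ J, inner ℝ u (D.v j) = 0}
  zero_mem' := by simp
  add_mem' := by
    rintro a b ⟨ha, ha'⟩ ⟨hb, hb'⟩
    refine ⟨fun i hi => ?_, fun j hj => ?_⟩
    · simp [ha i hi, hb i hi]
    · rw [inner_add_left, ha' j hj, hb' j hj, add_zero]
  smul_mem' := by
    rintro r a ⟨ha, ha'⟩
    refine ⟨fun i hi => ?_, fun j hj => ?_⟩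
    · simp [ha i hi]
    · rw [inner_smul_left, ha' j hj, mul_zero]

/-- The subspace in which the walk moves from `x`. -/
noncomputable def freeSpace (x : EuclideanSpace ℝ (Fin n)) :
    Submodule ℝ (EuclideanSpace ℝ (Fin n)) :=
  D.orthTo (D.nearVar x) (D.nearDisc x)

end EdgeWalkData

/-- The standard Gaussian distribution `𝒩(V)` on a subspace `V`, i.e. the law of `∑ i, g i • b i`
for an orthonormal basis `b` of `V` and independent standard Gaussians `g i`. -/
noncomputable def gaussianOn {n : ℕ} (V : Submodule ℝ (EuclideanSpace ℝ (Fin n))) :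
    Measure (EuclideanSpace ℝ (Fin n)) :=
  (stdGaussian V).map (fun u : V => (u : EuclideanSpace ℝ (Fin n)))

instance {n : ℕ} (V : Submodule ℝ (EuclideanSpace ℝ (Fin n))) :
    IsProbabilityMeasure (gaussianOn V) :=
  Measure.isProbabilityMeasure_map measurable_subtype_coe.aemeasurable

namespace EdgeWalkData

variable {n m : ℕ} (D : EdgeWalkData n m)

/-- One iteration: the law of `(X₀, …, X_t, X_t + γ U)` with `U ∼ 𝒩(V)`, `V` the free space at
`X_t`, given the history `h = (X₀, …, X_t)`. -/
noncomputable def step (t : ℕ) (h : Fin (t + 1) → EuclideanSpace ℝ (Fin n)) :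
    Measure (Fin (t + 2) → EuclideanSpace ℝ (Fin n)) :=
  (gaussianOn (D.freeSpace (h (Fin.last t)))).map fun u =>
    Fin.snoc (α := fun _ => EuclideanSpace ℝ (Fin n)) h (h (Fin.last t) + D.γ • u)

/-- The law of the trajectory `(X₀, …, X_T)` of Edge-Walk with `T` iterations. -/
noncomputable def walkLaw : (T : ℕ) → Measure (Fin (T + 1) → EuclideanSpace ℝ (Fin n))
  | 0 => Measure.dirac fun _ => D.x₀
  | t + 1 => (walkLaw t).bind (D.step t)

theorem measurable_snoc_step (t : ℕ) :
    Measurable fun p : (Fin (t + 1) → EuclideanSpace ℝ (Fin n)) × EuclideanSpace ℝ (Fin n) =>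
      (Fin.snoc (α := fun _ => EuclideanSpace ℝ (Fin n)) p.1 (p.1 (Fin.last t) + D.γ • p.2) :
        Fin (t + 2) → EuclideanSpace ℝ (Fin n)) := by
  refine measurable_pi_iff.2 fun i => ?_
  refine Fin.lastCases ?_ (fun i => ?_) i
  · simp only [Fin.snoc_last]
    fun_prop
  · simp only [Fin.snoc_castSucc]
    fun_prop

theorem measurable_step (t : ℕ) : Measurable (D.step t) := by
  classical
  let F (I : Finset (Fin n)) (J : Finset (Fin m)) (h : Fin (t + 1) → EuclideanSpace ℝ (Fin n)) :
      Measure (Fin (t + 2) → EuclideanSpace ℝ (Fin n)) :=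
    (gaussianOn (D.orthTo I J)).map fun u =>
      Fin.snoc (α := fun _ => EuclideanSpace ℝ (Fin n)) h (h (Fin.last t) + D.γ • u)
  have hF : ∀ I J, Measurable (F I J) := by
    intro I J
    have h1 := (Measure.measurable_map _ (D.measurable_snoc_step t)).comp
      (Measurable.map_prodMk_left (α := Fin (t + 1) → EuclideanSpace ℝ (Fin n))
        (ν := gaussianOn (D.orthTo I J)))
    convert h1 using 1
    funext h
    simp only [Function.comp, F]
    rw [Measure.map_map (D.measurable_snoc_step t) measurable_prodMk_left]
    rfl
  have hI : ∀ I, MeasurableSet {x | D.nearVar x = I} := by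
    intro I
    have : {x | D.nearVar x = I} = ⋂ i, {x | 1 - D.δ ≤ |x i| ↔ i ∈ I} := by
      ext x; simp [nearVar, Finset.ext_iff]
    rw [this]
    refine MeasurableSet.iInter fun i => ?_
    have hm : MeasurableSet {x : EuclideanSpace ℝ (Fin n) | 1 - D.δ ≤ |x i|} :=
      measurableSet_le measurable_const (by fun_prop)
    by_cases hi : i ∈ I
    · simpa [hi] using hm
    · simpa [hi, Set.compl_ofPred] using hm.compl
  have hJ : ∀ J, MeasurableSet {x | D.nearDisc x = J} := by
    intro J
    have : {x | D.nearDisc x = J} =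
        ⋂ j, {x | D.c j - D.δ ≤ |inner ℝ (x - D.x₀) (D.v j)| ↔ j ∈ J} := by
      ext x; simp [nearDisc, Finset.ext_iff]
    rw [this]
    refine MeasurableSet.iInter fun j => ?_
    have hm : MeasurableSet {x : EuclideanSpace ℝ (Fin n) |
        D.c j - D.δ ≤ |inner ℝ (x - D.x₀) (D.v j)|} :=
      (isClosed_le continuous_const (by fun_prop)).measurableSet
    by_cases hj : j ∈ J
    · simpa [hj] using hm
    · simpa [hj, Set.compl_ofPred] using hm.compl
  intro S hS
  have hl : Measurable fun h : Fin (t + 1) → EuclideanSpace ℝ (Fin n) => h (Fin.last t) :=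
    measurable_pi_apply _
  have : D.step t ⁻¹' S = ⋃ I, ⋃ J,
      ((fun h => h (Fin.last t)) ⁻¹' ({x | D.nearVar x = I} ∩ {x | D.nearDisc x = J})) ∩
        F I J ⁻¹' S := by
    ext h
    simp only [Set.mem_preimage, Set.mem_iUnion, Set.mem_inter_iff, Set.mem_ofPred_eq]
    constructor
    · intro hh
      exact ⟨_, _, ⟨rfl, rfl⟩, hh⟩
    · rintro ⟨I, J, ⟨rfl, rfl⟩, hh⟩
      exact hh
  rw [this]
  exact MeasurableSet.iUnion fun I => MeasurableSet.iUnion fun J =>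
    (hl ((hI I).inter (hJ J))).inter (hF I J hS)

instance isProbabilityMeasure_walkLaw (T : ℕ) : IsProbabilityMeasure (D.walkLaw T) := by
  induction T with
  | zero => exact Measure.dirac.isProbabilityMeasure
  | succ t ih =>
    refine ⟨?_⟩
    have h1 : ∀ h, D.step t h Set.univ = 1 := by
      intro h
      have hm : Measurable fun u : EuclideanSpace ℝ (Fin n) =>
          (Fin.snoc (α := fun _ => EuclideanSpace ℝ (Fin n)) h (h (Fin.last t) + D.γ • u) :
            Fin (t + 2) → EuclideanSpace ℝ (Fin n)) :=
        (D.measurable_snoc_step t).comp measurable_prodMk_left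
      rw [step, Measure.map_apply hm MeasurableSet.univ]
      simp
    rw [walkLaw, Measure.bind_apply MeasurableSet.univ (D.measurable_step t).aemeasurable]
    simp [h1]

/-- The initial machine state for Edge-Walk with `T` iterations: index registers `0, 1, 2` hold
`n, m, T`, real registers `0, 1` hold `γ, δ`, and the arrays `0, 1, 2` hold the constraint
vectors (one per row), the thresholds and the starting point. -/
noncomputable def input (T : ℕ) : RealRAM.Store where
  idx r := match r with
    | 0 => n
    | 1 => m
    | 2 => T
    | _ => 0
  real r := match r with
    | 0 => D.γ
    | 1 => D.δ
    | _ => 0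
  arr a j i := match a with
    | 0 => RealRAM.padMat (fun j i => D.v j i) j i
    | 1 => if i = 0 then RealRAM.padVec D.c j else 0
    | 2 => if i = 0 then RealRAM.padVec (fun k => D.x₀ k) j else 0
    | _ => 0
  drawn := 0

end EdgeWalkData

/-! ### Discrepancy -/

/-- `disc(A, x) = ‖A x‖_∞`. -/
noncomputable def discrepancy {m n : ℕ} (A : Matrix (Fin m) (Fin n) ℝ) (x : Fin n → ℝ) : ℝ :=
  ‖A.mulVec x‖

/-- The initial machine state for a colouring problem: index registers `0, 1` hold `n, m` and the
array `0` holds the matrix. -/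
noncomputable def matrixInput {m n : ℕ} (A : Matrix (Fin m) (Fin n) ℝ) : RealRAM.Store where
  idx r := match r with
    | 0 => n
    | 1 => m
    | _ => 0
  real _ := 0
  arr a j i := match a with
    | 0 => RealRAM.padMat A j i
    | _ => 0
  drawn := 0

/-! Part one, cost. A move inside the free space changes neither a frozen coordinate nor the inner
product with a frozen constraint vector, so the sets of nearly hit constraints only grow along the
walk (`nearVar_path_subset`, `nearDisc_path_subset`). Hence one orthonormal basis of the complement
of the free space serves the whole run. Gram-Schmidt extends it when a constraint is newly hit, at
cost `O(n²)`. At most `n` variables and fewer than `n` discrepancy constraints are inserted before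
failure is declared, so all insertions together cost `O(n³)`. The rest of an iteration tests the
constraints in `O(mn)` and projects a fresh Gaussian vector on the free space in `O(n²)`.

Part one, law. The projection of a standard Gaussian vector on `V` has law `𝒩(V)`
(`map_starProjection`), and each iteration reads a block of draws independent of the past
(`lintegral_fresh`). The deterministic recursion `path` therefore has the law of Edge-Walk
(`map_path`).

Part two, one walk. Take `γ²T = 256` and let `a` coordinates be active, that is, not nearly frozen,
at the start. The energy `∑ (1 + cos xᵢ)` over these coordinates lies in `[0, 2a]` wherever the walk
goes, and a step lowers its expectation by at least `γ²/8` times the dimension of the free space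
(`lintegral_energy_next_le`). Dimensions decrease, so the final expected dimension is at most
`a/16`. Deviations `⟨X_t - x₀, v_j⟩` are sub-Gaussian with variance proxy at most `256 a`. For the
threshold `128 √(l √(n a))`, with `l` about `log₂(m/n)`, the expected number of hit constraints is
thus at most `a/16`. The number of active coordinates is at most dimension plus hits
(`le_finrank_freeSpace`), so by Markov's inequality a walk halves it with probability at least one
half. The program can check this outcome and discards bad walks.

Part two, iteration. Halving `a` shrinks the threshold by the factor `2^(-1/4)`, so the accepted
discrepancies form a geometric series with sum `O(√(n l))` (`threshold_step`, `attempts_invariant`).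
After `O(log n)` attempts at most `√n` coordinates are active with probability at least `7/8`
(`measure_active_attempts_le`). A martingale of fair coins, the signs of Gaussians, pushes the
coordinates to `±1`. An exponential supermartingale `roundPot` bounds its error by `18 √n`, because
`∑ (1 - xᵢ²)` is only `O(n^(7/8))`.

Part two, regimes. Walks have about `√n` iterations, which is affordable when `m² < n³`, since then
`√n · m · n = O(n³)`. When `m² ≥ n³`, `log (em/n)` is comparable to `log m` and coin tossing from
the origin already suffices. Small `n`, or `m` exponentially large in `n`, falls under the trivial
bound `n` on the discrepancy. -/

namespace RealRAM

/-! ### Weakest preconditions and syntactic frames -/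

/-- `p` started in `s` halts after some number `k` of steps in a state `s'` with `Q k s'`. -/
def WP (ω : ℕ → ℝ) (p : Prog) (s : Store) (Q : ℕ → Store → Prop) : Prop :=
  ∃ k s', Exec ω p s k s' ∧ Q k s'

/-- Whether the program may write to the index register `r`. -/
def Prog.setsI (r : ℕ) : Prog → Bool
  | .setI r' _ => r' == r
  | .seq p q => p.setsI r || q.setsI r
  | .ite _ p q => p.setsI r || q.setsI r
  | .loop _ p => p.setsI r
  | _ => false

/-- Whether the program may write to the real register `r`. -/
def Prog.setsR (r : ℕ) : Prog → Bool
  | .setR r' _ => r' == r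
  | .gauss r' => r' == r
  | .seq p q => p.setsR r || q.setsR r
  | .ite _ p q => p.setsR r || q.setsR r
  | .loop _ p => p.setsR r
  | _ => false

/-- Whether the program may write to the array `a`. -/
def Prog.setsA (a : ℕ) : Prog → Bool
  | .put a' _ _ _ => a' == a
  | .seq p q => p.setsA a || q.setsA a
  | .ite _ p q => p.setsA a || q.setsA a
  | .loop _ p => p.setsA a
  | _ => false

/-- Whether the program may draw random numbers. -/
def Prog.draws : Prog → Bool
  | .gauss _ => true
  | .seq p q => p.draws || q.draws
  | .ite _ p q => p.draws || q.draws
  | .loop _ p => p.draws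
  | _ => false

/-- `s'` agrees with `s` except possibly at the places that `p` writes to. -/
structure Frame (p : Prog) (s s' : Store) : Prop where
  idx : ∀ r, p.setsI r = false → s'.idx r = s.idx r
  real : ∀ r, p.setsR r = false → s'.real r = s.real r
  arr : ∀ a, p.setsA a = false → s'.arr a = s.arr a
  drawn : p.draws = false → s'.drawn = s.drawn

theorem Frame.refl (p : Prog) (s : Store) : Frame p s s :=
  ⟨fun _ _ => rfl, fun _ _ => rfl, fun _ _ => rfl, fun _ => rfl⟩

theorem Frame.trans {p : Prog} {s s' s'' : Store} (h : Frame p s s') (h' : Frame p s' s'') :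
    Frame p s s'' :=
  ⟨fun r hr => (h'.idx r hr).trans (h.idx r hr), fun r hr => (h'.real r hr).trans (h.real r hr),
    fun a ha => (h'.arr a ha).trans (h.arr a ha), fun hd => (h'.drawn hd).trans (h.drawn hd)⟩

theorem Frame.weaken {p q : Prog} {s s' : Store} (h : Frame p s s')
    (hI : ∀ r, q.setsI r = false → p.setsI r = false)
    (hR : ∀ r, q.setsR r = false → p.setsR r = false)
    (hA : ∀ r, q.setsA r = false → p.setsA r = false)
    (hD : q.draws = false → p.draws = false) : Frame q s s' :=
  ⟨fun r hr => h.idx r (hI r hr), fun r hr => h.real r (hR r hr),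
    fun r hr => h.arr r (hA r hr), fun hr => h.drawn (hD hr)⟩

/-- Write sets are over-approximated by computable Booleans on the syntax. For concrete programs
every later side condition of the form "this register is untouched" is therefore closed by `rfl`. -/
theorem Exec.frame {ω : ℕ → ℝ} {p : Prog} {s s' : Store} {k : ℕ} (h : Exec ω p s k s') :
    Frame p s s' := by
  induction h with
  | skip s => exact Frame.refl _ _
  | setI r e s =>
    refine ⟨fun r' hr => ?_, fun _ _ => rfl, fun _ _ => rfl, fun _ => rfl⟩
    simp only [Prog.setsI, beq_eq_false_iff_ne] at hr
    simp [Store.setI, Function.update_of_ne (Ne.symm hr)]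
  | setR r e s =>
    refine ⟨fun _ _ => rfl, fun r' hr => ?_, fun _ _ => rfl, fun _ => rfl⟩
    simp only [Prog.setsR, beq_eq_false_iff_ne] at hr
    simp [Store.setR, Function.update_of_ne (Ne.symm hr)]
  | put a i j e s =>
    refine ⟨fun _ _ => rfl, fun _ _ => rfl, fun a' ha => ?_, fun _ => rfl⟩
    simp only [Prog.setsA, beq_eq_false_iff_ne] at ha
    funext i' j'
    simp [Store.put, Ne.symm ha]
  | gauss r s =>
    refine ⟨fun _ _ => rfl, fun r' hr => ?_, fun _ _ => rfl, fun hd => ?_⟩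
    · simp only [Prog.setsR, beq_eq_false_iff_ne] at hr
      simp [Store.setR, Function.update_of_ne (Ne.symm hr)]
    · simp [Prog.draws] at hd
  | seq _ _ ih ih' =>
    refine (ih.weaken ?_ ?_ ?_ ?_).trans (ih'.weaken ?_ ?_ ?_ ?_) <;>
      simp +contextual [Prog.setsI, Prog.setsR, Prog.setsA, Prog.draws]
  | iteTrue _ _ ih =>
    refine ih.weaken ?_ ?_ ?_ ?_ <;>
      simp +contextual [Prog.setsI, Prog.setsR, Prog.setsA, Prog.draws]
  | iteFalse _ _ ih =>
    refine ih.weaken ?_ ?_ ?_ ?_ <;>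
      simp +contextual [Prog.setsI, Prog.setsR, Prog.setsA, Prog.draws]
  | loopTrue _ _ _ ih ih' =>
    refine (ih.weaken ?_ ?_ ?_ ?_).trans ih' <;>
      simp +contextual [Prog.setsI, Prog.setsR, Prog.setsA, Prog.draws]
  | loopFalse _ => exact Frame.refl _ _

variable {ω : ℕ → ℝ} {p q : Prog} {s : Store} {Q Q' : ℕ → Store → Prop}

theorem WP.mono (h : WP ω p s Q) (hQ : ∀ k s', Q k s' → Q' k s') : WP ω p s Q' := by
  obtain ⟨k, s', he, hq⟩ := h
  exact ⟨k, s', he, hQ _ _ hq⟩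

theorem WP.frame (h : WP ω p s Q) : WP ω p s (fun k s' => Q k s' ∧ Frame p s s') := by
  obtain ⟨k, s', he, hq⟩ := h
  exact ⟨k, s', he, hq, he.frame⟩

/-- Consequence rule with the frame of the program made available. -/
theorem WP.mono_frame (h : WP ω p s Q) (hQ : ∀ k s', Frame p s s' → Q k s' → Q' k s') :
    WP ω p s Q' :=
  h.frame.mono fun k s' h => hQ k s' h.2 h.1

theorem wp_skip (h : Q 1 s) : WP ω .skip s Q := ⟨_, _, .skip s, h⟩

theorem wp_setI {r : ℕ} {e : IExpr} (h : Q (e.cost + 1) (s.setI r (e.eval s))) :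
    WP ω (.setI r e) s Q := ⟨_, _, .setI r e s, h⟩

theorem wp_setR {r : ℕ} {e : RExpr} (h : Q (e.cost + 1) (s.setR r (e.eval s))) :
    WP ω (.setR r e) s Q := ⟨_, _, .setR r e s, h⟩

theorem wp_put {a : ℕ} {i j : IExpr} {e : RExpr}
    (h : Q (i.cost + j.cost + e.cost + 1) (s.put a (i.eval s) (j.eval s) (e.eval s))) :
    WP ω (.put a i j e) s Q := ⟨_, _, .put a i j e s, h⟩

theorem wp_gauss {r : ℕ} (h : Q 1 { s.setR r (ω s.drawn) with drawn := s.drawn + 1 }) :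
    WP ω (.gauss r) s Q := ⟨_, _, .gauss r s, h⟩

theorem wp_seq (h : WP ω p s fun k s' => WP ω q s' fun l s'' => Q (k + l) s'') :
    WP ω (.seq p q) s Q := by
  obtain ⟨k, s', he, l, s'', he', hq⟩ := h
  exact ⟨_, _, .seq he he', hq⟩

theorem wp_ite {b : Test} (h : b.eval s → WP ω p s fun k s' => Q (b.cost + k) s')
    (h' : ¬ b.eval s → WP ω q s fun k s' => Q (b.cost + k) s') : WP ω (.ite b p q) s Q := by
  by_cases hb : b.eval s
  · obtain ⟨k, s', he, hq⟩ := h hb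
    exact ⟨_, _, .iteTrue hb he, hq⟩
  · obtain ⟨k, s', he, hq⟩ := h' hb
    exact ⟨_, _, .iteFalse hb he, hq⟩

/-- A `while` loop that ends after at most `N` rounds; the invariant carries the number of rounds
and the number of steps spent so far. -/
theorem wp_loop {b : Test} (Inv : ℕ → ℕ → Store → Prop) (N : ℕ)
    (h0 : Inv 0 0 s)
    (hstep : ∀ i K s', Frame (.loop b p) s s' → Inv i K s' → b.eval s' →
      i < N ∧ WP ω p s' fun k s'' => Inv (i + 1) (K + b.cost + k) s'')
    (hQ : ∀ i K s', Frame (.loop b p) s s' → Inv i K s' → ¬ b.eval s' → i ≤ N →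
      Q (K + b.cost) s') : WP ω (.loop b p) s Q := by
  -- Induction on the number `d` of rounds still allowed. At `d = 0` the test must fail, since a
  -- true test would give `N < N`.
  have key : ∀ d i K s', i + d = N → Frame (.loop b p) s s' → Inv i K s' →
      WP ω (.loop b p) s' fun k s'' => Q (K + k) s'' := by
    intro d
    induction d with
    | zero =>
      intro i K s' hi hF hI
      by_cases hb : b.eval s'
      · have := (hstep i K s' hF hI hb).1
        omega
      · exact ⟨_, _, .loopFalse hb, hQ i K s' hF hI hb (by omega)⟩
    | succ d ih =>
      intro i K s' hi hF hI
      by_cases hb : b.eval s'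
      · obtain ⟨k, s'', he, hI'⟩ := (hstep i K s' hF hI hb).2
        have hF' : Frame (.loop b p) s' s'' := he.frame.weaken (fun _ h => h) (fun _ h => h)
          (fun _ h => h) (fun h => h)
        obtain ⟨l, s₃, he', hq⟩ := ih (i + 1) _ s'' (by omega) (hF.trans hF') hI'
        refine ⟨_, _, .loopTrue hb he he', ?_⟩
        simpa [add_assoc] using hq
      · exact ⟨_, _, .loopFalse hb, hQ i K s' hF hI hb (by omega)⟩
  simpa using key N 0 0 s (by omega) (Frame.refl _ _) h0

/-- `for r = 0, …, (rN) - 1 do p`. -/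
def Prog.forTo (r rN : ℕ) (p : Prog) : Prog :=
  .seq (.setI r (.lit 0))
    (.loop (.idxLt (.reg r) (.reg rN)) (.seq p (.setI r (.add (.reg r) (.lit 1)))))

/-- The rule for `for` loops; the invariant carries the value of the loop counter and the number of
steps spent so far. -/
theorem wp_forTo {r rN N : ℕ} (Inv : ℕ → ℕ → Store → Prop) (hN : s.idx rN = N)
    (hr : p.setsI r = false) (hrN : (Prog.forTo r rN p).setsI rN = false)
    (h0 : Inv 0 2 (s.setI r 0))
    (hstep : ∀ i K s', i < N → s'.idx r = i → Frame (Prog.forTo r rN p) s s' → Inv i K s' →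
      WP ω p s' fun k s'' => Inv (i + 1) (K + k + 7) (s''.setI r (i + 1)))
    (hQ : ∀ K s', s'.idx r = N → Frame (Prog.forTo r rN p) s s' → Inv N K s' → Q (K + 3) s') :
    WP ω (Prog.forTo r rN p) s Q := by
  have hrr : r ≠ rN := by
    rintro rfl
    simp [Prog.forTo, Prog.setsI] at hrN
  have hF0 : Frame (Prog.forTo r rN p) s (s.setI r 0) := by
    refine ⟨fun r' h => ?_, fun _ _ => rfl, fun _ _ => rfl, fun _ => rfl⟩
    simp only [Prog.forTo, Prog.setsI, Bool.or_eq_false_iff, beq_eq_false_iff_ne] at h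
    simp [Store.setI, Function.update_of_ne (Ne.symm h.1)]
  have hFl : ∀ s', Frame (.loop (.idxLt (.reg r) (.reg rN))
      (.seq p (.setI r (.add (.reg r) (.lit 1))))) (s.setI r 0) s' →
      Frame (Prog.forTo r rN p) s s' := by
    intro s' h
    refine hF0.trans (h.weaken ?_ ?_ ?_ ?_) <;>
      simp +contextual [Prog.forTo, Prog.setsI, Prog.setsR, Prog.setsA, Prog.draws]
  refine wp_seq (wp_setI ?_)
  simp only [IExpr.eval, IExpr.cost]
  -- The constants in the rule: initialising the counter costs 2, test and increment cost 3 + 4 = 7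
  -- per round, and the final failing test costs 3.
  refine wp_loop (fun i K s' => i ≤ N ∧ s'.idx r = i ∧ Inv i (K + 2) s') N ?_ ?_ ?_
  · exact ⟨Nat.zero_le _, by simp [Store.setI], h0⟩
  · rintro i K s' hF ⟨hi, hir, hI⟩ hb
    have hF' := hFl s' hF
    have hNs : s'.idx rN = N := (hF'.idx rN hrN).trans hN
    have hlt : i < N := by simpa [Test.eval, IExpr.eval, hir, hNs] using hb
    refine ⟨hlt, wp_seq ?_⟩
    refine (hstep i _ s' hlt hir hF' hI).mono_frame fun k s'' hFp hI' => wp_setI ?_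
    have h1 : s''.idx r = i := (hFp.idx r hr).trans hir
    simp only [IExpr.eval, IExpr.cost, h1]
    refine ⟨hlt, by simp [Store.setI], ?_⟩
    convert hI' using 1
    simp [Test.cost, IExpr.cost]
    ring
  · rintro i K s' hF ⟨hi, hir, hI⟩ hb hiN
    have hF' := hFl s' hF
    have hNs : s'.idx rN = N := (hF'.idx rN hrN).trans hN
    have hge : i = N := by
      have : ¬ i < N := by simpa [Test.eval, IExpr.eval, hir, hNs] using hb
      omega
    subst hge
    have := hQ (K + 2) s' hir hF' hI
    convert this using 1
    simp [Test.cost, IExpr.cost]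
    ring

@[simp] theorem Store.setI_idx (s : Store) (r v r' : ℕ) :
    (s.setI r v).idx r' = if r' = r then v else s.idx r' := by
  simp [Store.setI, Function.update_apply]
@[simp] theorem Store.setI_real (s : Store) (r v : ℕ) : (s.setI r v).real = s.real := rfl
@[simp] theorem Store.setI_arr (s : Store) (r v : ℕ) : (s.setI r v).arr = s.arr := rfl
@[simp] theorem Store.setI_drawn (s : Store) (r v : ℕ) : (s.setI r v).drawn = s.drawn := rfl
@[simp] theorem Store.setR_idx (s : Store) (r : ℕ) (v : ℝ) : (s.setR r v).idx = s.idx := rfl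
@[simp] theorem Store.setR_real (s : Store) (r : ℕ) (v : ℝ) (r' : ℕ) :
    (s.setR r v).real r' = if r' = r then v else s.real r' := by
  simp [Store.setR, Function.update_apply]
@[simp] theorem Store.setR_arr (s : Store) (r : ℕ) (v : ℝ) : (s.setR r v).arr = s.arr := rfl
@[simp] theorem Store.setR_drawn (s : Store) (r : ℕ) (v : ℝ) :
    (s.setR r v).drawn = s.drawn := rfl
@[simp] theorem Store.put_idx (s : Store) (a i j : ℕ) (v : ℝ) : (s.put a i j v).idx = s.idx := rfl
@[simp] theorem Store.put_real (s : Store) (a i j : ℕ) (v : ℝ) :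
    (s.put a i j v).real = s.real := rfl
@[simp] theorem Store.put_arr (s : Store) (a i j : ℕ) (v : ℝ) (a' i' j' : ℕ) :
    (s.put a i j v).arr a' i' j' =
      if a' = a ∧ i' = i ∧ j' = j then v else s.arr a' i' j' := rfl
@[simp] theorem Store.put_drawn (s : Store) (a i j : ℕ) (v : ℝ) :
    (s.put a i j v).drawn = s.drawn := rfl

end RealRAM

/-! ### Loops that sum an expression or fill an array. -/

namespace RealRAM

variable {ω : ℕ → ℝ} {p q : Prog} {s : Store} {Q Q' : ℕ → Store → Prop}

theorem Frame.setI_right {p : Prog} {s s' : Store} {r v : ℕ} (h : Frame p s s')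
    (hr : p.setsI r = true) : Frame p s (s'.setI r v) := by
  refine ⟨fun r' h' => ?_, h.real, h.arr, h.drawn⟩
  have : r' ≠ r := by rintro rfl; simp [hr] at h'
  simp [this, h.idx r' h']

theorem Frame.setR_right {p : Prog} {s s' : Store} {r : ℕ} {v : ℝ} (h : Frame p s s')
    (hr : p.setsR r = true) : Frame p s (s'.setR r v) := by
  refine ⟨h.idx, fun r' h' => ?_, h.arr, h.drawn⟩
  have : r' ≠ r := by rintro rfl; simp [hr] at h'
  simp [this, h.real r' h']

/-- `ra := ∑ ri < rN, e`. -/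
def Prog.sumTo (ri rN ra : ℕ) (e : RExpr) : Prog :=
  .seq (.setR ra (.lit 0)) (.forTo ri rN (.setR ra (.add (.reg ra) e)))

/-- The summands are fixed in advance as `f`. The expression only has to evaluate to `f i` in states
that differ from `s` where the loop itself may write. -/
theorem wp_sumTo {ri rN ra N : ℕ} {e : RExpr} (f : ℕ → ℝ) (hN : s.idx rN = N)
    (hne : ri ≠ rN)
    (he : ∀ i < N, ∀ s', Frame (.sumTo ri rN ra e) s s' → s'.idx ri = i → e.eval s' = f i)
    (hQ : ∀ k s', Frame (.sumTo ri rN ra e) s s' → k ≤ N * (e.cost + 10) + 7 →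
      s'.real ra = ∑ i ∈ Finset.range N, f i → Q k s') :
    WP ω (.sumTo ri rN ra e) s Q := by
  have hF0 : Frame (.sumTo ri rN ra e) s (s.setR ra 0) :=
    (Frame.refl _ s).setR_right (by simp [Prog.sumTo, Prog.setsR])
  have hFs : ∀ s', Frame (.forTo ri rN (.setR ra (.add (.reg ra) e))) (s.setR ra 0) s' →
      Frame (.sumTo ri rN ra e) s s' := by
    intro s' h
    refine hF0.trans (h.weaken ?_ ?_ ?_ ?_) <;>
      simp +contextual [Prog.sumTo, Prog.forTo, Prog.setsI, Prog.setsR, Prog.setsA, Prog.draws]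
  refine wp_seq (wp_setR ?_)
  simp only [RExpr.eval, RExpr.cost, Rat.cast_zero]
  refine wp_forTo (N := N) (fun i K s' => K ≤ i * (e.cost + 10) + 2 ∧
    s'.real ra = ∑ l ∈ Finset.range i, f l) (by simpa using hN) rfl
    (by simp [Prog.forTo, Prog.setsI, hne]) (by simp) ?_ ?_
  · rintro i K s' hi hir hF ⟨hK, hs⟩
    refine wp_setR ?_
    have hev := he i hi s' (hFs s' hF) hir
    refine ⟨?_, ?_⟩
    · simp only [RExpr.cost]
      have : (i + 1) * (e.cost + 10) = i * (e.cost + 10) + (e.cost + 10) := by ring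
      omega
    · simp [RExpr.eval, hev, hs, Finset.sum_range_succ]
  · rintro K s' - hF ⟨hK, hs⟩
    exact hQ _ s' (hFs s' hF) (by omega) hs

/-- `for ri < rN: a[ie, je] := e`. -/
def Prog.fillTo (ri rN a : ℕ) (ie je : IExpr) (e : RExpr) : Prog :=
  .forTo ri rN (.put a ie je e)

/-- The target cells are pairwise distinct, so each cell still has its original content when its
turn comes. The hypothesis on `e` may use this, which permits in-place updates. -/
theorem wp_fillTo {ri rN a N : ℕ} {ie je : IExpr} {e : RExpr} (f : ℕ → ℝ) (pi pj : ℕ → ℕ)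
    (hN : s.idx rN = N) (hne : ri ≠ rN)
    (hinj : ∀ i < N, ∀ i' < N, pi i = pi i' → pj i = pj i' → i = i')
    (hie : ∀ i < N, ∀ s', Frame (.fillTo ri rN a ie je e) s s' → s'.idx ri = i →
      ie.eval s' = pi i ∧ je.eval s' = pj i)
    (he : ∀ i < N, ∀ s', Frame (.fillTo ri rN a ie je e) s s' → s'.idx ri = i →
      s'.arr a (pi i) (pj i) = s.arr a (pi i) (pj i) → e.eval s' = f i)
    (hQ : ∀ k s', Frame (.fillTo ri rN a ie je e) s s' →
      k ≤ N * (ie.cost + je.cost + e.cost + 8) + 5 →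
      (∀ i < N, s'.arr a (pi i) (pj i) = f i) →
      (∀ x y, (∀ i < N, ¬ (x = pi i ∧ y = pj i)) → s'.arr a x y = s.arr a x y) → Q k s') :
    WP ω (.fillTo ri rN a ie je e) s Q := by
  refine wp_forTo (N := N) (fun i K s' => K ≤ i * (ie.cost + je.cost + e.cost + 8) + 2 ∧
    (∀ l < i, s'.arr a (pi l) (pj l) = f l) ∧
    (∀ x y, (∀ l < i, ¬ (x = pi l ∧ y = pj l)) → s'.arr a x y = s.arr a x y)) hN rfl
    (by simp [Prog.forTo, Prog.setsI, hne]) (by simp) ?_ ?_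
  · rintro i K s' hi hir hF ⟨hK, hf, ho⟩
    refine wp_put ?_
    obtain ⟨h1, h2⟩ := hie i hi s' hF hir
    have hev := he i hi s' hF hir (ho _ _ fun l hl ⟨h, h'⟩ =>
      absurd (hinj i hi l (by omega) h h') (by omega))
    rw [h1, h2, hev]
    refine ⟨?_, ?_, ?_⟩
    · have : (i + 1) * (ie.cost + je.cost + e.cost + 8) =
        i * (ie.cost + je.cost + e.cost + 8) + (ie.cost + je.cost + e.cost + 8) := by ring
      omega
    · intro l hl
      simp only [Store.setI_arr, Store.put_arr, true_and]
      split_ifs with h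
      · rw [hinj l (by omega) i hi h.1 h.2]
      · refine hf l ?_
        rcases Nat.lt_succ_iff_lt_or_eq.1 hl with h' | rfl
        · exact h'
        · exact absurd ⟨rfl, rfl⟩ h
    · intro x y hxy
      simp only [Store.setI_arr, Store.put_arr, true_and]
      rw [if_neg (hxy i (by omega))]
      exact ho x y fun l hl => hxy l (by omega)
  · rintro K s' - hF ⟨hK, hf, ho⟩
    exact hQ _ s' hF (by omega) hf ho

/-- `for ri < rN: a[ri, 0] := e`. -/
def Prog.fillVec (ri rN a : ℕ) (e : RExpr) : Prog := .fillTo ri rN a (.reg ri) (.lit 0) e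

theorem wp_fillVec {ri rN a N : ℕ} {e : RExpr} (f : ℕ → ℝ) (hN : s.idx rN = N) (hne : ri ≠ rN)
    (he : ∀ i < N, ∀ s', Frame (.fillVec ri rN a e) s s' → s'.idx ri = i →
      s'.arr a i 0 = s.arr a i 0 → e.eval s' = f i)
    (hQ : ∀ k s', Frame (.fillVec ri rN a e) s s' → k ≤ N * (e.cost + 10) + 5 →
      (∀ i < N, s'.arr a i 0 = f i) → Q k s') :
    WP ω (.fillVec ri rN a e) s Q := by
  refine wp_fillTo f id (fun _ => 0) hN hne (fun i _ i' _ h _ => h)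
    (fun i _ s' _ h => ⟨h, rfl⟩) he ?_
  intro k s' hF hk hf _
  refine hQ k s' hF (hk.trans (le_of_eq ?_)) hf
  simp only [IExpr.cost]
  ring

/-- `for ri < rN: a[rk, ri] := e`. -/
def Prog.fillRow (ri rN a rk : ℕ) (e : RExpr) : Prog := .fillTo ri rN a (.reg rk) (.reg ri) e

theorem wp_fillRow {ri rN a rk N : ℕ} {e : RExpr} (f : ℕ → ℝ) (hN : s.idx rN = N) (hne : ri ≠ rN)
    (hne' : ri ≠ rk)
    (he : ∀ i < N, ∀ s', Frame (.fillRow ri rN a rk e) s s' → s'.idx ri = i → e.eval s' = f i)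
    (hQ : ∀ k s', Frame (.fillRow ri rN a rk e) s s' → k ≤ N * (e.cost + 10) + 5 →
      (∀ i < N, s'.arr a (s.idx rk) i = f i) →
      (∀ l, l ≠ s.idx rk → s'.arr a l = s.arr a l) → Q k s') :
    WP ω (.fillRow ri rN a rk e) s Q := by
  refine wp_fillTo f (fun _ => s.idx rk) id hN hne (fun i _ i' _ _ h => h)
    (fun i _ s' hF h => ⟨hF.idx rk ?_, h⟩) (fun i hi s' hF h _ => he i hi s' hF h) ?_
  · simp [Prog.fillTo, Prog.forTo, Prog.setsI, hne']
  intro k s' hF hk hf ho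
  refine hQ k s' hF (hk.trans (le_of_eq ?_)) hf fun l hl => ?_
  · simp only [IExpr.cost]
    ring
  · funext y
    exact ho l y fun i _ h => hl h.1

/-- The first `n` entries of a sequence as a vector. -/
noncomputable def vecOf (n : ℕ) (x : ℕ → ℝ) : EuclideanSpace ℝ (Fin n) :=
  WithLp.toLp 2 fun i => x i

@[simp] theorem vecOf_apply (n : ℕ) (x : ℕ → ℝ) (i : Fin n) : vecOf n x i = x i := rfl

theorem vecOf_congr {n : ℕ} {x y : ℕ → ℝ} (h : ∀ i < n, x i = y i) : vecOf n x = vecOf n y := by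
  ext i
  exact h i i.2

theorem inner_vecOf (n : ℕ) (x y : ℕ → ℝ) :
    inner ℝ (vecOf n x) (vecOf n y) = ∑ i ∈ Finset.range n, x i * y i := by
  rw [PiLp.inner_apply, Finset.sum_range]
  simp [mul_comm]

/-- Column `0` of the array `a`, as a vector. -/
noncomputable def Store.vec (s : Store) (a n : ℕ) : EuclideanSpace ℝ (Fin n) :=
  vecOf n fun i => s.arr a i 0

end RealRAM

namespace RealRAM

variable {ω : ℕ → ℝ} {p q : Prog} {s : Store} {Q Q' : ℕ → Store → Prop}

/-! ### Gram-Schmidt orthogonalization on the machine -/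

/-- The first `q` rows of `A` are an orthonormal basis of the orthogonal complement of `V`. -/
structure OrthoBasis (n q : ℕ) (A : ℕ → ℕ → ℝ) (V : Submodule ℝ (EuclideanSpace ℝ (Fin n))) :
    Prop where
  orthonormal : Orthonormal ℝ fun k : Fin q => vecOf n (A k)
  mem_iff : ∀ u, u ∈ V ↔ ∀ k < q, inner ℝ (vecOf n (A k)) u = 0

theorem OrthoBasis.le {n q : ℕ} {A : ℕ → ℕ → ℝ} {V : Submodule ℝ (EuclideanSpace ℝ (Fin n))}
    (h : OrthoBasis n q A V) : q ≤ n := by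
  simpa using h.orthonormal.linearIndependent.fintype_card_le_finrank

theorem OrthoBasis.inner_self {n q : ℕ} {A : ℕ → ℕ → ℝ}
    {V : Submodule ℝ (EuclideanSpace ℝ (Fin n))} (h : OrthoBasis n q A V) {k : ℕ} (hk : k < q) :
    inner ℝ (vecOf n (A k)) (vecOf n (A k)) = 1 := by
  have := h.orthonormal.1 ⟨k, hk⟩
  rw [real_inner_self_eq_norm_sq]
  simp only at this
  rw [this]
  norm_num

theorem OrthoBasis.inner_ne {n q : ℕ} {A : ℕ → ℕ → ℝ}
    {V : Submodule ℝ (EuclideanSpace ℝ (Fin n))} (h : OrthoBasis n q A V) {k l : ℕ} (hk : k < q)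
    (hl : l < q) (hkl : k ≠ l) : inner ℝ (vecOf n (A k)) (vecOf n (A l)) = 0 :=
  h.orthonormal.2 (i := ⟨k, hk⟩) (j := ⟨l, hl⟩) (by simpa using hkl)

theorem OrthoBasis.row_mem {n q : ℕ} {A : ℕ → ℕ → ℝ}
    {V : Submodule ℝ (EuclideanSpace ℝ (Fin n))} (h : OrthoBasis n q A V) {k : ℕ} (hk : k < q) :
    vecOf n (A k) ∈ Vᗮ :=
  (Submodule.mem_orthogonal' _ _).2 fun u hu => (h.mem_iff u).1 hu k hk

/-- Subtract from the vector in the array `5` its projections on the rows of the array `4`. -/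
def orthP : Prog :=
  .forTo 9 4 (.seq
    (.sumTo 8 0 2 (.mul (.get 5 (.reg 8) (.lit 0)) (.get 4 (.reg 9) (.reg 8))))
    (.fillVec 8 0 5 (.sub (.get 5 (.reg 8) (.lit 0)) (.mul (.reg 2) (.get 4 (.reg 9) (.reg 8))))))

/-- This is modified Gram-Schmidt: the coefficient of each row is taken from the current remainder.
The remainder becomes orthogonal to all rows, hence lies in `V`, and what was removed lies in `Vᗮ`;
these two facts characterise the projection. -/
theorem wp_orthP {n q : ℕ} {V : Submodule ℝ (EuclideanSpace ℝ (Fin n))} (hn : s.idx 0 = n)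
    (hq : s.idx 4 = q) (hb : OrthoBasis n q (s.arr 4) V)
    (hQ : ∀ k s', Frame orthP s s' → k ≤ q * (36 * n + 19) + 5 →
      s'.vec 5 n = V.starProjection (s.vec 5 n) → Q k s') : WP ω orthP s Q := by
  refine wp_forTo (N := q) (fun i K s' => K ≤ i * (36 * n + 19) + 2 ∧
    (∀ l < i, inner ℝ (vecOf n (s.arr 4 l)) (s'.vec 5 n) = 0) ∧
    s.vec 5 n - s'.vec 5 n ∈ Vᗮ) hq rfl rfl ?_ ?_ ?_
  · refine ⟨by simp, by simp, ?_⟩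
    simp [Store.vec]
  · rintro i K s₁ hi hir hF ⟨hK, horth, hmem⟩
    refine wp_seq (wp_sumTo (fun l => s₁.arr 5 l 0 * s.arr 4 i l) ((hF.idx 0 rfl).trans hn)
      (by decide) ?_ ?_)
    · intro l _ s₂ hF₂ hl
      simp only [RExpr.eval, IExpr.eval, hl]
      rw [hF₂.arr 5 rfl, hF₂.arr 4 rfl, hF₂.idx 9 rfl, hir, hF.arr 4 rfl]
    intro k₁ s₂ hF₂ hk₁ hs₂
    have hs₂' : s₂.real 2 = inner ℝ (s₁.vec 5 n) (vecOf n (s.arr 4 i)) := by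
      rw [hs₂, Store.vec, inner_vecOf]
    refine wp_fillVec (fun l => s₁.arr 5 l 0 - s₂.real 2 * s.arr 4 i l)
      (((hF₂.idx 0 rfl).trans (hF.idx 0 rfl)).trans hn) (by decide) ?_ ?_
    · intro l _ s₃ hF₃ hl hc
      simp only [RExpr.eval, IExpr.eval, hl]
      rw [hF₃.real 2 rfl, hc, hF₃.arr 4 rfl, hF₃.idx 9 rfl, hF₂.arr 4 rfl, hF₂.arr 5 rfl,
        hF₂.idx 9 rfl, hir, hF.arr 4 rfl]
    intro k₂ s₃ hF₃ hk₂ hs₃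
    have hv : s₃.vec 5 n = s₁.vec 5 n - s₂.real 2 • vecOf n (s.arr 4 i) := by
      ext l
      simpa [Store.vec] using hs₃ l l.2
    refine ⟨?_, ?_, ?_⟩
    · simp only [RExpr.cost, IExpr.cost] at hk₁ hk₂
      have : (i + 1) * (36 * n + 19) = i * (36 * n + 19) + (36 * n + 19) := by ring
      omega
    · intro l hl
      change inner ℝ _ (s₃.vec 5 n) = 0
      rw [hv, inner_sub_right, inner_smul_right, hs₂']
      rcases Nat.lt_succ_iff_lt_or_eq.1 hl with h | rfl
      · rw [horth l h, hb.inner_ne (by omega) hi (by omega)]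
        ring
      · rw [hb.inner_self hi, real_inner_comm]
        ring
    · change s.vec 5 n - s₃.vec 5 n ∈ Vᗮ
      have : s.vec 5 n - s₃.vec 5 n =
          (s.vec 5 n - s₁.vec 5 n) + s₂.real 2 • vecOf n (s.arr 4 i) := by
        rw [hv]; abel
      rw [this]
      exact add_mem hmem (Submodule.smul_mem _ _ (hb.row_mem hi))
  · rintro K s₁ - hF ⟨hK, horth, hmem⟩
    refine hQ _ s₁ hF (by omega) ?_
    exact (Submodule.eq_starProjection_of_mem_orthogonal ((hb.mem_iff _).2 horth) hmem).symm

/-- Add the vector in the array `5` to the orthonormal family in the array `4`. -/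
def insertP : Prog :=
  .seq orthP <| .seq
    (.sumTo 8 0 2 (.mul (.get 5 (.reg 8) (.lit 0)) (.get 5 (.reg 8) (.lit 0))))
    (.ite (.realLe (.reg 2) (.lit 0)) .skip
      (.seq (.setR 2 (.sqrt (.reg 2))) <| .seq
        (.fillRow 8 0 4 4 (.div (.get 5 (.reg 8) (.lit 0)) (.reg 2)))
        (.setI 4 (.add (.reg 4) (.lit 1)))))

/-- A vector with zero projection on `V` is orthogonal to `V`, so the new constraint is redundant
and the basis stays as it is. -/
theorem OrthoBasis.of_proj_eq_zero {n q : ℕ} {A : ℕ → ℕ → ℝ}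
    {V V' : Submodule ℝ (EuclideanSpace ℝ (Fin n))} (h : OrthoBasis n q A V)
    {w : EuclideanSpace ℝ (Fin n)} (hV' : ∀ u, u ∈ V' ↔ u ∈ V ∧ inner ℝ w u = 0)
    (hw : V.starProjection w = 0) : OrthoBasis n q A V' := by
  have : V' = V := by
    ext u
    rw [hV', and_iff_left_iff_imp]
    intro hu
    rw [Submodule.starProjection_apply_eq_zero_iff] at hw
    exact Submodule.inner_left_of_mem_orthogonal hu hw
  rwa [this]

/-- On `V` the functionals `⟨w, ·⟩` and `⟨r, ·⟩` agree for the projection `r` of `w`, so `r` may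
replace `w` as the constraint. Being in `V`, it is orthogonal to all older rows. -/
theorem OrthoBasis.succ {n q : ℕ} {A A' : ℕ → ℕ → ℝ}
    {V V' : Submodule ℝ (EuclideanSpace ℝ (Fin n))} (h : OrthoBasis n q A V)
    {w : EuclideanSpace ℝ (Fin n)} (hV' : ∀ u, u ∈ V' ↔ u ∈ V ∧ inner ℝ w u = 0)
    (hw : V.starProjection w ≠ 0) (hold : ∀ k < q, A' k = A k)
    (hnew : vecOf n (A' q) = ‖V.starProjection w‖⁻¹ • V.starProjection w) :
    OrthoBasis n (q + 1) A' V' := by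
  set r := V.starProjection w with hr
  have hrV : r ∈ V := Submodule.starProjection_apply_mem V w
  have hrn : ‖r‖ ≠ 0 := norm_ne_zero_iff.2 hw
  have h0 : ∀ k < q, inner ℝ (vecOf n (A k)) r = 0 := (h.mem_iff r).1 hrV
  refine ⟨⟨?_, ?_⟩, ?_⟩
  · rintro ⟨k, hk⟩
    rcases Nat.lt_succ_iff_lt_or_eq.1 hk with hk' | rfl
    · simp only [hold k hk']
      exact h.orthonormal.1 ⟨k, hk'⟩
    · simp only [hnew, norm_smul, norm_inv, norm_norm]
      exact inv_mul_cancel₀ hrn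
  · rintro ⟨k, hk⟩ ⟨l, hl⟩ hkl
    have hkl' : k ≠ l := by simpa using hkl
    simp only
    rcases Nat.lt_succ_iff_lt_or_eq.1 hk with hk' | rfl <;>
    rcases Nat.lt_succ_iff_lt_or_eq.1 hl with hl' | rfl
    · rw [hold k hk', hold l hl']
      exact h.inner_ne hk' hl' hkl'
    · rw [hold k hk', hnew, inner_smul_right, h0 k hk', mul_zero]
    · rw [hold l hl', hnew, real_inner_comm, inner_smul_right, h0 l hl', mul_zero]
    · exact absurd rfl hkl'
  · intro u
    have hwr : u ∈ V → inner ℝ w u = inner ℝ r u := by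
      intro hu
      have := Submodule.starProjection_inner_eq_zero (K := V) w u hu
      rw [inner_sub_left] at this
      linarith
    have hq : inner ℝ (vecOf n (A' q)) u = 0 ↔ inner ℝ r u = 0 := by
      rw [hnew, real_inner_smul_left, mul_eq_zero]
      simp [hrn]
    rw [hV']
    constructor
    · rintro ⟨hu, hu'⟩ k hk
      rcases Nat.lt_succ_iff_lt_or_eq.1 hk with hk' | rfl
      · rw [hold k hk']; exact (h.mem_iff u).1 hu k hk'
      · rw [hq, ← hwr hu, hu']
    · intro hu
      have huV : u ∈ V := (h.mem_iff u).2 fun k hk => by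
        rw [← hold k hk]; exact hu k (by omega)
      exact ⟨huV, by rw [hwr huV]; exact hq.1 (hu q (by omega))⟩

/-- Linear dependence is detected by comparing the squared norm of the remainder with zero, which is
decisive in exact arithmetic. Orthonormality gives `q ≤ n`, hence quadratic cost. -/
theorem wp_insertP {n q : ℕ} {V V' : Submodule ℝ (EuclideanSpace ℝ (Fin n))} (hn : s.idx 0 = n)
    (hn1 : 1 ≤ n) (hq : s.idx 4 = q) (hb : OrthoBasis n q (s.arr 4) V)
    (hV' : ∀ u, u ∈ V' ↔ u ∈ V ∧ inner ℝ (s.vec 5 n) u = 0)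
    (hQ : ∀ k s', Frame insertP s s' → k ≤ 120 * n ^ 2 →
      OrthoBasis n (s'.idx 4) (s'.arr 4) V' → Q k s') : WP ω insertP s Q := by
  suffices h : WP ω insertP s fun k s' => k ≤ 120 * n ^ 2 ∧
      OrthoBasis n (s'.idx 4) (s'.arr 4) V' from
    h.mono_frame fun k s' hF h => hQ k s' hF h.1 h.2
  have hqn := hb.le
  have hcost : ∀ k, k ≤ q * (36 * n + 19) + 5 + (n * 17 + 7) + (n * 15 + 20) →
      k ≤ 120 * n ^ 2 := by
    intro k hk
    nlinarith
  refine wp_seq (wp_orthP hn hq hb ?_)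
  intro k₁ s₁ hF₁ hk₁ hv₁
  refine wp_seq (wp_sumTo (fun l => s₁.arr 5 l 0 * s₁.arr 5 l 0) ((hF₁.idx 0 rfl).trans hn)
    (by decide) ?_ ?_)
  · intro l _ s₂ hF₂ hl
    simp only [RExpr.eval, IExpr.eval, hl]
    rw [hF₂.arr 5 rfl]
  intro k₂ s₂ hF₂ hk₂ hs₂
  have hs₂' : s₂.real 2 = ‖V.starProjection (s.vec 5 n)‖ ^ 2 := by
    rw [hs₂, ← hv₁, ← real_inner_self_eq_norm_sq, Store.vec, inner_vecOf]
  have hA4 : s₂.arr 4 = s.arr 4 := (hF₂.arr 4 rfl).trans (hF₁.arr 4 rfl)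
  have hq₂ : s₂.idx 4 = q := ((hF₂.idx 4 rfl).trans (hF₁.idx 4 rfl)).trans hq
  simp only [RExpr.cost, IExpr.cost] at hk₂
  refine wp_ite (fun hle => ?_) (fun hle => ?_)
  · refine wp_skip ⟨hcost _ ?_, ?_⟩
    · simp only [Test.cost, RExpr.cost]; omega
    · rw [hA4, hq₂]
      refine hb.of_proj_eq_zero hV' ?_
      simp only [Test.eval, RExpr.eval, hs₂', Rat.cast_zero] at hle
      have : ‖V.starProjection (s.vec 5 n)‖ = 0 := by nlinarith [norm_nonneg (V.starProjection (s.vec 5 n))]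
      exact norm_eq_zero.1 this
  · have hne : V.starProjection (s.vec 5 n) ≠ 0 := by
      intro h0
      apply hle
      simp [Test.eval, RExpr.eval, hs₂', h0]
    refine wp_seq (wp_setR ?_)
    set s₃ := s₂.setR 2 (RExpr.eval s₂ (.sqrt (.reg 2))) with hs₃
    have hr₃ : s₃.real 2 = ‖V.starProjection (s.vec 5 n)‖ := by
      simp [hs₃, RExpr.eval, hs₂']
    refine wp_seq (wp_fillRow (fun l => s₁.arr 5 l 0 / s₃.real 2) (N := n)
      (((hF₂.idx 0 rfl).trans (hF₁.idx 0 rfl)).trans hn) (by decide) (by decide) ?_ ?_)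
    · intro l _ s₄ hF₄ hl
      simp only [RExpr.eval, IExpr.eval, hl]
      rw [hF₄.arr 5 rfl, hF₄.real 2 rfl]
      simp only [hs₃, Store.setR_arr, hF₂.arr 5 rfl]
    intro k₄ s₄ hF₄ hk₄ hrow hold
    have hq₃ : s₃.idx 4 = q := hq₂
    have hA3 : s₃.arr 4 = s.arr 4 := hA4
    rw [hq₃] at hrow hold
    refine wp_setI ⟨hcost _ ?_, ?_⟩
    · simp only [RExpr.cost, IExpr.cost, Test.cost] at hk₄ ⊢; omega
    · have hq₄ : s₄.idx 4 = q := (hF₄.idx 4 rfl).trans hq₃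
      simp only [IExpr.eval, hq₄, Store.setI_idx, Store.setI_arr, if_true]
      refine hb.succ hV' hne (fun k hk => by rw [hold k (by omega), hA3]) ?_
      rw [← hr₃, ← hv₁]
      ext l
      simp [Store.vec, hrow l l.2, div_eq_inv_mul]

end RealRAM

/-! ### The trajectory as a function of the draws -/

namespace EdgeWalkData

variable {n m : ℕ} (D : EdgeWalkData n m)

/-- The trajectory of Edge-Walk driven by the draws `ω`: iteration `t` projects the vector of the
`n` draws from position `t * n` on to the free space. -/
noncomputable def path (ω : ℕ → ℝ) : ℕ → EuclideanSpace ℝ (Fin n)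
  | 0 => D.x₀
  | t + 1 => path ω t + D.γ • (D.freeSpace (path ω t)).starProjection
      (RealRAM.vecOf n fun i => ω (t * n + i))

theorem mem_nearVar {x : EuclideanSpace ℝ (Fin n)} {i : Fin n} :
    i ∈ D.nearVar x ↔ 1 - D.δ ≤ |x i| := by simp [nearVar]

theorem mem_nearDisc {x : EuclideanSpace ℝ (Fin n)} {j : Fin m} :
    j ∈ D.nearDisc x ↔ D.c j - D.δ ≤ |inner ℝ (x - D.x₀) (D.v j)| := by simp [nearDisc]

theorem mem_orthTo {I : Finset (Fin n)} {J : Finset (Fin m)} {u : EuclideanSpace ℝ (Fin n)} :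
    u ∈ D.orthTo I J ↔ (∀ i ∈ I, u i = 0) ∧ ∀ j ∈ J, inner ℝ u (D.v j) = 0 := Iff.rfl

theorem apply_add_eq_of_mem_freeSpace {x u : EuclideanSpace ℝ (Fin n)} (hu : u ∈ D.freeSpace x)
    {i : Fin n} (hi : i ∈ D.nearVar x) (r : ℝ) : (x + r • u) i = x i := by
  simp [((D.mem_orthTo).1 hu).1 i hi]

theorem inner_add_eq_of_mem_freeSpace {x u : EuclideanSpace ℝ (Fin n)} (hu : u ∈ D.freeSpace x)
    {j : Fin m} (hj : j ∈ D.nearDisc x) (r : ℝ) :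
    inner ℝ (x + r • u - D.x₀) (D.v j) = inner ℝ (x - D.x₀) (D.v j) := by
  rw [add_sub_right_comm, inner_add_left, real_inner_smul_left, ((D.mem_orthTo).1 hu).2 j hj]
  ring

/-- Frozen quantities do not move. This monotonicity is what makes an incrementally grown basis
correct and limits the number of insertions. -/
theorem nearVar_subset {x u : EuclideanSpace ℝ (Fin n)} (hu : u ∈ D.freeSpace x) (r : ℝ) :
    D.nearVar x ⊆ D.nearVar (x + r • u) := by
  intro i hi
  rw [mem_nearVar, D.apply_add_eq_of_mem_freeSpace hu hi, ← mem_nearVar]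
  exact hi

theorem nearDisc_subset {x u : EuclideanSpace ℝ (Fin n)} (hu : u ∈ D.freeSpace x) (r : ℝ) :
    D.nearDisc x ⊆ D.nearDisc (x + r • u) := by
  intro i hi
  rw [mem_nearDisc, D.inner_add_eq_of_mem_freeSpace hu hi, ← mem_nearDisc]
  exact hi

theorem nearVar_path_subset (ω : ℕ → ℝ) (t : ℕ) :
    D.nearVar (D.path ω t) ⊆ D.nearVar (D.path ω (t + 1)) :=
  D.nearVar_subset (Submodule.starProjection_apply_mem _ _) _

theorem nearDisc_path_subset (ω : ℕ → ℝ) (t : ℕ) :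
    D.nearDisc (D.path ω t) ⊆ D.nearDisc (D.path ω (t + 1)) :=
  D.nearDisc_subset (Submodule.starProjection_apply_mem _ _) _

theorem mem_orthTo_insert_left {I : Finset (Fin n)} {J : Finset (Fin m)} {i : Fin n}
    {u : EuclideanSpace ℝ (Fin n)} :
    u ∈ D.orthTo (insert i I) J ↔ u ∈ D.orthTo I J ∧ u i = 0 := by
  simp only [mem_orthTo, Finset.mem_insert, forall_eq_or_imp]
  tauto

theorem mem_orthTo_insert_right {I : Finset (Fin n)} {J : Finset (Fin m)} {j : Fin m}
    {u : EuclideanSpace ℝ (Fin n)} :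
    u ∈ D.orthTo I (insert j J) ↔ u ∈ D.orthTo I J ∧ inner ℝ (D.v j) u = 0 := by
  simp only [mem_orthTo, Finset.mem_insert, forall_eq_or_imp, real_inner_comm (D.v j)]
  tauto

end EdgeWalkData

namespace RealRAM

variable {ω : ℕ → ℝ} {p q : Prog} {s : Store} {Q Q' : ℕ → Store → Prop} {n m : ℕ}

/-! ### The Edge-Walk program -/

/-- The input of Edge-Walk is stored in `s`. -/
structure Encodes (s : Store) (D : EdgeWalkData n m) (T : ℕ) : Prop where
  idx0 : s.idx 0 = n
  idx1 : s.idx 1 = m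
  idx2 : s.idx 2 = T
  real0 : s.real 0 = D.γ
  real1 : s.real 1 = D.δ
  arr0 : ∀ (j : Fin m) (i : Fin n), s.arr 0 j i = D.v j i
  arr1 : ∀ j : Fin m, s.arr 1 j 0 = D.c j
  arr2 : ∀ i : Fin n, s.arr 2 i 0 = D.x₀ i

theorem Encodes.of_frame {s s' : Store} {D : EdgeWalkData n m} {T : ℕ} (h : Encodes s D T)
    (hF : Frame p s s') (h0 : p.setsI 0 = false) (h1 : p.setsI 1 = false)
    (h2 : p.setsI 2 = false) (h3 : p.setsR 0 = false) (h4 : p.setsR 1 = false)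
    (h5 : p.setsA 0 = false) (h6 : p.setsA 1 = false) (h7 : p.setsA 2 = false) :
    Encodes s' D T where
  idx0 := (hF.idx 0 h0).trans h.idx0
  idx1 := (hF.idx 1 h1).trans h.idx1
  idx2 := (hF.idx 2 h2).trans h.idx2
  real0 := (hF.real 0 h3).trans h.real0
  real1 := (hF.real 1 h4).trans h.real1
  arr0 := by rw [hF.arr 0 h5]; exact h.arr0
  arr1 := by rw [hF.arr 1 h6]; exact h.arr1
  arr2 := by rw [hF.arr 2 h7]; exact h.arr2

open Classical in
/-- The walk is at `x`, the constraints in `I` and `J` have been processed, and the basis of their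
span is stored. -/
structure WalkState (s : Store) (D : EdgeWalkData n m) (x : EuclideanSpace ℝ (Fin n))
    (I : Finset (Fin n)) (J : Finset (Fin m)) : Prop where
  pos : s.vec 3 n = x
  flagVar : ∀ i : Fin n, s.arr 6 i 0 = if i ∈ I then 1 else 0
  flagDisc : ∀ j : Fin m, s.arr 7 j 0 = if j ∈ J then 1 else 0
  count : s.idx 5 = J.card
  basis : OrthoBasis n (s.idx 4) (s.arr 4) (D.orthTo I J)
  fail : s.idx 3 = 0

theorem WalkState.congr {s s' : Store} {D : EdgeWalkData n m} {x : EuclideanSpace ℝ (Fin n)}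
    {I : Finset (Fin n)} {J : Finset (Fin m)} (h : WalkState s D x I J)
    (h3 : s'.arr 3 = s.arr 3) (h6 : s'.arr 6 = s.arr 6) (h7 : s'.arr 7 = s.arr 7)
    (h4 : s'.arr 4 = s.arr 4) (i3 : s'.idx 3 = s.idx 3) (i4 : s'.idx 4 = s.idx 4)
    (i5 : s'.idx 5 = s.idx 5) : WalkState s' D x I J where
  pos := by rw [Store.vec, h3]; exact h.pos
  flagVar := by rw [h6]; exact h.flagVar
  flagDisc := by rw [h7]; exact h.flagDisc
  count := by rw [i5]; exact h.count
  basis := by rw [h4, i4]; exact h.basis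
  fail := by rw [i3]; exact h.fail

theorem WalkState.setI {s : Store} {D : EdgeWalkData n m} {x : EuclideanSpace ℝ (Fin n)}
    {I : Finset (Fin n)} {J : Finset (Fin m)} (h : WalkState s D x I J) {r v : ℕ} (hr : 5 < r) :
    WalkState (s.setI r v) D x I J := by
  refine h.congr rfl rfl rfl rfl ?_ ?_ ?_ <;> simp <;> omega

theorem WalkState.setR {s : Store} {D : EdgeWalkData n m} {x : EuclideanSpace ℝ (Fin n)}
    {I : Finset (Fin n)} {J : Finset (Fin m)} (h : WalkState s D x I J) {r : ℕ} {v : ℝ} :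
    WalkState (s.setR r v) D x I J :=
  h.congr rfl rfl rfl rfl rfl rfl rfl

/-- Handle the variable constraint whose number is in index register `7`. -/
def addVarP : Prog :=
  .seq (.put 6 (.reg 7) (.lit 0) (.lit 1)) <| .seq (.fillVec 8 0 5 (.lit 0)) <|
    .seq (.put 5 (.reg 7) (.lit 0) (.lit 1)) insertP

/-- Handle all variable constraints that are nearly hit. -/
def procVarP : Prog :=
  .forTo 7 0 <| .seq
    (.setR 3 (.sqrt (.mul (.get 3 (.reg 7) (.lit 0)) (.get 3 (.reg 7) (.lit 0))))) <|
    .ite (.realLe (.sub (.lit 1) (.reg 1)) (.reg 3))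
      (.ite (.realLe (.get 6 (.reg 7) (.lit 0)) (.lit 0)) addVarP .skip) .skip

theorem wp_addVarP {D : EdgeWalkData n m} {T : ℕ} {x : EuclideanSpace ℝ (Fin n)}
    {I : Finset (Fin n)} {J : Finset (Fin m)} (hn : 1 ≤ n) (hE : Encodes s D T)
    (hW : WalkState s D x I J) (i : Fin n) (hi : s.idx 7 = i)
    (hQ : ∀ k s', Frame addVarP s s' → k ≤ 150 * n ^ 2 →
      WalkState s' D x (insert i I) J → Q k s') : WP ω addVarP s Q := by
  classical
  suffices h : WP ω addVarP s fun k s' => k ≤ 150 * n ^ 2 ∧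
      WalkState s' D x (insert i I) J from
    h.mono_frame fun k s' hF h => hQ k s' hF h.1 h.2
  refine wp_seq (wp_put ?_)
  simp only [IExpr.eval, RExpr.eval, IExpr.cost, RExpr.cost, hi, Rat.cast_one]
  set s₁ := s.put 6 i 0 1 with hs₁
  refine wp_seq (wp_fillVec (fun _ => 0) (N := n) hE.idx0 (by decide) ?_ ?_)
  · intro l _ s₂ _ _ _
    simp [RExpr.eval]
  intro k₂ s₂ hF₂ hk₂ hs₂
  refine wp_seq (wp_put ?_)
  have hi₂ : s₂.idx 7 = i := (hF₂.idx 7 rfl).trans hi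
  simp only [IExpr.eval, RExpr.eval, IExpr.cost, RExpr.cost, hi₂, Rat.cast_one] at hk₂ ⊢
  set s₃ := s₂.put 5 i 0 1 with hs₃
  have hA4 : s₃.arr 4 = s.arr 4 := by
    funext a b; simp [hs₃, hF₂.arr 4 rfl, hs₁]
  have hA3 : s₃.arr 3 = s.arr 3 := by
    funext a b; simp [hs₃, hF₂.arr 3 rfl, hs₁]
  have hA7 : s₃.arr 7 = s.arr 7 := by
    funext a b; simp [hs₃, hF₂.arr 7 rfl, hs₁]
  have hA6 : s₃.arr 6 = s₁.arr 6 := by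
    funext a b; simp [hs₃, hF₂.arr 6 rfl]
  have hv : s₃.vec 5 n = EuclideanSpace.single i 1 := by
    ext l
    simp only [Store.vec, vecOf_apply, hs₃, Store.put_arr, PiLp.single_apply,
      hs₂ l l.2, true_and, and_true, Fin.val_inj]
  refine wp_insertP (q := s.idx 4) (V := D.orthTo I J) (V' := D.orthTo (insert i I) J)
    (((hF₂.idx 0 rfl)).trans hE.idx0) hn (hF₂.idx 4 rfl)
    (by rw [hA4]; exact hW.basis) ?_ ?_
  · intro u
    rw [D.mem_orthTo_insert_left, hv]
    simp [EuclideanSpace.inner_single_left]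
  · intro k₄ s₄ hF₄ hk₄ hb
    refine ⟨by nlinarith, ⟨?_, ?_, ?_, ?_, hb, ?_⟩⟩
    · rw [Store.vec, hF₄.arr 3 rfl, hA3]; exact hW.pos
    · intro l
      rw [hF₄.arr 6 rfl, hA6]
      simp only [hs₁, Store.put_arr, true_and, and_true, hW.flagVar l, Fin.val_inj,
        Finset.mem_insert]
      by_cases h : l = i <;> simp [h]
    · rw [hF₄.arr 7 rfl, hA7]; exact hW.flagDisc
    · rw [hF₄.idx 5 rfl]; exact (hF₂.idx 5 rfl).trans hW.count
    · rw [hF₄.idx 3 rfl]; exact (hF₂.idx 3 rfl).trans hW.fail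

/-- The cost is amortised: each newly flagged variable pays `150 n²`, so the charge is the growth of
the flagged set. Placing the old cardinality on the left avoids truncated subtraction. -/
theorem wp_procVarP {D : EdgeWalkData n m} {T : ℕ} {x : EuclideanSpace ℝ (Fin n)}
    {I : Finset (Fin n)} {J : Finset (Fin m)} (hn : 1 ≤ n) (hE : Encodes s D T)
    (hW : WalkState s D x I J) (hI : I ⊆ D.nearVar x)
    (hQ : ∀ k s', Frame procVarP s s' →
      k + 150 * n ^ 2 * I.card ≤ 30 * n + 5 + 150 * n ^ 2 * (D.nearVar x).card →
      WalkState s' D x (D.nearVar x) J → Q k s') : WP ω procVarP s Q := by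
  classical
  refine wp_forTo (N := n) (fun i K s' => ∃ I' : Finset (Fin n), I' ⊆ D.nearVar x ∧
    (∀ l : Fin n, (l : ℕ) < i → l ∈ D.nearVar x → l ∈ I') ∧ WalkState s' D x I' J ∧
    K + 150 * n ^ 2 * I.card ≤ 30 * i + 2 + 150 * n ^ 2 * I'.card) hE.idx0 rfl rfl ?_ ?_ ?_
  · refine ⟨I, hI, by simp, hW.setI (by decide), by omega⟩
  · rintro i K s₁ hi hir hF ⟨I', hI', hdone, hW₁, hK⟩
    have hE₁ : Encodes s₁ D T := hE.of_frame hF rfl rfl rfl rfl rfl rfl rfl rfl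
    refine wp_seq (wp_setR ?_)
    have hval : RExpr.eval s₁ (.sqrt (.mul (.get 3 (.reg 7) (.lit 0))
        (.get 3 (.reg 7) (.lit 0)))) = |x ⟨i, hi⟩| := by
      simp only [RExpr.eval, IExpr.eval, hir]
      rw [Real.sqrt_mul_self_eq_abs, ← hW₁.pos]
      rfl
    rw [hval]
    set s₂ := s₁.setR 3 |x ⟨i, hi⟩| with hs₂
    have hW₂ : WalkState s₂ D x I' J := hW₁.setR
    have hE₂ : Encodes s₂ D T := by
      refine hE₁.of_frame (p := .setR 3 (.lit 0)) ((Frame.refl _ _).setR_right rfl)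
        rfl rfl rfl rfl rfl rfl rfl rfl
    have htest : Test.eval s₂ (.realLe (.sub (.lit 1) (.reg 1)) (.reg 3)) ↔
        (⟨i, hi⟩ : Fin n) ∈ D.nearVar x := by
      rw [D.mem_nearVar]
      simp only [Test.eval, RExpr.eval, Rat.cast_one, hE₂.real1]
      simp [hs₂]
    simp only [RExpr.cost, IExpr.cost]
    refine wp_ite (fun h => ?_) (fun h => ?_)
    · rw [htest] at h
      have htest₂ : Test.eval s₂ (.realLe (.get 6 (.reg 7) (.lit 0)) (.lit 0)) ↔
          (⟨i, hi⟩ : Fin n) ∉ I' := by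
        simp only [Test.eval, RExpr.eval, IExpr.eval, Rat.cast_zero]
        have : s₂.arr 6 (s₂.idx 7) 0 = if (⟨i, hi⟩ : Fin n) ∈ I' then 1 else 0 := by
          rw [← hW₂.flagVar ⟨i, hi⟩]
          simp [hs₂, hir]
        rw [this]
        split_ifs with h' <;> simp [h']
      refine wp_ite (fun h' => ?_) (fun h' => ?_)
      · rw [htest₂] at h'
        refine wp_addVarP hn hE₂ hW₂ ⟨i, hi⟩ hir ?_
        intro k₃ s₃ hF₃ hk₃ hW₃
        refine ⟨insert (⟨i, hi⟩ : Fin n) I', ?_, ?_, hW₃.setI (by decide), ?_⟩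
        · exact Finset.insert_subset h hI'
        · intro l hl hl'
          rcases Nat.lt_succ_iff_lt_or_eq.1 hl with h2 | h2
          · exact Finset.mem_insert_of_mem (hdone l h2 hl')
          · rw [show l = ⟨i, hi⟩ from Fin.ext h2]
            exact Finset.mem_insert_self _ _
        · rw [Finset.card_insert_of_notMem h']
          simp only [Test.cost, RExpr.cost, IExpr.cost]
          have : 150 * n ^ 2 * (I'.card + 1) = 150 * n ^ 2 * I'.card + 150 * n ^ 2 := by ring
          omega
      · rw [htest₂, not_not] at h'
        refine wp_skip ⟨I', hI', ?_, hW₂.setI (by decide), ?_⟩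
        · intro l hl hl'
          rcases Nat.lt_succ_iff_lt_or_eq.1 hl with h2 | h2
          · exact hdone l h2 hl'
          · rwa [show l = ⟨i, hi⟩ from Fin.ext h2]
        · simp only [Test.cost, RExpr.cost, IExpr.cost]
          omega
    · rw [htest] at h
      refine wp_skip ⟨I', hI', ?_, hW₂.setI (by decide), ?_⟩
      · intro l hl hl'
        rcases Nat.lt_succ_iff_lt_or_eq.1 hl with h2 | h2
        · exact hdone l h2 hl'
        · rw [show l = ⟨i, hi⟩ from Fin.ext h2] at hl'
          exact absurd hl' h
      · simp only [Test.cost, RExpr.cost]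
        omega
  · rintro K s₁ - hF ⟨I', hI', hdone, hW₁, hK⟩
    have hII : I' = D.nearVar x := hI'.antisymm fun l hl => hdone l l.2 hl
    subst hII
    exact hQ _ s₁ hF (by omega) hW₁

end RealRAM

/-! ### Discrepancy constraints, the random step and the main loop of Edge-Walk. -/

namespace RealRAM

variable {ω : ℕ → ℝ} {p q : Prog} {s : Store} {Q Q' : ℕ → Store → Prop} {n m : ℕ}

/-- Handle the discrepancy constraint whose number is in index register `7`: count it, and report
failure if too many of them are nearly hit. -/
def addDiscP : Prog :=
  .seq (.put 7 (.reg 7) (.lit 0) (.lit 1)) <| .seq (.setI 5 (.add (.reg 5) (.lit 1))) <|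
    .ite (.idxLt (.reg 5) (.reg 0))
      (.seq (.fillVec 8 0 5 (.get 0 (.reg 7) (.reg 8))) insertP)
      (.setI 3 (.lit 1))

/-- Handle all discrepancy constraints that are nearly hit. -/
def procDiscP : Prog :=
  .forTo 7 1 <| .ite (.idxLt (.reg 3) (.lit 1))
    (.seq (.sumTo 8 0 2 (.mul (.sub (.get 3 (.reg 8) (.lit 0)) (.get 2 (.reg 8) (.lit 0)))
        (.get 0 (.reg 7) (.reg 8)))) <|
      .seq (.setR 3 (.sqrt (.mul (.reg 2) (.reg 2)))) <|
      .ite (.realLe (.sub (.get 1 (.reg 7) (.lit 0)) (.reg 1)) (.reg 3))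
        (.ite (.realLe (.get 7 (.reg 7) (.lit 0)) (.lit 0)) addDiscP .skip) .skip) .skip

/-- The constraint that brings the count to `n` is not orthogonalised; it only raises the failure
flag. So fewer than `n` discrepancy constraints are ever inserted, however large `m` is. -/
theorem wp_addDiscP {D : EdgeWalkData n m} {T : ℕ} {x : EuclideanSpace ℝ (Fin n)}
    {I : Finset (Fin n)} {J : Finset (Fin m)} (hn : 1 ≤ n) (hE : Encodes s D T)
    (hW : WalkState s D x I J) (j : Fin m) (hj : s.idx 7 = j)  (hjJ : j ∉ J)
    (hQ : ∀ k s', Frame addDiscP s s' →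
      (J.card + 1 < n ∧ k ≤ 150 * n ^ 2 ∧ WalkState s' D x I (insert j J)) ∨
      (n ≤ J.card + 1 ∧ k ≤ 20 ∧ s'.idx 3 = 1) → Q k s') : WP ω addDiscP s Q := by
  suffices h : WP ω addDiscP s fun k s' =>
      (J.card + 1 < n ∧ k ≤ 150 * n ^ 2 ∧ WalkState s' D x I (insert j J)) ∨
      (n ≤ J.card + 1 ∧ k ≤ 20 ∧ s'.idx 3 = 1) from
    h.mono_frame fun k s' hF h => hQ k s' hF h
  refine wp_seq (wp_put (wp_seq (wp_setI ?_)))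
  simp only [IExpr.eval, RExpr.eval, IExpr.cost, RExpr.cost, hj, Rat.cast_one, Store.put_idx,
    hW.count]
  set s₁ := (s.put 7 j 0 1).setI 5 (J.card + 1) with hs₁
  have htest : Test.eval s₁ (.idxLt (.reg 5) (.reg 0)) ↔ J.card + 1 < n := by
    simp [Test.eval, IExpr.eval, hs₁, hE.idx0]
  refine wp_ite (fun h => ?_) (fun h => ?_)
  · rw [htest] at h
    have hv0 : s₁.idx 7 = j := by simp [hs₁, hj]
    refine wp_seq (wp_fillVec (fun i => s.arr 0 j i) (N := n) (by simp [hs₁, hE.idx0])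
      (by decide) ?_ ?_)
    · intro l _ s₂ hF₂ hl _
      simp only [RExpr.eval, IExpr.eval, hl]
      rw [hF₂.arr 0 rfl, hF₂.idx 7 rfl, hv0]
      simp [hs₁]
    intro k₂ s₂ hF₂ hk₂ hs₂
    have hA4 : s₂.arr 4 = s.arr 4 := by
      rw [hF₂.arr 4 rfl]; funext a b; simp [hs₁]
    have hA3 : s₂.arr 3 = s.arr 3 := by
      rw [hF₂.arr 3 rfl]; funext a b; simp [hs₁]
    have hA6 : s₂.arr 6 = s.arr 6 := by
      rw [hF₂.arr 6 rfl]; funext a b; simp [hs₁]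
    have hi4 : s₂.idx 4 = s.idx 4 := by
      rw [hF₂.idx 4 rfl]; simp [hs₁]
    have hv : s₂.vec 5 n = D.v j := by
      ext l
      rw [Store.vec, vecOf_apply, hs₂ l l.2, hE.arr0]
    refine wp_insertP (q := s.idx 4) (V := D.orthTo I J) (V' := D.orthTo I (insert j J))
      (by rw [hF₂.idx 0 rfl]; simp [hs₁, hE.idx0]) hn hi4
      (by rw [hA4]; exact hW.basis) ?_ ?_
    · intro u
      rw [D.mem_orthTo_insert_right, hv]
    · intro k₄ s₄ hF₄ hk₄ hb
      simp only [IExpr.cost, RExpr.cost, Test.cost] at hk₂ ⊢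
      refine Or.inl ⟨h, by nlinarith, ⟨?_, ?_, ?_, ?_, hb, ?_⟩⟩
      · rw [Store.vec, hF₄.arr 3 rfl, hA3]; exact hW.pos
      · rw [hF₄.arr 6 rfl, hA6]; exact hW.flagVar
      · intro l
        rw [hF₄.arr 7 rfl, hF₂.arr 7 rfl]
        simp only [hs₁, Store.setI_arr, Store.put_arr, true_and, and_true, hW.flagDisc l,
          Fin.val_inj, Finset.mem_insert]
        by_cases h : l = j <;> simp [h]
      · rw [hF₄.idx 5 rfl, hF₂.idx 5 rfl, Finset.card_insert_of_notMem hjJ]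
        simp [hs₁]
      · rw [hF₄.idx 3 rfl, hF₂.idx 3 rfl]
        simp [hs₁, hW.fail]
  · rw [htest] at h
    refine wp_setI (Or.inr ⟨by omega, ?_, ?_⟩)
    · simp [IExpr.cost, Test.cost]
    · simp [IExpr.eval]

/-- The loop invariant is a disjunction: either the processed constraints number fewer than `n` and
the walk state is intact, or the flag is up and only the running time still matters. -/
theorem wp_procDiscP {D : EdgeWalkData n m} {T : ℕ} {x : EuclideanSpace ℝ (Fin n)}
    {I : Finset (Fin n)} {J : Finset (Fin m)} (hn : 1 ≤ n) (hE : Encodes s D T)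
    (hW : WalkState s D x I J) (hJ : J ⊆ D.nearDisc x) (hJn : J.card < n)
    (hQ : ∀ k s', Frame procDiscP s s' →
      ((D.nearDisc x).card < n ∧
        k + 150 * n ^ 2 * J.card ≤ m * (21 * n + 80) + 5 + 150 * n ^ 2 * (D.nearDisc x).card ∧
        WalkState s' D x I (D.nearDisc x)) ∨
      (n ≤ (D.nearDisc x).card ∧
        k + 150 * n ^ 2 * J.card ≤ m * (21 * n + 80) + 5 + 150 * n ^ 2 * n ∧
        s'.idx 3 = 1) → Q k s') : WP ω procDiscP s Q := by
  refine wp_forTo (N := m) (fun i K s' =>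
    (∃ J' : Finset (Fin m), J' ⊆ D.nearDisc x ∧ J'.card < n ∧
      (∀ l : Fin m, (l : ℕ) < i → l ∈ D.nearDisc x → l ∈ J') ∧ WalkState s' D x I J' ∧
      K + 150 * n ^ 2 * J.card ≤ i * (21 * n + 80) + 2 + 150 * n ^ 2 * J'.card) ∨
    (n ≤ (D.nearDisc x).card ∧ K + 150 * n ^ 2 * J.card ≤
      i * (21 * n + 80) + 2 + 150 * n ^ 2 * n ∧ s'.idx 3 = 1)) hE.idx1 rfl rfl ?_ ?_ ?_
  · exact Or.inl ⟨J, hJ, hJn, by simp, hW.setI (by decide), by omega⟩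
  · rintro i K s₁ hi hir hF hinv
    have hmul : (i + 1) * (21 * n + 80) = i * (21 * n + 80) + (21 * n + 80) := by ring
    refine wp_ite (fun h => ?_) (fun h => ?_)
    · rcases hinv with ⟨J', hJ', hJ'n, hdone, hW₁, hK⟩ | ⟨_, _, h3⟩
      swap
      · simp [Test.eval, IExpr.eval, h3] at h
      have hE₁ : Encodes s₁ D T := hE.of_frame hF rfl rfl rfl rfl rfl rfl rfl rfl
      refine wp_seq (wp_sumTo (fun l => (s₁.arr 3 l 0 - s₁.arr 2 l 0) * s₁.arr 0 i l) hE₁.idx0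
        (by decide) ?_ ?_)
      · intro l _ s₂ hF₂ hl
        simp only [RExpr.eval, IExpr.eval, hl]
        rw [hF₂.arr 3 rfl, hF₂.arr 2 rfl, hF₂.arr 0 rfl, hF₂.idx 7 rfl, hir]
      intro k₂ s₂ hF₂ hk₂ hs₂
      have hs₂' : s₂.real 2 = inner ℝ (x - D.x₀) (D.v ⟨i, hi⟩) := by
        have h1 : x - D.x₀ = vecOf n fun l => s₁.arr 3 l 0 - s₁.arr 2 l 0 := by
          ext l
          rw [← hW₁.pos]
          simp [Store.vec, hE₁.arr2]
        have h2 : D.v ⟨i, hi⟩ = vecOf n (s₁.arr 0 i) := by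
          ext l
          exact (hE₁.arr0 ⟨i, hi⟩ l).symm
        rw [h1, h2, inner_vecOf, hs₂]
      refine wp_seq (wp_setR ?_)
      have hval : RExpr.eval s₂ (.sqrt (.mul (.reg 2) (.reg 2))) =
          |inner ℝ (x - D.x₀) (D.v ⟨i, hi⟩)| := by
        simp only [RExpr.eval]
        rw [Real.sqrt_mul_self_eq_abs, hs₂']
      rw [hval]
      set s₃ := s₂.setR 3 |inner ℝ (x - D.x₀) (D.v ⟨i, hi⟩)| with hs₃
      have hE₂ : Encodes s₂ D T := hE₁.of_frame hF₂ rfl rfl rfl rfl rfl rfl rfl rfl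
      have hE₃ : Encodes s₃ D T :=
        hE₂.of_frame (p := .setR 3 (.lit 0)) ((Frame.refl _ _).setR_right rfl)
          rfl rfl rfl rfl rfl rfl rfl rfl
      have hW₃ : WalkState s₃ D x I J' :=
        (hW₁.congr (hF₂.arr 3 rfl) (hF₂.arr 6 rfl) (hF₂.arr 7 rfl) (hF₂.arr 4 rfl)
          (hF₂.idx 3 rfl) (hF₂.idx 4 rfl) (hF₂.idx 5 rfl)).setR
      have hi₃ : s₃.idx 7 = i := (hF₂.idx 7 rfl).trans hir
      have htest : Test.eval s₃ (.realLe (.sub (.get 1 (.reg 7) (.lit 0)) (.reg 1)) (.reg 3)) ↔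
          (⟨i, hi⟩ : Fin m) ∈ D.nearDisc x := by
        rw [D.mem_nearDisc]
        simp only [Test.eval, RExpr.eval, IExpr.eval, hE₃.real1, hi₃]
        rw [← hE₃.arr1 ⟨i, hi⟩]
        simp [hs₃]
      simp only [RExpr.cost, IExpr.cost] at hk₂ ⊢
      refine wp_ite (fun h => ?_) (fun h => ?_)
      · rw [htest] at h
        have htest₂ : Test.eval s₃ (.realLe (.get 7 (.reg 7) (.lit 0)) (.lit 0)) ↔
            (⟨i, hi⟩ : Fin m) ∉ J' := by
          simp only [Test.eval, RExpr.eval, IExpr.eval, Rat.cast_zero, hi₃]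
          rw [hW₃.flagDisc ⟨i, hi⟩]
          split_ifs with h' <;> simp [h']
        refine wp_ite (fun h' => ?_) (fun h' => ?_)
        · rw [htest₂] at h'
          refine wp_addDiscP hn hE₃ hW₃ ⟨i, hi⟩ hi₃ h' ?_
          rintro k₄ s₄ hF₄ (⟨hc, hk₄, hW₄⟩ | ⟨hc, hk₄, h3⟩)
          · refine Or.inl ⟨insert (⟨i, hi⟩ : Fin m) J', Finset.insert_subset h hJ', ?_, ?_,
              hW₄.setI (by decide), ?_⟩
            · rw [Finset.card_insert_of_notMem h']; exact hc
            · intro l hl hl'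
              rcases Nat.lt_succ_iff_lt_or_eq.1 hl with h2 | h2
              · exact Finset.mem_insert_of_mem (hdone l h2 hl')
              · rw [show l = ⟨i, hi⟩ from Fin.ext h2]
                exact Finset.mem_insert_self _ _
            · rw [Finset.card_insert_of_notMem h', hmul]
              simp only [Test.cost, RExpr.cost, IExpr.cost]
              have : 150 * n ^ 2 * (J'.card + 1) = 150 * n ^ 2 * J'.card + 150 * n ^ 2 := by ring
              omega
          · refine Or.inr ⟨?_, ?_, by simpa using h3⟩
            · refine hc.trans ?_
              rw [← Finset.card_insert_of_notMem h']
              exact Finset.card_le_card (Finset.insert_subset h hJ')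
            · have : 150 * n ^ 2 * J'.card ≤ 150 * n ^ 2 * n :=
                Nat.mul_le_mul_left _ hJ'n.le
              simp only [Test.cost, RExpr.cost, IExpr.cost]
              omega
        · rw [htest₂, not_not] at h'
          refine wp_skip (Or.inl ⟨J', hJ', hJ'n, ?_, hW₃.setI (by decide), ?_⟩)
          · intro l hl hl'
            rcases Nat.lt_succ_iff_lt_or_eq.1 hl with h2 | h2
            · exact hdone l h2 hl'
            · rwa [show l = ⟨i, hi⟩ from Fin.ext h2]
          · simp only [Test.cost, RExpr.cost, IExpr.cost]
            omega
      · rw [htest] at h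
        refine wp_skip (Or.inl ⟨J', hJ', hJ'n, ?_, hW₃.setI (by decide), ?_⟩)
        · intro l hl hl'
          rcases Nat.lt_succ_iff_lt_or_eq.1 hl with h2 | h2
          · exact hdone l h2 hl'
          · rw [show l = ⟨i, hi⟩ from Fin.ext h2] at hl'
            exact absurd hl' h
        · simp only [Test.cost, RExpr.cost, IExpr.cost]
          omega
    · rcases hinv with ⟨J', hJ', hJ'n, hdone, hW₁, hK⟩ | ⟨hc, hK, h3⟩
      · simp [Test.eval, IExpr.eval, hW₁.fail] at h
      · refine wp_skip (Or.inr ⟨hc, ?_, by simpa using h3⟩)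
        simp only [Test.cost, IExpr.cost]
        omega
  · rintro K s₁ - hF (⟨J', hJ', hJ'n, hdone, hW₁, hK⟩ | ⟨hc, hK, h3⟩)
    · have hII : J' = D.nearDisc x := hJ'.antisymm fun l hl => hdone l l.2 hl
      subst hII
      exact hQ _ s₁ hF (Or.inl ⟨hJ'n, by omega, hW₁⟩)
    · exact hQ _ s₁ hF (Or.inr ⟨hc, by omega, h3⟩)

/-- Fill the array `5` with `n` fresh draws. -/
def drawP : Prog := .forTo 8 0 (.seq (.gauss 3) (.put 5 (.reg 8) (.lit 0) (.reg 3)))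

theorem wp_drawP (hn : s.idx 0 = n)
    (hQ : ∀ k s', Frame drawP s s' → k ≤ 12 * n + 5 → s'.drawn = s.drawn + n →
      (∀ i < n, s'.arr 5 i 0 = ω (s.drawn + i)) → Q k s') : WP ω drawP s Q := by
  refine wp_forTo (N := n) (fun i K s' => K ≤ 12 * i + 2 ∧ s'.drawn = s.drawn + i ∧
    ∀ l < i, s'.arr 5 l 0 = ω (s.drawn + l)) hn rfl rfl (by simp) ?_ ?_
  · rintro i K s₁ hi hir hF ⟨hK, hd, ha⟩
    refine wp_seq (wp_gauss (wp_put ?_))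
    simp only [IExpr.eval, RExpr.eval, IExpr.cost, RExpr.cost, Store.setR_idx, hir, hd,
      Store.setR_real, if_true]
    refine ⟨by omega, by simp [add_assoc], fun l hl => ?_⟩
    simp only [Store.setI_arr, Store.put_arr, Store.setR_arr, true_and, and_true]
    split_ifs with h
    · rw [h]
    · exact ha l (by omega)
  · rintro K s₁ - hF ⟨hK, hd, ha⟩
    exact hQ _ s₁ hF (by omega) hd ha

/-- Make the step: project the draws on to the free space and move. -/
def moveP : Prog :=
  .seq orthP (.fillVec 8 0 3 (.add (.get 3 (.reg 8) (.lit 0))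
    (.mul (.reg 0) (.get 5 (.reg 8) (.lit 0)))))

theorem wp_moveP {D : EdgeWalkData n m} {T : ℕ} {x : EuclideanSpace ℝ (Fin n)}
    {I : Finset (Fin n)} {J : Finset (Fin m)} (hn : 1 ≤ n) (hE : Encodes s D T)
    (hW : WalkState s D x I J)
    (hQ : ∀ k s', Frame moveP s s' → k ≤ 90 * n ^ 2 →
      WalkState s' D (x + D.γ • (D.orthTo I J).starProjection (s.vec 5 n)) I J → Q k s') :
    WP ω moveP s Q := by
  suffices h : WP ω moveP s fun k s' => k ≤ 90 * n ^ 2 ∧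
      WalkState s' D (x + D.γ • (D.orthTo I J).starProjection (s.vec 5 n)) I J from
    h.mono_frame fun k s' hF h => hQ k s' hF h.1 h.2
  have hq := hW.basis.le
  refine wp_seq (wp_orthP hE.idx0 rfl hW.basis ?_)
  intro k₁ s₁ hF₁ hk₁ hv₁
  have hE₁ : Encodes s₁ D T := hE.of_frame hF₁ rfl rfl rfl rfl rfl rfl rfl rfl
  refine wp_fillVec (fun i => s₁.arr 3 i 0 + D.γ * s₁.arr 5 i 0) hE₁.idx0 (by decide) ?_ ?_
  · intro l _ s₂ hF₂ hl ha
    simp only [RExpr.eval, IExpr.eval, hl]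
    rw [ha, hF₂.real 0 rfl, hE₁.real0, hF₂.arr 5 rfl]
  intro k₂ s₂ hF₂ hk₂ hs₂
  simp only [RExpr.cost, IExpr.cost] at hk₂
  refine ⟨by nlinarith, ⟨?_, ?_, ?_, ?_, ?_, ?_⟩⟩
  · rw [← hv₁]
    ext l
    rw [Store.vec, vecOf_apply, hs₂ l l.2, ← hW.pos, hF₁.arr 3 rfl]
    simp [Store.vec]
  · rw [hF₂.arr 6 rfl, hF₁.arr 6 rfl]; exact hW.flagVar
  · rw [hF₂.arr 7 rfl, hF₁.arr 7 rfl]; exact hW.flagDisc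
  · rw [hF₂.idx 5 rfl, hF₁.idx 5 rfl]; exact hW.count
  · rw [hF₂.idx 4 rfl, hF₁.idx 4 rfl, hF₂.arr 4 rfl, hF₁.arr 4 rfl]; exact hW.basis
  · rw [hF₂.idx 3 rfl, hF₁.idx 3 rfl]; exact hW.fail

/-- One iteration of Edge-Walk. -/
def walkStepP : Prog :=
  .seq (.ite (.idxLt (.reg 3) (.lit 1)) (.seq procVarP procDiscP) .skip) <|
    .seq drawP (.ite (.idxLt (.reg 3) (.lit 1)) moveP .skip)

/-- Edge-Walk. -/
def edgeWalkP : Prog :=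
  .seq (.setI 3 (.lit 0)) <| .seq (.setI 4 (.lit 0)) <| .seq (.setI 5 (.lit 0)) <|
  .seq (.fillVec 8 0 3 (.get 2 (.reg 8) (.lit 0))) <|
  .seq (.fillVec 8 0 6 (.lit 0)) <|
  .seq (.ite (.idxLt (.lit 0) (.reg 2)) (.fillVec 8 1 7 (.lit 0)) .skip) <|
  .forTo 6 2 walkStepP

/-- The invariant of the main loop after `t` iterations, with `K` steps spent. -/
def WalkInv (D : EdgeWalkData n m) (ω : ℕ → ℝ) (K₀ t K : ℕ) (s : Store) : Prop :=
  ((∀ t' < t, (D.nearDisc (D.path ω t')).card < n) ∧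
    ∃ I J, I ⊆ D.nearVar (D.path ω t) ∧ J ⊆ D.nearDisc (D.path ω t) ∧ J.card < n ∧
      WalkState s D (D.path ω t) I J ∧
      K ≤ t * (101 * (m * n) + 200 * n ^ 2) + K₀ + 150 * n ^ 2 * I.card + 150 * n ^ 2 * J.card) ∨
  ((∃ t' < t, n ≤ (D.nearDisc (D.path ω t')).card) ∧ s.idx 3 = 1 ∧
    K ≤ t * (101 * (m * n) + 200 * n ^ 2) + K₀ + 300 * n ^ 3)

/-- The `n` draws are made even after a failure, so iteration `t` always reads from position `d + t
* n` and the trajectory is one fixed function of the draws. The offset `d` allows use as a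
subroutine. Drawing comes after the insertions because both use the scratch array `5`. -/
theorem wp_walkStepP {D : EdgeWalkData n m} {T K₀ t K d : ℕ} (hn : 1 ≤ n)
    (hE : Encodes s D T) (hd : s.drawn = d + t * n)
    (hI : WalkInv D (fun k => ω (d + k)) K₀ t K s) :
    WP ω walkStepP s fun k s' => s'.drawn = d + (t + 1) * n ∧
      WalkInv D (fun k => ω (d + k)) K₀ (t + 1) (K + k + 7) (s'.setI 6 (t + 1)) := by
  unfold WalkInv at hI ⊢
  set B := 101 * (m * n) + 200 * n ^ 2 with hB
  have hBt : (t + 1) * B = t * B + B := by ring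
  have hmn : m ≤ m * n := Nat.le_mul_of_pos_right m hn
  have hn2 : n ≤ n ^ 2 := by nlinarith
  have hn3 : 150 * n ^ 2 * n = 150 * n ^ 3 := by ring
  refine wp_seq ?_
  rcases hI with ⟨hlt, I, J, hI, hJ, hJn, hW, hK⟩ | ⟨hex, h3, hK⟩
  · have hfirst : WP ω (.ite (.idxLt (.reg 3) (.lit 1)) (.seq procVarP procDiscP) .skip) s
        fun k s' =>
        ((D.nearDisc (D.path (fun k => ω (d + k)) t)).card < n ∧
          WalkState s' D (D.path (fun k => ω (d + k)) t)
            (D.nearVar (D.path (fun k => ω (d + k)) t))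
            (D.nearDisc (D.path (fun k => ω (d + k)) t)) ∧
          K + k ≤ t * B + K₀ + (30 * n + m * (21 * n + 80) + 13) +
            150 * n ^ 2 * (D.nearVar (D.path (fun k => ω (d + k)) t)).card +
            150 * n ^ 2 * (D.nearDisc (D.path (fun k => ω (d + k)) t)).card) ∨
        (n ≤ (D.nearDisc (D.path (fun k => ω (d + k)) t)).card ∧ s'.idx 3 = 1 ∧
          K + k ≤ t * B + K₀ + (30 * n + m * (21 * n + 80) + 13) + 300 * n ^ 3) := by
      refine wp_ite (fun _ => ?_) (fun h => absurd hW.fail (by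
        simp only [Test.eval, IExpr.eval] at h; omega))
      refine wp_seq (wp_procVarP hn hE hW hI ?_)
      intro k₁ s₁ hF₁ hk₁ hW₁
      refine wp_procDiscP hn (hE.of_frame hF₁ rfl rfl rfl rfl rfl rfl rfl rfl) hW₁ hJ hJn ?_
      rintro k₂ s₂ hF₂ (⟨hc, hk₂, hW₂⟩ | ⟨hc, hk₂, h3⟩)
      · refine Or.inl ⟨hc, hW₂, ?_⟩
        simp only [Test.cost, IExpr.cost]
        omega
      · refine Or.inr ⟨hc, h3, ?_⟩
        have hIn : 150 * n ^ 2 * (D.nearVar (D.path (fun k => ω (d + k)) t)).card ≤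
            150 * n ^ 2 * n := Nat.mul_le_mul_left _ (by
          simpa using Finset.card_le_univ (D.nearVar (D.path (fun k => ω (d + k)) t)))
        simp only [Test.cost, IExpr.cost]
        omega
    refine hfirst.mono_frame fun k₁ s₁ hF₁ h₁ => wp_seq ?_
    have hE₁ : Encodes s₁ D T := hE.of_frame hF₁ rfl rfl rfl rfl rfl rfl rfl rfl
    have hd₁ : s₁.drawn = d + t * n := (hF₁.drawn rfl).trans hd
    refine wp_drawP hE₁.idx0 ?_
    intro k₂ s₂ hF₂ hk₂ hd₂ ha₂
    have hE₂ : Encodes s₂ D T := hE₁.of_frame hF₂ rfl rfl rfl rfl rfl rfl rfl rfl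
    have hd₂' : s₂.drawn = d + (t + 1) * n := by rw [hd₂, hd₁]; ring
    rcases h₁ with ⟨hc, hW₁, hk₁⟩ | ⟨hc, h3, hk₁⟩
    · have hW₂ := hW₁.congr (hF₂.arr 3 rfl) (hF₂.arr 6 rfl) (hF₂.arr 7 rfl) (hF₂.arr 4 rfl)
          (hF₂.idx 3 rfl) (hF₂.idx 4 rfl) (hF₂.idx 5 rfl)
      have hv : s₂.vec 5 n = vecOf n fun i => ω (d + (t * n + i)) :=
        vecOf_congr fun i hi => by rw [ha₂ i hi, hd₁, add_assoc]
      refine wp_ite (fun _ => ?_) (fun h => absurd hW₂.fail (by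
        simp only [Test.eval, IExpr.eval] at h; omega))
      refine wp_moveP hn hE₂ hW₂ ?_
      intro k₃ s₃ hF₃ hk₃ hW₃
      rw [hv] at hW₃
      refine ⟨(hF₃.drawn rfl).trans hd₂', Or.inl ⟨?_, _, _, ?_, ?_, hc,
        hW₃.setI (by decide), ?_⟩⟩
      · intro t' ht'
        rcases Nat.lt_succ_iff_lt_or_eq.1 ht' with h | rfl
        · exact hlt t' h
        · exact hc
      · exact D.nearVar_path_subset _ t
      · exact D.nearDisc_path_subset _ t
      · simp only [Test.cost, IExpr.cost]
        nlinarith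
    · have h3' : s₂.idx 3 = 1 := (hF₂.idx 3 rfl).trans h3
      refine wp_ite (fun h => absurd h3' (by
        simp only [Test.eval, IExpr.eval] at h; omega)) (fun _ => ?_)
      refine wp_skip ⟨hd₂', Or.inr ⟨⟨t, by omega, hc⟩, by simpa using h3', ?_⟩⟩
      simp only [Test.cost, IExpr.cost]
      nlinarith
  · refine wp_ite (fun h => absurd h3 (by
        simp only [Test.eval, IExpr.eval] at h; omega)) (fun _ => ?_)
    refine wp_skip (wp_seq (wp_drawP hE.idx0 ?_))
    intro k₂ s₂ hF₂ hk₂ hd₂ _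
    have h3' : s₂.idx 3 = 1 := (hF₂.idx 3 rfl).trans h3
    refine wp_ite (fun h => absurd h3' (by
        simp only [Test.eval, IExpr.eval] at h; omega)) (fun _ => ?_)
    refine wp_skip ⟨?_, Or.inr ⟨?_, by simpa using h3', ?_⟩⟩
    · rw [hd₂, hd]; ring
    · obtain ⟨t', h, h'⟩ := hex
      exact ⟨t', by omega, h'⟩
    · simp only [Test.cost, IExpr.cost]
      omega

/-- Nothing is assumed about scratch memory, so the program can be rerun: stale rows in the array
`4` do no harm once the basis size is reset to zero. -/
theorem wp_edgeWalkP {D : EdgeWalkData n m} {T : ℕ} (hn : 1 ≤ n) (hE : Encodes s D T)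
    (hQ : ∀ k s', Frame edgeWalkP s s' → k ≤ 500 * (T * m * n + n ^ 3 + T * n ^ 2) →
      s'.drawn = s.drawn + T * n →
      ((∃ t < T, n ≤ (D.nearDisc (D.path (fun k => ω (s.drawn + k)) t)).card) → s'.idx 3 = 1) →
      ((¬ ∃ t < T, n ≤ (D.nearDisc (D.path (fun k => ω (s.drawn + k)) t)).card) →
        s'.idx 3 = 0 ∧ s'.vec 3 n = D.path (fun k => ω (s.drawn + k)) T) → Q k s') :
    WP ω edgeWalkP s Q := by
  classical
  suffices h : WP ω edgeWalkP s fun k s' => k ≤ 500 * (T * m * n + n ^ 3 + T * n ^ 2) ∧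
      s'.drawn = s.drawn + T * n ∧
      ((∃ t < T, n ≤ (D.nearDisc (D.path (fun k => ω (s.drawn + k)) t)).card) → s'.idx 3 = 1) ∧
      ((¬ ∃ t < T, n ≤ (D.nearDisc (D.path (fun k => ω (s.drawn + k)) t)).card) →
        s'.idx 3 = 0 ∧ s'.vec 3 n = D.path (fun k => ω (s.drawn + k)) T) from
    h.mono_frame fun k s' hF h => hQ k s' hF h.1 h.2.1 h.2.2.1 h.2.2.2
  refine wp_seq (wp_setI (wp_seq (wp_setI (wp_seq (wp_setI ?_)))))
  simp only [IExpr.eval, IExpr.cost]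
  set s₀ := ((s.setI 3 0).setI 4 0).setI 5 0 with hs₀
  have hE₀ : Encodes s₀ D T :=
    ⟨by simp [hs₀, hE.idx0], by simp [hs₀, hE.idx1], by simp [hs₀, hE.idx2], hE.real0, hE.real1,
      hE.arr0, hE.arr1, hE.arr2⟩
  refine wp_seq (wp_fillVec (fun i => s.arr 2 i 0) hE₀.idx0 (by decide) ?_ ?_)
  · intro l _ s₁ hF hl _
    simp only [RExpr.eval, IExpr.eval, hl, hF.arr 2 rfl]
    simp [hs₀]
  intro k₁ s₁ hF₁ hk₁ ha₁
  have hE₁ : Encodes s₁ D T := hE₀.of_frame hF₁ rfl rfl rfl rfl rfl rfl rfl rfl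
  refine wp_seq (wp_fillVec (fun i => 0) hE₁.idx0 (by decide) ?_ ?_)
  · intro l _ s₂ hF hl _
    simp [RExpr.eval]
  intro k₂ s₂ hF₂ hk₂ ha₂
  have hE₂ : Encodes s₂ D T := hE₁.of_frame hF₂ rfl rfl rfl rfl rfl rfl rfl rfl
  -- Clearing the `m` flags must be charged to `T * m * n`, which vanishes for `T = 0`. The flags
  -- are therefore cleared only when there is an iteration to use them.
  have hflag : WP ω (.ite (.idxLt (.lit 0) (.reg 2)) (.fillVec 8 1 7 (.lit 0)) .skip) s₂
      fun k s' => k ≤ T * (11 * m) + 9 ∧ (0 < T → ∀ j < m, s'.arr 7 j 0 = 0) := by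
    refine wp_ite (fun h => ?_) (fun h => ?_)
    · simp only [Test.eval, IExpr.eval, hE₂.idx2] at h
      refine wp_fillVec (fun _ => 0) hE₂.idx1 (by decide) (fun _ _ _ _ _ _ => by
        simp [RExpr.eval]) ?_
      intro k s' _ hk ha
      refine ⟨?_, fun _ => ha⟩
      simp only [Test.cost, IExpr.cost, RExpr.cost] at hk ⊢
      have : 11 * m ≤ T * (11 * m) := Nat.le_mul_of_pos_left _ h
      omega
    · simp only [Test.eval, IExpr.eval, hE₂.idx2] at h
      refine wp_skip ⟨by simp [Test.cost, IExpr.cost], fun h' => absurd h' h⟩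
  refine wp_seq (hflag.mono_frame ?_)
  rintro k₃ s₃ hF₃ ⟨hk₃, ha₃⟩
  have hE₃ : Encodes s₃ D T := hE₂.of_frame hF₃ rfl rfl rfl rfl rfl rfl rfl rfl
  have hd₃ : s₃.drawn = s.drawn := by
    rw [hF₃.drawn rfl, hF₂.drawn rfl, hF₁.drawn rfl]; simp [hs₀]
  have hi3 : s₃.idx 3 = 0 := by
    rw [hF₃.idx 3 rfl, hF₂.idx 3 rfl, hF₁.idx 3 rfl]; simp [hs₀]
  have hi4 : s₃.idx 4 = 0 := by
    rw [hF₃.idx 4 rfl, hF₂.idx 4 rfl, hF₁.idx 4 rfl]; simp [hs₀]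
  have hi5 : s₃.idx 5 = 0 := by
    rw [hF₃.idx 5 rfl, hF₂.idx 5 rfl, hF₁.idx 5 rfl]; simp [hs₀]
  have hv3 : s₃.vec 3 n = D.x₀ := by
    ext i
    rw [Store.vec, vecOf_apply, hF₃.arr 3 rfl, hF₂.arr 3 rfl, ha₁ i i.2, hE.arr2]
  simp only [RExpr.cost, IExpr.cost] at hk₁ hk₂
  -- For `T = 0` the flags may hold garbage and the loop invariant is not available, but the loop
  -- body never runs.
  rcases Nat.eq_zero_or_pos T with hT | hT
  · subst hT
    refine wp_forTo (N := 0) (fun i K s' => K ≤ 2 ∧ s' = s₃.setI 6 0) hE₃.idx2 rfl rfl ⟨le_rfl, rfl⟩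
      (fun i K s' h => absurd h (by omega)) ?_
    rintro K s₄ - hF₄ ⟨hK, rfl⟩
    have hn3 : 1 ≤ n ^ 3 := Nat.one_le_pow _ _ hn
    have hn3' : n ≤ n ^ 3 := Nat.le_self_pow (by decide) n
    refine ⟨by simp only [zero_mul, zero_add, add_zero] at hk₃ ⊢; omega, by simp [hd₃], by simp,
      fun _ => ⟨by simp [hi3], hv3⟩⟩
  set K₀ := 24 * n + T * (11 * m) + 40 with hK₀
  refine wp_forTo (N := T) (fun t K s' => s'.drawn = s.drawn + t * n ∧
    WalkInv D (fun k => ω (s.drawn + k)) K₀ t K s') hE₃.idx2 rfl rfl ?_ ?_ ?_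
  · refine ⟨by simp [hd₃], Or.inl ⟨by simp, ∅, ∅, by simp, by simp, by simp; omega, ?_, ?_⟩⟩
    · refine WalkState.setI ⟨hv3, ?_, ?_, by simp [hi5], ?_, hi3⟩ (by decide)
      · intro i
        rw [hF₃.arr 6 rfl, ha₂ i i.2]
        simp
      · intro j
        rw [ha₃ hT j j.2]
        simp
      · rw [hi4]
        refine ⟨⟨fun k => k.elim0, fun k => k.elim0⟩, fun u => ?_⟩
        simp [D.mem_orthTo]
    · simp [hK₀]
  · rintro t K s₄ ht htr hF₄ ⟨hd₄, hI⟩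
    exact wp_walkStepP hn (hE₃.of_frame hF₄ rfl rfl rfl rfl rfl rfl rfl rfl) hd₄ hI
  · rintro K s₄ - hF₄ ⟨hd₄, hI⟩
    have hmn : m ≤ m * n := Nat.le_mul_of_pos_right m hn
    have hTm : T * m ≤ T * (m * n) := Nat.mul_le_mul_left _ hmn
    have hTa : T * (11 * m) = 11 * (T * m) := by ring
    have hTb : T * (101 * (m * n) + 200 * n ^ 2) = 101 * (T * (m * n)) + 200 * (T * n ^ 2) := by
      ring
    have hTc : T * m * n = T * (m * n) := by ring
    have hn3 : 1 ≤ n ^ 3 := Nat.one_le_pow _ _ hn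
    have hn3' : n ≤ n ^ 3 := Nat.le_self_pow (by decide) n
    rcases hI with ⟨hlt, I, J, hI, hJ, hJn, hW, hK⟩ | ⟨hex, h3, hK⟩
    · have hIn : 150 * n ^ 2 * I.card ≤ 150 * n ^ 2 * n := Nat.mul_le_mul_left _ (by
          simpa using Finset.card_le_univ I)
      have hJn : 150 * n ^ 2 * J.card ≤ 150 * n ^ 2 * n := Nat.mul_le_mul_left _ hJn.le
      have hn3'' : 150 * n ^ 2 * n = 150 * n ^ 3 := by ring
      refine ⟨by omega, hd₄, fun ⟨t, ht, h⟩ => ?_, fun _ => ⟨hW.fail, hW.pos⟩⟩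
      have := hlt t ht
      omega
    · exact ⟨by omega, hd₄, fun _ => h3, fun h => absurd hex h⟩

end RealRAM

/-! ### The random draws -/

namespace RealRAM

instance : IsProbabilityMeasure drawLaw := by unfold drawLaw; infer_instance

/-- The draws from position `k` on. -/
def shift (k : ℕ) (ω : ℕ → ℝ) : ℕ → ℝ := fun i => ω (k + i)

@[fun_prop]
theorem measurable_shift (k : ℕ) : Measurable (shift k) := by unfold shift; fun_prop

theorem shift_shift (k l : ℕ) (ω : ℕ → ℝ) : shift k (shift l ω) = shift (l + k) ω := by
  funext i; simp [shift, add_assoc]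

/-- `k` draws from the first sequence, followed by the second sequence. -/
def glue (k : ℕ) (p : (ℕ → ℝ) × (ℕ → ℝ)) : ℕ → ℝ := fun i => if i < k then p.1 i else p.2 (i - k)

theorem measurable_glue (k : ℕ) : Measurable (glue k) := by
  refine measurable_pi_iff.2 fun i => ?_
  unfold glue
  split_ifs <;> fun_prop

theorem shift_glue (k : ℕ) (p : (ℕ → ℝ) × (ℕ → ℝ)) : shift k (glue k p) = p.2 := by
  funext i; simp [shift, glue]

/-- A finite box pulls back to a product of two boxes, one on the coordinates below `k` and one on
the shifted remaining coordinates; both sides have the same product of one-dimensional measures. -/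
theorem map_glue (k : ℕ) : (drawLaw.prod drawLaw).map (glue k) = drawLaw := by
  classical
  refine Measure.eq_infinitePi _ fun s t ht => ?_
  rw [Measure.map_apply (measurable_glue k)
    (MeasurableSet.pi s.countable_toSet fun i _ => ht i)]
  have hpre : glue k ⁻¹' (Set.pi s t) =
      (Set.pi (s.filter (· < k) : Finset ℕ) t) ×ˢ
        (Set.pi ((s.filter (¬ · < k)).image (· - k) : Finset ℕ) fun i => t (i + k)) := by
    ext p
    simp only [Set.mem_preimage, Set.mem_pi, Finset.mem_coe, Set.mem_prod, Finset.mem_filter,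
      Finset.mem_image, forall_exists_index, and_imp]
    constructor
    · intro h
      refine ⟨fun i hi hik => by simpa [glue, hik] using h i hi, ?_⟩
      rintro _ i hi hik rfl
      rw [Nat.sub_add_cancel (by omega)]
      simpa [glue, hik] using h i hi
    · rintro ⟨h1, h2⟩ i hi
      by_cases hik : i < k
      · simpa [glue, hik] using h1 i hi hik
      · have := h2 (i - k) i hi hik rfl
        rw [Nat.sub_add_cancel (by omega)] at this
        simpa [glue, hik] using this
  rw [hpre, Measure.prod_prod, drawLaw, Measure.infinitePi_pi _ fun i _ => ht i,
    Measure.infinitePi_pi _ fun i _ => ht _, Finset.prod_image, ← Finset.prod_filter_mul_prod_filter_not s (· < k)]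
  · congr 1
    refine Finset.prod_congr rfl fun i hi => ?_
    rw [Nat.sub_add_cancel]
    simp only [Finset.mem_filter] at hi
    omega
  · intro i hi j hj hij
    simp only [Finset.coe_filter, Set.mem_ofPred_eq] at hi hj
    have : i - k = j - k := hij
    omega

/-- `g` is determined by the first `k` draws. -/
def UsesDraws {α : Type*} (k : ℕ) (g : (ℕ → ℝ) → α) : Prop :=
  ∀ ω ω', (∀ i < k, ω i = ω' i) → g ω = g ω'

/-- The draws from position `k` on are independent of the first `k` ones. -/
theorem lintegral_fresh {α : Type*} [MeasurableSpace α] {k : ℕ} {g : (ℕ → ℝ) → α}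
    (hg : Measurable g) (hdep : UsesDraws k g) {Φ : α → (ℕ → ℝ) → ENNReal}
    (hΦ : Measurable (Function.uncurry Φ)) :
    ∫⁻ ω, Φ (g ω) (shift k ω) ∂drawLaw = ∫⁻ ω, ∫⁻ ω', Φ (g ω) ω' ∂drawLaw ∂drawLaw := by
  have hm : Measurable fun ω => Φ (g ω) (shift k ω) :=
    hΦ.comp (hg.prodMk (measurable_shift k))
  -- Resample everything from position `k` on: `g` does not see the change, and the shifted sequence
  -- becomes the independent second factor.
  conv_lhs => rw [← map_glue k]
  rw [lintegral_map hm (measurable_glue k), lintegral_prod]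
  · refine lintegral_congr fun ω => lintegral_congr fun ω' => ?_
    rw [shift_glue, hdep (glue k (ω, ω')) ω fun i hi => by simp [glue, hi]]
  · exact (hm.comp (measurable_glue k)).aemeasurable

@[fun_prop]
theorem measurable_vecOf (n : ℕ) : Measurable (vecOf n) := by
  unfold vecOf
  fun_prop

theorem map_vecOf (n : ℕ) : drawLaw.map (vecOf n) = stdGaussian (EuclideanSpace ℝ (Fin n)) := by
  rw [← map_pi_eq_stdGaussian, ← Measure.infinitePi_eq_pi,
    ← Measure.map_infinitePi_infinitePi_of_inj (P := fun _ : ℕ => gaussianReal 0 1)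
      (f := fun i : Fin n => (i : ℕ)) Fin.val_injective, Measure.map_map (by fun_prop) (by fun_prop)]
  rfl

variable {n : ℕ}

/-- Projecting a standard Gaussian vector on to a subspace gives the standard Gaussian vector of
the subspace. -/
theorem map_starProjection (V : Submodule ℝ (EuclideanSpace ℝ (Fin n))) :
    (stdGaussian (EuclideanSpace ℝ (Fin n))).map V.starProjection = gaussianOn V := by
  refine Measure.ext_of_charFun (E := EuclideanSpace ℝ (Fin n)) ?_
  ext t
  have h1 : charFun (gaussianOn V) t = charFun (stdGaussian V) (V.orthogonalProjectionOnto t) := by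
    rw [gaussianOn, charFun_apply, charFun_apply, integral_map (by fun_prop) (by fun_prop)]
    refine integral_congr_ae (Filter.Eventually.of_forall fun u => ?_)
    simp only
    congr 3
    rw [Submodule.coe_inner, ← Submodule.starProjection_apply,
      ← Submodule.inner_starProjection_left_eq_right,
      Submodule.starProjection_eq_self_iff.2 u.2]
  have h2 : charFun ((stdGaussian (EuclideanSpace ℝ (Fin n))).map V.starProjection) t =
      charFun (stdGaussian (EuclideanSpace ℝ (Fin n))) (V.starProjection t) := by
    rw [charFun_apply, charFun_apply, integral_map (by fun_prop) (by fun_prop)]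
    refine integral_congr_ae (Filter.Eventually.of_forall fun u => ?_)
    simp only
    congr 3
    rw [Submodule.inner_starProjection_left_eq_right]
  -- Both characteristic functions equal `exp (-‖P t‖² / 2)`, where `P` is the projection on `V`.
  rw [h1, h2, charFun_stdGaussian, charFun_stdGaussian, Submodule.starProjection_apply]
  rfl

/-- By self-adjointness `⟨P g, w⟩ = ⟨g, P w⟩`, a linear functional of a standard Gaussian vector,
with variance `‖P w‖²`. -/
theorem map_inner_starProjection (V : Submodule ℝ (EuclideanSpace ℝ (Fin n)))
    (w : EuclideanSpace ℝ (Fin n)) :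
    drawLaw.map (fun ω => inner ℝ (V.starProjection (vecOf n ω)) w) =
      gaussianReal 0 (‖V.starProjection w‖₊ ^ 2) := by
  have h1 : (fun ω => inner ℝ (V.starProjection (vecOf n ω)) w) =
      (innerSL ℝ (V.starProjection w)) ∘ vecOf n := by
    funext ω
    simp only [Function.comp, innerSL_apply_apply]
    rw [Submodule.inner_starProjection_left_eq_right, real_inner_comm]
  rw [h1, ← Measure.map_map (by fun_prop) (by fun_prop), map_vecOf,
    IsGaussian.map_eq_gaussianReal, integral_strongDual_stdGaussian, variance_dual_stdGaussian,
    innerSL_apply_norm]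
  congr 1
  rw [← coe_nnnorm, ← NNReal.coe_pow, Real.toNNReal_coe]

theorem lintegral_exp_inner (V : Submodule ℝ (EuclideanSpace ℝ (Fin n)))
    (w : EuclideanSpace ℝ (Fin n)) (θ : ℝ) :
    ∫⁻ ω, ENNReal.ofReal (Real.exp (θ * inner ℝ (V.starProjection (vecOf n ω)) w)) ∂drawLaw =
      ENNReal.ofReal (Real.exp (θ ^ 2 * ‖V.starProjection w‖ ^ 2 / 2)) := by
  have hmap := map_inner_starProjection V w
  have h := mgf_gaussianReal hmap θ
  have hint : Integrable (fun ω => Real.exp (θ * inner ℝ (V.starProjection (vecOf n ω)) w))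
      drawLaw := by
    have := integrable_exp_mul_gaussianReal (μ := 0)
      (v := (‖V.starProjection w‖₊ ^ 2)) θ
    rw [← hmap, integrable_map_measure (by fun_prop) (by fun_prop)] at this
    exact this
  rw [← ofReal_integral_eq_lintegral_ofReal hint
    (Filter.Eventually.of_forall fun _ => (Real.exp_pos _).le)]
  congr 1
  rw [mgf] at h
  rw [h]
  congr 1
  simp
  ring

/-- The real part of `exp (i b)` times the Gaussian characteristic function. This exact formula is
why the energy is built from cosines. -/
theorem integral_cos_inner (V : Submodule ℝ (EuclideanSpace ℝ (Fin n)))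
    (w : EuclideanSpace ℝ (Fin n)) (b r : ℝ) :
    ∫ ω, Real.cos (b + r * inner ℝ (V.starProjection (vecOf n ω)) w) ∂drawLaw =
      Real.cos b * Real.exp (-(r ^ 2 * ‖V.starProjection w‖ ^ 2 / 2)) := by
  have hmap := map_inner_starProjection V w
  have h := charFun_gaussianReal (μ := 0) (v := (‖V.starProjection w‖₊ ^ 2)) r
  rw [← hmap, charFun_apply_real, integral_map (by fun_prop) (by fun_prop)] at h
  have hint : Integrable (fun ω => Complex.exp (((b + r * inner ℝ (V.starProjection (vecOf n ω)) w : ℝ) : ℂ) *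
      Complex.I)) drawLaw := by
    refine Integrable.of_bound (C := 1) (by fun_prop) (Filter.Eventually.of_forall fun ω => ?_)
    rw [Complex.norm_exp_ofReal_mul_I]
  have h2 : ∫ ω, Complex.exp (((b + r * inner ℝ (V.starProjection (vecOf n ω)) w : ℝ) : ℂ) *
      Complex.I) ∂drawLaw =
      Complex.exp (b * Complex.I) * Complex.exp ((-(r ^ 2 * ‖V.starProjection w‖ ^ 2 / 2) : ℝ) : ℂ) := by
    have : ∀ ω, Complex.exp (((b + r * inner ℝ (V.starProjection (vecOf n ω)) w : ℝ) : ℂ) *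
      Complex.I) = Complex.exp (b * Complex.I) * Complex.exp ((r : ℂ) * (inner ℝ (V.starProjection (vecOf n ω)) w : ℝ) *
      Complex.I) := by
      intro ω
      rw [← Complex.exp_add]
      congr 1
      push_cast
      ring
    simp_rw [this]
    rw [integral_const_mul, h]
    congr 2
    push_cast
    simp
    ring
  have h3 := congrArg Complex.re h2
  rw [← Complex.ofReal_exp, Complex.re_mul_ofReal, Complex.exp_ofReal_mul_I_re] at h3
  rw [← h3]
  have h4 := integral_re (𝕜 := ℂ) hint
  simp only [RCLike.re_to_complex] at h4
  rw [← h4]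
  simp only [Complex.exp_ofReal_mul_I_re]

end RealRAM

/-! ### Measurability and law of the trajectory. -/

namespace EdgeWalkData

open RealRAM

variable {n m : ℕ} (D : EdgeWalkData n m)

theorem measurableSet_nearVar_eq (I : Finset (Fin n)) : MeasurableSet {x | D.nearVar x = I} := by
  have : {x | D.nearVar x = I} = ⋂ i, {x | 1 - D.δ ≤ |x i| ↔ i ∈ I} := by
    ext x; simp [nearVar, Finset.ext_iff]
  rw [this]
  refine MeasurableSet.iInter fun i => ?_
  have hm : MeasurableSet {x : EuclideanSpace ℝ (Fin n) | 1 - D.δ ≤ |x i|} :=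
    measurableSet_le measurable_const (by fun_prop)
  by_cases hi : i ∈ I
  · simpa [hi] using hm
  · simpa [hi, Set.compl_ofPred] using hm.compl

theorem measurableSet_nearDisc_eq (J : Finset (Fin m)) : MeasurableSet {x | D.nearDisc x = J} := by
  have : {x | D.nearDisc x = J} =
      ⋂ j, {x | D.c j - D.δ ≤ |inner ℝ (x - D.x₀) (D.v j)| ↔ j ∈ J} := by
    ext x; simp [nearDisc, Finset.ext_iff]
  rw [this]
  refine MeasurableSet.iInter fun j => ?_
  have hm : MeasurableSet {x : EuclideanSpace ℝ (Fin n) |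
      D.c j - D.δ ≤ |inner ℝ (x - D.x₀) (D.v j)|} :=
    (isClosed_le continuous_const (by fun_prop)).measurableSet
  by_cases hj : j ∈ J
  · simpa [hj] using hm
  · simpa [hj, Set.compl_ofPred] using hm.compl

/-- The near sets take finitely many values with measurable level sets, so a function depending on
them is measurable once it is so for each fixed value. -/
theorem measurable_comp_near {α β : Type*} [MeasurableSpace α] [MeasurableSpace β]
    {X : α → EuclideanSpace ℝ (Fin n)} (hX : Measurable X)
    {F : Finset (Fin n) → Finset (Fin m) → α → β} (hF : ∀ I J, Measurable (F I J)) :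
    Measurable fun a => F (D.nearVar (X a)) (D.nearDisc (X a)) a := by
  intro S hS
  have : (fun a => F (D.nearVar (X a)) (D.nearDisc (X a)) a) ⁻¹' S = ⋃ I, ⋃ J,
      (X ⁻¹' ({x | D.nearVar x = I} ∩ {x | D.nearDisc x = J})) ∩ F I J ⁻¹' S := by
    ext h
    simp only [Set.mem_preimage, Set.mem_iUnion, Set.mem_inter_iff, Set.mem_ofPred_eq]
    constructor
    · intro hh
      exact ⟨_, _, ⟨rfl, rfl⟩, hh⟩
    · rintro ⟨I, J, ⟨rfl, rfl⟩, hh⟩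
      exact hh
  rw [this]
  exact MeasurableSet.iUnion fun I => MeasurableSet.iUnion fun J =>
    (hX ((D.measurableSet_nearVar_eq I).inter (D.measurableSet_nearDisc_eq J))).inter (hF I J hS)

/-- One step of the walk from `x`, driven by the first `n` draws. -/
noncomputable def next (x : EuclideanSpace ℝ (Fin n)) (ω : ℕ → ℝ) : EuclideanSpace ℝ (Fin n) :=
  x + D.γ • (D.freeSpace x).starProjection (vecOf n ω)

theorem measurable_next : Measurable (Function.uncurry D.next) := by
  have h : Measurable fun p : EuclideanSpace ℝ (Fin n) × (ℕ → ℝ) =>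
      (D.freeSpace p.1).starProjection (vecOf n p.2) :=
    D.measurable_comp_near (F := fun I J p => (D.orthTo I J).starProjection (vecOf n p.2))
      measurable_fst fun I J => by fun_prop
  exact measurable_fst.add (h.const_smul D.γ)

theorem path_succ (ω : ℕ → ℝ) (t : ℕ) :
    D.path ω (t + 1) = D.next (D.path ω t) (shift (t * n) ω) := rfl

theorem measurable_path (t : ℕ) : Measurable fun ω => D.path ω t := by
  induction t with
  | zero => exact measurable_const
  | succ t ih => exact D.measurable_next.comp (ih.prodMk (measurable_shift _))

theorem usesDraws_path (t : ℕ) : UsesDraws (t * n) fun ω => D.path ω t := by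
  induction t with
  | zero => intro ω ω' _; rfl
  | succ t ih =>
    intro ω ω' h
    have h1 : D.path ω t = D.path ω' t :=
      ih ω ω' fun i hi => h i (hi.trans_le (Nat.mul_le_mul_right n (Nat.le_succ t)))
    have h2 : vecOf n (shift (t * n) ω) = vecOf n (shift (t * n) ω') :=
      vecOf_congr fun i hi => h (t * n + i) (by rw [Nat.succ_mul]; omega)
    simp only [path_succ, next]
    simp only [h1, h2]

/-- Induction on `T`: the history uses the first `T * n` draws, so `lintegral_fresh` turns the next
step into a kernel. Projecting fresh draws yields exactly the kernel `step`. -/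
theorem map_path (T : ℕ) :
    drawLaw.map (fun ω (t : Fin (T + 1)) => D.path ω t) = D.walkLaw T := by
  have hmeas : ∀ T, Measurable fun ω (t : Fin (T + 1)) => D.path ω t :=
    fun T => measurable_pi_iff.2 fun t => D.measurable_path t
  induction T with
  | zero =>
    have : (fun ω (t : Fin 1) => D.path ω t) = fun _ _ => D.x₀ := by
      funext ω t
      rw [Subsingleton.elim t 0]
      rfl
    rw [walkLaw, zero_add, this, Measure.map_const]
    simp
  | succ T ih =>
    ext S hS
    rw [walkLaw, ← ih, Measure.bind_apply hS (D.measurable_step T).aemeasurable,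
      lintegral_map (f := fun h => D.step T h S)
        ((Measure.measurable_coe hS).comp (D.measurable_step T)) (hmeas T),
      Measure.map_apply (hmeas _) hS, ← lintegral_indicator_one ((hmeas _) hS)]
    have hsn : Measurable fun p : (Fin (T + 1) → EuclideanSpace ℝ (Fin n)) × (ℕ → ℝ) =>
        (Fin.snoc (α := fun _ => EuclideanSpace ℝ (Fin n)) p.1 (D.next (p.1 (Fin.last T)) p.2) :
          Fin (T + 2) → EuclideanSpace ℝ (Fin n)) := by
      refine measurable_pi_iff.2 fun i => ?_
      refine Fin.lastCases ?_ (fun i => ?_) i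
      · simp only [Fin.snoc_last]
        have hp : Measurable fun p : (Fin (T + 1) → EuclideanSpace ℝ (Fin n)) × (ℕ → ℝ) =>
            (p.1 (Fin.last T), p.2) := by fun_prop
        exact D.measurable_next.comp hp
      · simp only [Fin.snoc_castSucc]
        fun_prop
    have hfr := lintegral_fresh (g := fun ω (t : Fin (T + 1)) => D.path ω t) (k := T * n)
      (Φ := fun h ω => S.indicator 1 (Fin.snoc (α := fun _ => EuclideanSpace ℝ (Fin n)) h
        (D.next (h (Fin.last T)) ω) : Fin (T + 2) → EuclideanSpace ℝ (Fin n))) (hmeas T) ?_ ?_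
    · refine Eq.trans (lintegral_congr fun ω => ?_) (hfr.trans (lintegral_congr fun ω => ?_))
      · rw [show (S.indicator 1 (Fin.snoc (α := fun _ => EuclideanSpace ℝ (Fin n))
            (fun t : Fin (T + 1) => D.path ω t)
            (D.next (D.path ω (Fin.last T)) (shift (T * n) ω)) :
            Fin (T + 2) → EuclideanSpace ℝ (Fin n)) : ENNReal) =
            S.indicator 1 fun t : Fin (T + 2) => D.path ω t from ?_]
        · rfl
        · congr 1
          funext t
          refine Fin.lastCases ?_ (fun i => ?_) t
          · simp only [Fin.snoc_last, Fin.val_last]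
            rfl
          · simp
      · rw [step, ← map_starProjection, ← map_vecOf, Measure.map_map (by fun_prop) (by fun_prop),
          Measure.map_map ?_ (by fun_prop), Measure.map_apply ?_ hS,
          ← lintegral_indicator_one]
        · rfl
        · exact (hsn.comp (measurable_prodMk_left (x := fun t : Fin (T + 1) => D.path ω t))) hS
        · exact hsn.comp (measurable_prodMk_left (x := fun t : Fin (T + 1) => D.path ω t))
        · exact ((D.measurable_snoc_step T).comp
            (measurable_prodMk_left (x := fun t : Fin (T + 1) => D.path ω t))).comp (by fun_prop)
    · intro ω ω' h
      funext t
      exact D.usesDraws_path t ω ω' fun i hi => h i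
        (hi.trans_le (Nat.mul_le_mul_right n (Nat.lt_succ_iff.1 t.2)))
    · exact (measurable_one.indicator hS).comp hsn

end EdgeWalkData

/-- Edge-Walk runs on the machine in time `O(Tmn + n³ + Tn²)`. -/
theorem edgeWalk_program :
    ∃ (p : RealRAM.Prog) (C : ℕ), ∀ (n m T : ℕ) (D : EdgeWalkData n m), 0 < n →
      ∃ X : (ℕ → ℝ) → Fin (T + 1) → EuclideanSpace ℝ (Fin n),
        Measurable X ∧ RealRAM.drawLaw.map X = D.walkLaw T ∧
        ∀ ω : ℕ → ℝ, ∃ (k : ℕ) (s : RealRAM.Store),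
          RealRAM.Exec ω p (D.input T) k s ∧
          k ≤ C * (T * m * n + n ^ 3 + T * n ^ 2) ∧
          ((∃ t : Fin T, n ≤ (D.nearDisc (X ω t.castSucc)).card) → s.idx 3 = 1) ∧
          ((¬ ∃ t : Fin T, n ≤ (D.nearDisc (X ω t.castSucc)).card) →
            s.idx 3 = 0 ∧ ∀ i : Fin n, s.arr 3 i 0 = X ω (Fin.last T) i) := by
  refine ⟨RealRAM.edgeWalkP, 500, fun n m T D hn =>
    ⟨fun ω t => D.path ω t, measurable_pi_iff.2 fun t => D.measurable_path t, D.map_path T,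
      fun ω => ?_⟩⟩
  have hE : RealRAM.Encodes (D.input T) D T :=
    ⟨rfl, rfl, rfl, rfl, rfl, fun j i => by simp [EdgeWalkData.input, RealRAM.padMat,
      RealRAM.padVec], fun j => by simp [EdgeWalkData.input, RealRAM.padVec],
      fun i => by simp [EdgeWalkData.input, RealRAM.padVec]⟩
  have hω : (fun k => ω ((D.input T).drawn + k)) = ω := by
    funext k
    simp [EdgeWalkData.input]
  refine RealRAM.wp_edgeWalkP (ω := ω) hn hE ?_
  rw [hω]
  intro k s _ hk _ hfail hok
  refine ⟨hk, ?_, fun h => ?_⟩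
  · rintro ⟨t, ht⟩
    exact hfail ⟨t, t.2, by simpa using ht⟩
  · obtain ⟨h1, h2⟩ := hok fun ⟨t, ht, h'⟩ => h ⟨⟨t, ht⟩, by simpa using h'⟩
    refine ⟨h1, fun i => ?_⟩
    simp only [Fin.val_last]
    rw [← h2]
    rfl

/-! ### Energy and deviation estimates for the walk -/

/-- The trace of a projection is its rank, and `‖P eᵢ‖² = ⟨P eᵢ, eᵢ⟩`. -/
theorem sum_norm_sq_starProjection {n : ℕ} (V : Submodule ℝ (EuclideanSpace ℝ (Fin n))) :
    ∑ i : Fin n, ‖V.starProjection (EuclideanSpace.single i 1)‖ ^ 2 = Module.finrank ℝ V := by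
  have h : LinearMap.IsProj V (V.starProjection : EuclideanSpace ℝ (Fin n) →ₗ[ℝ] _) :=
    ⟨fun x => Submodule.starProjection_apply_mem V x,
      fun x hx => Submodule.starProjection_eq_self_iff.2 hx⟩
  have h1 := h.trace
  rw [LinearMap.trace_eq_sum_inner _ (EuclideanSpace.basisFun (Fin n) ℝ)] at h1
  rw [← h1]
  refine Finset.sum_congr rfl fun i _ => ?_
  rw [EuclideanSpace.basisFun_apply, ContinuousLinearMap.coe_coe, ← real_inner_self_eq_norm_sq,
    Submodule.inner_starProjection_left_eq_right,
    Submodule.starProjection_eq_self_iff.2 (Submodule.starProjection_apply_mem V _)]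

/-- A Gaussian tail bound from a bound on the moment generating function. -/
theorem measure_abs_ge_le_of_lintegral_exp_le {Ω : Type*} [MeasurableSpace Ω] {μ : Measure Ω}
    {f : Ω → ℝ} (hf : Measurable f) {v u : ℝ} (hv : 0 < v)
    (h : ∀ θ : ℝ, ∫⁻ ω, ENNReal.ofReal (Real.exp (θ * f ω)) ∂μ ≤
      ENNReal.ofReal (Real.exp (θ ^ 2 * v / 2))) (hu : 0 ≤ u) :
    μ {ω | u ≤ |f ω|} ≤ ENNReal.ofReal (2 * Real.exp (-(u ^ 2 / (2 * v)))) := by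
  -- Chernoff's bound at the optimal `θ = ± u / v`, one sign for each tail.
  have key : ∀ θ : ℝ, θ ^ 2 = (u / v) ^ 2 → μ {ω | u ^ 2 / v ≤ θ * f ω} ≤
      ENNReal.ofReal (Real.exp (-(u ^ 2 / (2 * v)))) := by
    intro θ hθ
    have h1 := mul_meas_ge_le_lintegral (μ := μ)
      (f := fun ω => ENNReal.ofReal (Real.exp (θ * f ω))) (by fun_prop)
      (ENNReal.ofReal (Real.exp (u ^ 2 / v)))
    have h2 : {ω | u ^ 2 / v ≤ θ * f ω} ⊆ {ω | ENNReal.ofReal (Real.exp (u ^ 2 / v)) ≤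
        ENNReal.ofReal (Real.exp (θ * f ω))} := fun ω hω =>
      ENNReal.ofReal_le_ofReal (Real.exp_le_exp.2 hω)
    have h3 : ENNReal.ofReal (Real.exp (u ^ 2 / v)) * μ {ω | u ^ 2 / v ≤ θ * f ω} ≤
        ENNReal.ofReal (Real.exp (θ ^ 2 * v / 2)) :=
      ((mul_le_mul_right (measure_mono h2) _).trans h1).trans (h θ)
    have h4 : ENNReal.ofReal (Real.exp (-(u ^ 2 / (2 * v)))) =
        ENNReal.ofReal (Real.exp (-(u ^ 2 / v))) * ENNReal.ofReal (Real.exp (θ ^ 2 * v / 2)) := by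
      rw [← ENNReal.ofReal_mul (Real.exp_pos _).le, ← Real.exp_add, hθ]
      congr 2
      field_simp
      ring
    have h5 : ENNReal.ofReal (Real.exp (-(u ^ 2 / v))) * ENNReal.ofReal (Real.exp (u ^ 2 / v)) =
        1 := by
      rw [← ENNReal.ofReal_mul (Real.exp_pos _).le, ← Real.exp_add]
      simp
    calc μ {ω | u ^ 2 / v ≤ θ * f ω} = ENNReal.ofReal (Real.exp (-(u ^ 2 / v))) *
          (ENNReal.ofReal (Real.exp (u ^ 2 / v)) * μ {ω | u ^ 2 / v ≤ θ * f ω}) := by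
          rw [← mul_assoc, h5, one_mul]
      _ ≤ _ := by rw [h4]; exact mul_le_mul_right h3 _
  have hsub : {ω | u ≤ |f ω|} ⊆ {ω | u ^ 2 / v ≤ (u / v) * f ω} ∪
      {ω | u ^ 2 / v ≤ (-(u / v)) * f ω} := by
    intro ω hω
    have hω' : u ≤ |f ω| := hω
    have huv : 0 ≤ u / v := by positivity
    rcases le_total 0 (f ω) with h0 | h0
    · left
      rw [abs_of_nonneg h0] at hω'
      have := mul_le_mul_of_nonneg_left hω' huv
      simp only [Set.mem_ofPred_eq]
      calc u ^ 2 / v = u / v * u := by ring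
        _ ≤ _ := this
    · right
      rw [abs_of_nonpos h0] at hω'
      have := mul_le_mul_of_nonneg_left hω' huv
      simp only [Set.mem_ofPred_eq]
      calc u ^ 2 / v = u / v * u := by ring
        _ ≤ u / v * -f ω := this
        _ = _ := by ring
  calc μ {ω | u ≤ |f ω|} ≤ _ := measure_mono hsub
    _ ≤ _ := measure_union_le _ _
    _ ≤ _ := add_le_add (key _ rfl) (key _ (by ring))
    _ = _ := by rw [← ENNReal.ofReal_add (Real.exp_pos _).le (Real.exp_pos _).le, ← two_mul]

namespace EdgeWalkData

open RealRAM

variable {n m : ℕ} (D : EdgeWalkData n m)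

theorem starProjection_single_eq_zero {x : EuclideanSpace ℝ (Fin n)} {i : Fin n}
    (hi : i ∈ D.nearVar x) :
    (D.freeSpace x).starProjection (EuclideanSpace.single i 1) = 0 := by
  rw [Submodule.starProjection_apply_eq_zero_iff, Submodule.mem_orthogonal']
  intro u hu
  simp [EuclideanSpace.inner_single_left, ((D.mem_orthTo).1 hu).1 i hi]

/-- Vectors of the free space vanish on frozen coordinates, so zeroing `w` there leaves its
projection unchanged. As a result the variance of a step scales with the number of active
coordinates instead of `n`. -/
theorem norm_sq_starProjection_le {x w : EuclideanSpace ℝ (Fin n)} (hw : ∀ i, |w i| ≤ 1) :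
    ‖(D.freeSpace x).starProjection w‖ ^ 2 ≤ ((D.nearVar x)ᶜ.card : ℝ) := by
  classical
  set w' : EuclideanSpace ℝ (Fin n) :=
    WithLp.toLp 2 fun i => if i ∈ D.nearVar x then 0 else w i with hw'
  have h1 : (D.freeSpace x).starProjection w = (D.freeSpace x).starProjection w' := by
    rw [← sub_eq_zero, ← map_sub, Submodule.starProjection_apply_eq_zero_iff,
      Submodule.mem_orthogonal']
    intro u hu
    rw [PiLp.inner_apply]
    refine Finset.sum_eq_zero fun i _ => ?_
    by_cases hi : i ∈ D.nearVar x
    · simp [((D.mem_orthTo).1 hu).1 i hi]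
    · simp [hw', hi]
  rw [h1]
  calc ‖(D.freeSpace x).starProjection w'‖ ^ 2 ≤ ‖w'‖ ^ 2 := by
        gcongr
        exact Submodule.norm_starProjection_apply_le _ _
    _ = ∑ i, (w' i) ^ 2 := EuclideanSpace.real_norm_sq_eq _
    _ ≤ ∑ i, if i ∈ (D.nearVar x)ᶜ then (1 : ℝ) else 0 := by
        refine Finset.sum_le_sum fun i _ => ?_
        by_cases hi : i ∈ D.nearVar x
        · simp [hw', hi]
        · have := hw i
          simp only [hw', hi, Finset.mem_compl, if_false, not_false_iff, if_true]
          rw [← sq_abs]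
          nlinarith [abs_nonneg (w i)]
    _ = _ := by rw [Finset.sum_ite_mem]; simp

/-- The free space is the orthogonal complement of at most `|nearVar| + |nearDisc|` vectors. Thus a
small dimension together with few discrepancy hits forces many frozen coordinates. -/
theorem le_finrank_freeSpace (x : EuclideanSpace ℝ (Fin n)) :
    (D.nearVar x)ᶜ.card ≤ Module.finrank ℝ (D.freeSpace x) + (D.nearDisc x).card := by
  classical
  set S : Finset (EuclideanSpace ℝ (Fin n)) :=
    (D.nearVar x).image (fun i => EuclideanSpace.single i (1 : ℝ)) ∪ (D.nearDisc x).image D.v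
    with hS
  have hV : D.freeSpace x = (Submodule.span ℝ (S : Set (EuclideanSpace ℝ (Fin n))))ᗮ := by
    ext u
    rw [Submodule.mem_orthogonal]
    constructor
    · intro hu v hv
      induction hv using Submodule.span_induction with
      | mem v hv =>
        simp only [hS, Finset.coe_union, Finset.coe_image, Set.mem_union, Set.mem_image,
          Finset.mem_coe] at hv
        rcases hv with ⟨i, hi, rfl⟩ | ⟨j, hj, rfl⟩
        · simp [EuclideanSpace.inner_single_left, ((D.mem_orthTo).1 hu).1 i hi]
        · rw [real_inner_comm]
          exact ((D.mem_orthTo).1 hu).2 j hj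
      | zero => simp
      | add a b _ _ ha hb => rw [inner_add_left, ha, hb, add_zero]
      | smul r a _ ha => rw [real_inner_smul_left, ha, mul_zero]
    · intro h
      refine (D.mem_orthTo).2 ⟨fun i hi => ?_, fun j hj => ?_⟩
      · have := h (EuclideanSpace.single i 1) (Submodule.subset_span (by
          simp only [hS, Finset.coe_union, Finset.coe_image]
          exact Or.inl ⟨i, hi, rfl⟩))
        simpa [EuclideanSpace.inner_single_left] using this
      · rw [real_inner_comm]
        exact h (D.v j) (Submodule.subset_span (by
          simp only [hS, Finset.coe_union, Finset.coe_image]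
          exact Or.inr ⟨j, hj, rfl⟩))
  have h1 := (Submodule.span ℝ (S : Set (EuclideanSpace ℝ (Fin n)))).finrank_add_finrank_orthogonal
  rw [← hV, finrank_euclideanSpace, Fintype.card_fin] at h1
  have h2 : Module.finrank ℝ (Submodule.span ℝ (S : Set (EuclideanSpace ℝ (Fin n)))) ≤ S.card :=
    finrank_span_finset_le_card S
  have h3 : S.card ≤ (D.nearVar x).card + (D.nearDisc x).card :=
    (Finset.card_union_le _ _).trans (add_le_add Finset.card_image_le Finset.card_image_le)
  have h4 := Finset.card_add_card_compl (D.nearVar x)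
  rw [Fintype.card_fin] at h4
  omega

/-- The energy of the coordinates in `S`. -/
noncomputable def energy (S : Finset (Fin n)) (x : EuclideanSpace ℝ (Fin n)) : ℝ :=
  ∑ i ∈ S, (1 + Real.cos (x i))

theorem energy_nonneg (S : Finset (Fin n)) (x : EuclideanSpace ℝ (Fin n)) : 0 ≤ energy S x :=
  Finset.sum_nonneg fun i _ => by linarith [Real.neg_one_le_cos (x i)]

theorem energy_le (S : Finset (Fin n)) (x : EuclideanSpace ℝ (Fin n)) :
    energy S x ≤ 2 * S.card := by
  calc energy S x ≤ ∑ i ∈ S, (2 : ℝ) :=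
        Finset.sum_le_sum fun i _ => by linarith [Real.cos_le_one (x i)]
    _ = _ := by simp [mul_comm]

theorem measurable_energy (S : Finset (Fin n)) : Measurable (energy S) := by
  unfold energy
  fun_prop

/-- If coordinate `i` moves by a Gaussian of variance `2y`, then `cos xᵢ` is multiplied by `exp
(-y)` on average. An active coordinate has `|xᵢ| ≤ 1`, hence `cos xᵢ ≥ 1/2`, and loses at least
`y/4`. The losses sum to `γ²/8` times the trace of the projection; overshooting the cube is harmless
because the energy stays bounded. -/
theorem lintegral_energy_next_le {S : Finset (Fin n)} {x : EuclideanSpace ℝ (Fin n)}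
    (hδ : 0 ≤ D.δ) (hγ : D.γ ^ 2 ≤ 2) (hS : (D.nearVar x)ᶜ ⊆ S) :
    ∫⁻ ω, ENNReal.ofReal (energy S (D.next x ω)) ∂drawLaw +
      ENNReal.ofReal (D.γ ^ 2 / 8) * (Module.finrank ℝ (D.freeSpace x) : ENNReal) ≤
      ENNReal.ofReal (energy S x) := by
  set V := D.freeSpace x with hV
  set σ : Fin n → ℝ := fun i => ‖V.starProjection (EuclideanSpace.single i 1)‖ with hσ
  have hmeas : Measurable fun ω => D.next x ω := D.measurable_next.comp measurable_prodMk_left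
  have hcoord : ∀ ω i, (D.next x ω) i =
      x i + D.γ * inner ℝ (V.starProjection (vecOf n ω)) (EuclideanSpace.single i 1) := by
    intro ω i
    simp [next, EuclideanSpace.inner_single_right, hV]
  have hint : ∀ i, Integrable (fun ω => 1 + Real.cos ((D.next x ω) i)) drawLaw := by
    intro i
    refine Integrable.of_bound (C := 2) ?_ (Filter.Eventually.of_forall fun ω => ?_)
    · exact Measurable.aestronglyMeasurable (by fun_prop)
    · rw [Real.norm_eq_abs, abs_le]
      constructor <;> linarith [Real.neg_one_le_cos ((D.next x ω) i),
        Real.cos_le_one ((D.next x ω) i)]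
  have hE : ∫ ω, energy S (D.next x ω) ∂drawLaw =
      ∑ i ∈ S, (1 + Real.cos (x i) * Real.exp (-(D.γ ^ 2 * σ i ^ 2 / 2))) := by
    unfold energy
    rw [integral_finsetSum _ fun i _ => hint i]
    refine Finset.sum_congr rfl fun i _ => ?_
    have hc := hint i
    have : Integrable (fun ω => Real.cos ((D.next x ω) i)) drawLaw := by
      refine (hc.sub (integrable_const (1 : ℝ))).congr (Filter.Eventually.of_forall fun ω => ?_)
      simp
    rw [integral_add (integrable_const _) this]
    simp_rw [hcoord]
    rw [integral_cos_inner]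
    simp [hσ]
  have hmain : ∫ ω, energy S (D.next x ω) ∂drawLaw + D.γ ^ 2 / 8 * (Module.finrank ℝ V : ℝ) ≤
      energy S x := by
    -- Coordinates outside `S` are frozen and contribute nothing to the trace.
    have hsum : (Module.finrank ℝ V : ℝ) = ∑ i ∈ S, σ i ^ 2 := by
      rw [← sum_norm_sq_starProjection]
      symm
      refine Finset.sum_subset (Finset.subset_univ S) fun i _ hi => ?_
      have : i ∈ D.nearVar x := by
        by_contra h
        exact hi (hS (Finset.mem_compl.2 h))
      simp [hσ, hV, D.starProjection_single_eq_zero this]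
    rw [hE, hsum, Finset.mul_sum, ← Finset.sum_add_distrib]
    refine Finset.sum_le_sum fun i _ => ?_
    by_cases hi : i ∈ D.nearVar x
    · have : σ i = 0 := by simp [hσ, hV, D.starProjection_single_eq_zero hi]
      simp [this]
    · have hxi : |x i| ≤ 1 := by
        rw [mem_nearVar, not_le] at hi
        linarith
      have hcos : 1 / 2 ≤ Real.cos (x i) := by
        have := Real.one_sub_sq_div_two_le_cos (x := x i)
        have h2 : x i ^ 2 ≤ 1 := by rw [← sq_abs]; nlinarith [abs_nonneg (x i)]
        linarith
      have hσ1 : σ i ≤ 1 := by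
        refine (Submodule.norm_starProjection_apply_le V _).trans ?_
        simp
      have hσ0 : 0 ≤ σ i := norm_nonneg _
      set y := D.γ ^ 2 * σ i ^ 2 / 2 with hy
      have hy0 : 0 ≤ y := by positivity
      have hy1 : y ≤ 1 := by
        have : σ i ^ 2 ≤ 1 := by nlinarith
        nlinarith [sq_nonneg D.γ, sq_nonneg (σ i)]
      -- From `exp (-y) ≤ 1 / (1 + y)` and `(1 + y)(1 - y/2) ≥ 1` for `0 ≤ y ≤ 1`.
      have hexp : Real.exp (-y) ≤ 1 - y / 2 := by
        have h1 := Real.add_one_le_exp y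
        have h2 : Real.exp (-y) * Real.exp y = 1 := by rw [← Real.exp_add]; simp
        have h3 := Real.exp_pos (-y)
        nlinarith
      have hpos := Real.exp_pos (-y)
      have : D.γ ^ 2 / 8 * σ i ^ 2 = y / 4 := by rw [hy]; ring
      rw [this]
      nlinarith
  rw [← ofReal_integral_eq_lintegral_ofReal
      (by unfold energy; exact integrable_finsetSum _ fun i _ => hint i)
      (Filter.Eventually.of_forall fun ω => energy_nonneg _ _),
    ← ENNReal.ofReal_natCast, ← ENNReal.ofReal_mul (by positivity), ← ENNReal.ofReal_add
      (integral_nonneg fun ω => energy_nonneg _ _) (by positivity)]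
  exact ENNReal.ofReal_le_ofReal hmain

end EdgeWalkData

/-! ### Expected dimension, deviations and acceptance of a walk. -/

namespace EdgeWalkData

open RealRAM

variable {n m : ℕ} (D : EdgeWalkData n m)

theorem nearVar_path_mono (ω : ℕ → ℝ) {t t' : ℕ} (h : t ≤ t') :
    D.nearVar (D.path ω t) ⊆ D.nearVar (D.path ω t') := by
  induction t', h using Nat.le_induction with
  | base => exact subset_rfl
  | succ t' _ ih => exact ih.trans (D.nearVar_path_subset ω t')

theorem nearDisc_path_mono (ω : ℕ → ℝ) {t t' : ℕ} (h : t ≤ t') :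
    D.nearDisc (D.path ω t) ⊆ D.nearDisc (D.path ω t') := by
  induction t', h using Nat.le_induction with
  | base => exact subset_rfl
  | succ t' _ ih => exact ih.trans (D.nearDisc_path_subset ω t')

theorem freeSpace_path_anti (ω : ℕ → ℝ) {t t' : ℕ} (h : t ≤ t') :
    D.freeSpace (D.path ω t') ≤ D.freeSpace (D.path ω t) := fun _ hu =>
  (D.mem_orthTo).2 ⟨fun i hi => ((D.mem_orthTo).1 hu).1 i (D.nearVar_path_mono ω h hi),
    fun j hj => ((D.mem_orthTo).1 hu).2 j (D.nearDisc_path_mono ω h hj)⟩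

theorem measurable_finrank_path (t : ℕ) :
    Measurable fun ω => (Module.finrank ℝ (D.freeSpace (D.path ω t)) : ENNReal) :=
  D.measurable_comp_near (F := fun I J _ => (Module.finrank ℝ (D.orthTo I J) : ENNReal))
    (D.measurable_path t) fun _ _ => measurable_const

theorem measurable_card_nearDisc_path (t : ℕ) :
    Measurable fun ω => ((D.nearDisc (D.path ω t)).card : ENNReal) :=
  D.measurable_comp_near (F := fun _ J _ => (J.card : ENNReal))
    (D.measurable_path t) fun _ _ => measurable_const

theorem lintegral_path_succ (t : ℕ) {Φ : EuclideanSpace ℝ (Fin n) → EuclideanSpace ℝ (Fin n) →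
    ENNReal} (hΦ : Measurable (Function.uncurry Φ)) :
    ∫⁻ ω, Φ (D.path ω t) (D.path ω (t + 1)) ∂drawLaw =
      ∫⁻ ω, ∫⁻ ω', Φ (D.path ω t) (D.next (D.path ω t) ω') ∂drawLaw ∂drawLaw := by
  refine lintegral_fresh (Φ := fun x ω' => Φ x (D.next x ω')) (D.measurable_path t)
    (D.usesDraws_path t) ?_
  exact hΦ.comp (measurable_fst.prodMk D.measurable_next)

/-- The one-step decrease telescopes. The coordinate set is fixed to those active at the start,
which contains every later active set. -/
theorem lintegral_energy_path_le (hδ : 0 ≤ D.δ) (hγ : D.γ ^ 2 ≤ 2) (T : ℕ) :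
    ∫⁻ ω, ENNReal.ofReal (energy (D.nearVar D.x₀)ᶜ (D.path ω T)) ∂drawLaw +
      ∑ t ∈ Finset.range T, ENNReal.ofReal (D.γ ^ 2 / 8) *
        ∫⁻ ω, (Module.finrank ℝ (D.freeSpace (D.path ω t)) : ENNReal) ∂drawLaw ≤
      ENNReal.ofReal (energy (D.nearVar D.x₀)ᶜ D.x₀) := by
  induction T with
  | zero => simp [path]
  | succ T ih =>
    refine le_trans ?_ ih
    rw [Finset.sum_range_succ, add_comm (Finset.sum _ _), ← add_assoc]
    refine add_le_add_left ?_ _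
    rw [D.lintegral_path_succ T
      (Φ := fun _ y => ENNReal.ofReal (energy (D.nearVar D.x₀)ᶜ y))
      (((measurable_energy _).comp measurable_snd).ennreal_ofReal),
      ← lintegral_const_mul _ (D.measurable_finrank_path T),
      ← lintegral_add_right _ ((D.measurable_finrank_path T).const_mul _)]
    refine lintegral_mono fun ω => ?_
    exact D.lintegral_energy_next_le hδ hγ
      (Finset.compl_subset_compl.2 (D.nearVar_path_mono ω (Nat.zero_le T)))

/-- The free spaces decrease along a trajectory, so the last dimension is at most each of the `T`
dimensions in the telescoped sum, and that sum is paid for by the initial energy. -/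
theorem lintegral_finrank_path_le (hδ : 0 ≤ D.δ) (hγ : D.γ ^ 2 ≤ 2) (T : ℕ) :
    ENNReal.ofReal (T * (D.γ ^ 2 / 8)) *
      ∫⁻ ω, (Module.finrank ℝ (D.freeSpace (D.path ω T)) : ENNReal) ∂drawLaw ≤
      ENNReal.ofReal (2 * (D.nearVar D.x₀)ᶜ.card) := by
  refine le_trans ?_ ((le_add_self.trans (D.lintegral_energy_path_le hδ hγ T)).trans
    (ENNReal.ofReal_le_ofReal (energy_le _ _)))
  rw [ENNReal.ofReal_mul (by positivity), ENNReal.ofReal_natCast, mul_assoc]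
  calc (T : ENNReal) * (ENNReal.ofReal (D.γ ^ 2 / 8) *
        ∫⁻ ω, (Module.finrank ℝ (D.freeSpace (D.path ω T)) : ENNReal) ∂drawLaw)
      = ∑ t ∈ Finset.range T, ENNReal.ofReal (D.γ ^ 2 / 8) *
        ∫⁻ ω, (Module.finrank ℝ (D.freeSpace (D.path ω T)) : ENNReal) ∂drawLaw := by simp
    _ ≤ _ := by
      refine Finset.sum_le_sum fun t ht => mul_le_mul_right (lintegral_mono fun ω => ?_) _
      exact Nat.cast_le.2 (Submodule.finrank_mono
        (D.freeSpace_path_anti ω (Finset.mem_range.1 ht).le))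

theorem lintegral_exp_next (x w : EuclideanSpace ℝ (Fin n)) (θ : ℝ) :
    ∫⁻ ω, ENNReal.ofReal (Real.exp (θ * inner ℝ (D.next x ω - x) w)) ∂drawLaw =
      ENNReal.ofReal (Real.exp (θ ^ 2 * (D.γ ^ 2 * ‖(D.freeSpace x).starProjection w‖ ^ 2) / 2)) := by
  have h := lintegral_exp_inner (D.freeSpace x) w (θ * D.γ)
  rw [show θ ^ 2 * (D.γ ^ 2 * ‖(D.freeSpace x).starProjection w‖ ^ 2) / 2 =
    (θ * D.γ) ^ 2 * ‖(D.freeSpace x).starProjection w‖ ^ 2 / 2 by ring, ← h]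
  refine lintegral_congr fun ω => ?_
  rw [next, add_sub_cancel_left, real_inner_smul_left, mul_assoc]

/-- Conditionally on the past, a step multiplies the moment generating function by at most `exp (θ²
γ² a / 2)`, with `a` the initial number of active coordinates. The set of active coordinates never
grows, so one factor serves every step. -/
theorem lintegral_exp_path_le {w : EuclideanSpace ℝ (Fin n)} (hw : ∀ i, |w i| ≤ 1) (θ : ℝ)
    (t : ℕ) :
    ∫⁻ ω, ENNReal.ofReal (Real.exp (θ * inner ℝ (D.path ω t - D.x₀) w)) ∂drawLaw ≤
      ENNReal.ofReal (Real.exp (θ ^ 2 * (D.γ ^ 2 * t * (D.nearVar D.x₀)ᶜ.card) / 2)) := by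
  induction t with
  | zero => simp [path]
  | succ t ih =>
    rw [D.lintegral_path_succ t
      (Φ := fun _ y => ENNReal.ofReal (Real.exp (θ * inner ℝ (y - D.x₀) w)))
      (by simp only [Function.uncurry_def]; fun_prop)]
    set a : ℝ := ((D.nearVar D.x₀)ᶜ.card : ℝ) with ha
    calc ∫⁻ ω, ∫⁻ ω', ENNReal.ofReal (Real.exp (θ * inner ℝ (D.next (D.path ω t) ω' - D.x₀) w))
          ∂drawLaw ∂drawLaw
        ≤ ∫⁻ ω, ENNReal.ofReal (Real.exp (θ * inner ℝ (D.path ω t - D.x₀) w)) *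
            ENNReal.ofReal (Real.exp (θ ^ 2 * (D.γ ^ 2 * a) / 2)) ∂drawLaw := by
          refine lintegral_mono fun ω => ?_
          have h1 : ∀ ω', ENNReal.ofReal (Real.exp (θ * inner ℝ (D.next (D.path ω t) ω' - D.x₀) w))
              = ENNReal.ofReal (Real.exp (θ * inner ℝ (D.path ω t - D.x₀) w)) *
              ENNReal.ofReal (Real.exp (θ * inner ℝ (D.next (D.path ω t) ω' - D.path ω t) w)) := by
            intro ω'
            rw [← ENNReal.ofReal_mul (Real.exp_pos _).le, ← Real.exp_add, ← mul_add,
              ← inner_add_left]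
            congr 4
            abel
          simp_rw [h1]
          have hm : Measurable fun ω' => D.next (D.path ω t) ω' :=
            D.measurable_next.comp measurable_prodMk_left
          rw [lintegral_const_mul _ (by fun_prop), D.lintegral_exp_next]
          refine mul_le_mul_right (ENNReal.ofReal_le_ofReal (Real.exp_le_exp.2 ?_)) _
          have h2 := D.norm_sq_starProjection_le (x := D.path ω t) hw
          have h3 : ((D.nearVar (D.path ω t))ᶜ.card : ℝ) ≤ a := by
            exact Nat.cast_le.2 (Finset.card_le_card
              (Finset.compl_subset_compl.2 (D.nearVar_path_mono ω (Nat.zero_le t))))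
          gcongr
          exact h2.trans h3
      _ = (∫⁻ ω, ENNReal.ofReal (Real.exp (θ * inner ℝ (D.path ω t - D.x₀) w)) ∂drawLaw) *
            ENNReal.ofReal (Real.exp (θ ^ 2 * (D.γ ^ 2 * a) / 2)) := by
          have := D.measurable_path t
          rw [lintegral_mul_const _ (by fun_prop)]
      _ ≤ ENNReal.ofReal (Real.exp (θ ^ 2 * (D.γ ^ 2 * t * a) / 2)) *
            ENNReal.ofReal (Real.exp (θ ^ 2 * (D.γ ^ 2 * a) / 2)) := mul_le_mul_left ih _
      _ = _ := by
          rw [← ENNReal.ofReal_mul (Real.exp_pos _).le, ← Real.exp_add]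
          congr 2
          push_cast
          ring

/-- A single step is unlikely to be large in a given direction. -/
theorem measure_step_ge_le {w : EuclideanSpace ℝ (Fin n)} {L u : ℝ} (hw : ‖w‖ ^ 2 ≤ L)
    (hL : 0 < L) (hγ : D.γ ≠ 0) (hu : 0 ≤ u) (t : ℕ) :
    drawLaw {ω | u ≤ |inner ℝ (D.path ω (t + 1) - D.path ω t) w|} ≤
      ENNReal.ofReal (2 * Real.exp (-(u ^ 2 / (2 * (D.γ ^ 2 * L))))) := by
  have hm := D.measurable_path t
  have hm' := D.measurable_path (t + 1)
  refine measure_abs_ge_le_of_lintegral_exp_le (by fun_prop) (by positivity) (fun θ => ?_) hu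
  rw [D.lintegral_path_succ t
    (Φ := fun x y => ENNReal.ofReal (Real.exp (θ * inner ℝ (y - x) w)))
    (by simp only [Function.uncurry_def]; fun_prop)]
  simp_rw [D.lintegral_exp_next]
  calc _ ≤ ∫⁻ ω, ENNReal.ofReal (Real.exp (θ ^ 2 * (D.γ ^ 2 * L) / 2)) ∂drawLaw := by
        refine lintegral_mono fun ω => ENNReal.ofReal_le_ofReal (Real.exp_le_exp.2 ?_)
        have := Submodule.norm_starProjection_apply_le (D.freeSpace (D.path ω t)) w
        gcongr
        refine le_trans ?_ hw
        gcongr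
    _ = _ := by simp

theorem measure_deviation_ge_le {w : EuclideanSpace ℝ (Fin n)} (hw : ∀ i, |w i| ≤ 1) {u : ℝ}
    {t : ℕ} (hpos : 0 < D.γ ^ 2 * t * (D.nearVar D.x₀)ᶜ.card) (hu : 0 ≤ u) :
    drawLaw {ω | u ≤ |inner ℝ (D.path ω t - D.x₀) w|} ≤
      ENNReal.ofReal
        (2 * Real.exp (-(u ^ 2 / (2 * (D.γ ^ 2 * t * (D.nearVar D.x₀)ᶜ.card))))) := by
  have hm := D.measurable_path t
  exact measure_abs_ge_le_of_lintegral_exp_le (by fun_prop) hpos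
    (fun θ => D.lintegral_exp_path_le hw θ t) hu

/-- The walk has produced a usable partial colouring. -/
def Accepts (T : ℕ) (ω : ℕ → ℝ) : Prop :=
  (∀ t < T, (D.nearDisc (D.path ω t)).card < n) ∧ (∀ i, |D.path ω T i| ≤ 1) ∧
    (∀ j, |inner ℝ (D.path ω T - D.x₀) (D.v j)| ≤ 2 * D.c j) ∧
    2 * (D.nearVar (D.path ω T))ᶜ.card ≤ (D.nearVar D.x₀)ᶜ.card

/-- A coordinate that still moves is below `1 - δ` in absolute value, so a step shorter than `δ`
cannot leave the cube; any other coordinate stands still. -/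
theorem abs_path_le_one {ω : ℕ → ℝ} {T : ℕ} {i : Fin n} (h0 : |D.x₀ i| ≤ 1)
    (h : ∀ t < T, |inner ℝ (D.path ω (t + 1) - D.path ω t) (EuclideanSpace.single i 1)| < D.δ) :
    |D.path ω T i| ≤ 1 := by
  induction T with
  | zero => exact h0
  | succ T ih =>
    have ih := ih fun t ht => h t (by omega)
    by_cases hi : i ∈ D.nearVar (D.path ω T)
    · have : D.path ω (T + 1) i = D.path ω T i :=
        D.apply_add_eq_of_mem_freeSpace (Submodule.starProjection_apply_mem _ _) hi _
      rwa [this]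
    · rw [mem_nearVar, not_le] at hi
      have h1 := h T (by omega)
      rw [EuclideanSpace.inner_single_right] at h1
      simp only [one_mul, PiLp.sub_apply, conj_trivial] at h1
      calc |D.path ω (T + 1) i| = |D.path ω T i + (D.path ω (T + 1) i - D.path ω T i)| := by
            congr 1; ring
        _ ≤ |D.path ω T i| + |D.path ω (T + 1) i - D.path ω T i| := abs_add_le _ _
        _ ≤ 1 := by linarith

/-- Only jumps below `c` are required, giving the final bound `2 c`. Demanding jumps below `δ` would
be too much here, since steps in the direction `v j` can be much longer than in a coordinate
direction. -/
theorem abs_deviation_le {ω : ℕ → ℝ} {T : ℕ} {j : Fin m} (hδ : 0 ≤ D.δ) (hc : 0 ≤ D.c j)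
    (h : ∀ t < T, |inner ℝ (D.path ω (t + 1) - D.path ω t) (D.v j)| < D.c j) :
    |inner ℝ (D.path ω T - D.x₀) (D.v j)| ≤ 2 * D.c j := by
  induction T with
  | zero => simpa [path] using hc
  | succ T ih =>
    have ih := ih fun t ht => h t (by omega)
    by_cases hj : j ∈ D.nearDisc (D.path ω T)
    · have : inner ℝ (D.path ω (T + 1) - D.x₀) (D.v j) = inner ℝ (D.path ω T - D.x₀) (D.v j) :=
        D.inner_add_eq_of_mem_freeSpace (Submodule.starProjection_apply_mem _ _) hj _
      rwa [this]
    · rw [mem_nearDisc, not_le] at hj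
      have h1 := h T (by omega)
      have h2 : inner ℝ (D.path ω (T + 1) - D.x₀) (D.v j) =
          inner ℝ (D.path ω T - D.x₀) (D.v j) +
            inner ℝ (D.path ω (T + 1) - D.path ω T) (D.v j) := by
        rw [← inner_add_left]
        congr 1
        abel
      rw [h2]
      refine (abs_add_le _ _).trans ?_
      linarith

/-- With suitable parameters the walk produces a usable partial colouring with probability at
least one half. -/
theorem measure_not_accepts_le {T : ℕ} {c : ℝ} (hn : 0 < n) (hγT : D.γ ^ 2 * T = 256)
    (hγ : D.γ ^ 2 ≤ 2) (hδ : 0 < D.δ) (hc : ∀ j, D.c j = c) (hcδ : D.δ ≤ c)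
    (hx₀ : ∀ i, |D.x₀ i| ≤ 1) (hv : ∀ j i, |D.v j i| ≤ 1) (ha : 0 < (D.nearVar D.x₀)ᶜ.card)
    (hhits : 2 * m * Real.exp (-((c - D.δ) ^ 2 / (512 * (D.nearVar D.x₀)ᶜ.card))) ≤
      (D.nearVar D.x₀)ᶜ.card / 16)
    (hjumps : 2 * T * n * Real.exp (-(D.δ ^ 2 / (2 * D.γ ^ 2))) +
      2 * T * m * Real.exp (-(c ^ 2 / (2 * (D.γ ^ 2 * n)))) ≤ 1 / 16) :
    drawLaw {ω | ¬ D.Accepts T ω} ≤ ENNReal.ofReal (1 / 2) := by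
  classical
  set a : ℕ := (D.nearVar D.x₀)ᶜ.card with ha'
  have haR : (0 : ℝ) < a := by exact_mod_cast ha
  have hnR : (0 : ℝ) < n := by exact_mod_cast hn
  have hγ0 : D.γ ≠ 0 := by rintro h; rw [h] at hγT; norm_num at hγT
  have han : a ≤ n := by simpa using Finset.card_le_univ (D.nearVar D.x₀)ᶜ
  set JV : Set (ℕ → ℝ) := ⋃ t ∈ Finset.range T, ⋃ i : Fin n,
    {ω | D.δ ≤ |inner ℝ (D.path ω (t + 1) - D.path ω t) (EuclideanSpace.single i 1)|} with hJV
  set JD : Set (ℕ → ℝ) := ⋃ t ∈ Finset.range T, ⋃ j : Fin m,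
    {ω | c ≤ |inner ℝ (D.path ω (t + 1) - D.path ω t) (D.v j)|} with hJD
  set H : Set (ℕ → ℝ) := {ω | (n : ENNReal) ≤ ((D.nearDisc (D.path ω T)).card : ENNReal)} with hH
  set N : Set (ℕ → ℝ) := {ω | ((a : ENNReal) / 2) ≤
    (Module.finrank ℝ (D.freeSpace (D.path ω T)) : ENNReal) +
      ((D.nearDisc (D.path ω T)).card : ENNReal)} with hN
  -- Four ways to be rejected: a long coordinate step, a long step along some `v j`, at least `n`
  -- hits, or dimension plus hits at least `a / 2`. By monotonicity the last two need testing only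
  -- at time `T`.
  have hsub : {ω | ¬ D.Accepts T ω} ⊆ (JV ∪ JD) ∪ (H ∪ N) := by
    intro ω hω
    by_contra hcon
    apply hω
    simp only [Set.mem_union, not_or, hJV, hJD, Set.mem_iUnion, not_exists, Set.mem_ofPred_eq,
      Finset.mem_range, not_le, hH, hN] at hcon
    obtain ⟨⟨h1, h2⟩, h3, h4⟩ := hcon
    refine ⟨fun t ht => ?_, fun i => ?_, fun j => ?_, ?_⟩
    · refine lt_of_le_of_lt (Finset.card_le_card (D.nearDisc_path_mono ω ht.le)) ?_
      exact_mod_cast h3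
    · exact D.abs_path_le_one (hx₀ i) fun t ht => h1 t ht i
    · refine D.abs_deviation_le hδ.le (by rw [hc]; linarith) fun t ht => ?_
      rw [hc]
      exact h2 t ht j
    · have h5 := D.le_finrank_freeSpace (D.path ω T)
      rw [ENNReal.lt_div_iff_mul_lt (Or.inl (by norm_num)) (Or.inl (by norm_num))] at h4
      have h6 : (Module.finrank ℝ (D.freeSpace (D.path ω T)) +
        (D.nearDisc (D.path ω T)).card) * 2 < a := by exact_mod_cast h4
      omega
  have hEH : ∫⁻ ω, ((D.nearDisc (D.path ω T)).card : ENNReal) ∂drawLaw ≤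
      ENNReal.ofReal (a / 16) := by
    have h1 : ∀ ω, ((D.nearDisc (D.path ω T)).card : ENNReal) =
        ∑ j : Fin m, Set.indicator {ω | c - D.δ ≤ |inner ℝ (D.path ω T - D.x₀) (D.v j)|} 1 ω := by
      intro ω
      rw [nearDisc, Finset.card_filter]
      push_cast
      refine Finset.sum_congr rfl fun j _ => ?_
      rw [hc, Set.indicator_apply]
      simp
    have hm := D.measurable_path T
    have hms : ∀ j, MeasurableSet {ω | c - D.δ ≤ |inner ℝ (D.path ω T - D.x₀) (D.v j)|} :=
      fun j => measurableSet_le measurable_const (by fun_prop)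
    simp_rw [h1]
    rw [lintegral_finsetSum _ fun j _ => measurable_one.indicator (hms j)]
    simp_rw [lintegral_indicator_one (hms _)]
    have h2 : ∀ j, drawLaw {ω | c - D.δ ≤ |inner ℝ (D.path ω T - D.x₀) (D.v j)|} ≤
        ENNReal.ofReal (2 * Real.exp (-((c - D.δ) ^ 2 / (512 * a)))) := by
      intro j
      have := D.measure_deviation_ge_le (hv j) (t := T) (u := c - D.δ)
        (by rw [hγT]; positivity) (by linarith)
      rwa [hγT, ← ha', ← mul_assoc, show (2 : ℝ) * 256 = 512 by norm_num] at this
    calc _ ≤ ∑ j : Fin m, ENNReal.ofReal (2 * Real.exp (-((c - D.δ) ^ 2 / (512 * a)))) :=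
          Finset.sum_le_sum fun j _ => h2 j
      _ = ENNReal.ofReal (m * (2 * Real.exp (-((c - D.δ) ^ 2 / (512 * a))))) := by
          rw [ENNReal.ofReal_mul (by positivity)]; simp
      _ ≤ _ := by
          refine ENNReal.ofReal_le_ofReal (le_trans (le_of_eq ?_) hhits)
          ring
  have hEF : ∫⁻ ω, (Module.finrank ℝ (D.freeSpace (D.path ω T)) : ENNReal) ∂drawLaw ≤
      ENNReal.ofReal (a / 16) := by
    have h1 := D.lintegral_finrank_path_le hδ.le hγ T
    rw [show (T : ℝ) * (D.γ ^ 2 / 8) = 32 by linarith, ← ha'] at h1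
    -- With `γ² T = 256` the energy bound reads `32 · E dim ≤ 2 a`, so the expected dimension is at
    -- most `a / 16`.
    have h2 : ENNReal.ofReal (2 * a) = ENNReal.ofReal 32 * ENNReal.ofReal (a / 16) := by
      rw [← ENNReal.ofReal_mul (by norm_num)]
      congr 1
      ring
    rw [h2] at h1
    exact (ENNReal.mul_le_mul_iff_right (by norm_num) (by norm_num)).1 h1
  have hPH : drawLaw H ≤ ENNReal.ofReal (1 / 16) := by
    have h1 := meas_ge_le_lintegral_div (μ := drawLaw)
      (D.measurable_card_nearDisc_path T).aemeasurable (ε := (n : ENNReal))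
      (by exact_mod_cast hn.ne') (by simp)
    refine h1.trans ?_
    refine ENNReal.div_le_of_le_mul (hEH.trans ?_)
    rw [← ENNReal.ofReal_natCast, ← ENNReal.ofReal_mul (by norm_num)]
    refine ENNReal.ofReal_le_ofReal ?_
    have : (a : ℝ) ≤ n := by exact_mod_cast han
    linarith
  -- Markov's inequality: the expectation of dimension plus hits is at most `a / 8`, against the
  -- level `a / 2`.
  have hPN : drawLaw N ≤ ENNReal.ofReal (1 / 4) := by
    have h1 := meas_ge_le_lintegral_div (μ := drawLaw)
      ((D.measurable_finrank_path T).add (D.measurable_card_nearDisc_path T)).aemeasurable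
      (ε := (a : ENNReal) / 2) (by simp; omega)
      (ENNReal.div_ne_top (by simp) (by simp))
    refine h1.trans ?_
    refine ENNReal.div_le_of_le_mul ?_
    simp only [Pi.add_apply]
    rw [lintegral_add_left (D.measurable_finrank_path T)]
    refine (add_le_add hEF hEH).trans ?_
    rw [← ENNReal.ofReal_add (by positivity) (by positivity), ← ENNReal.ofReal_natCast,
      ← ENNReal.ofReal_ofNat, ← ENNReal.ofReal_div_of_pos (by norm_num),
      ← ENNReal.ofReal_mul (by norm_num)]
    refine ENNReal.ofReal_le_ofReal ?_
    linarith
  have hPJV : drawLaw JV ≤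
      ENNReal.ofReal (2 * T * n * Real.exp (-(D.δ ^ 2 / (2 * D.γ ^ 2)))) := by
    have h1 : ∀ t (i : Fin n), drawLaw {ω | D.δ ≤ |inner ℝ (D.path ω (t + 1) - D.path ω t)
        (EuclideanSpace.single i 1)|} ≤
        ENNReal.ofReal (2 * Real.exp (-(D.δ ^ 2 / (2 * D.γ ^ 2)))) := by
      intro t i
      have := D.measure_step_ge_le (w := EuclideanSpace.single i 1) (L := 1) (u := D.δ) (by simp)
        one_pos hγ0 hδ.le t
      rwa [mul_one] at this
    calc drawLaw JV ≤ ∑ t ∈ Finset.range T, ∑ i : Fin n,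
          ENNReal.ofReal (2 * Real.exp (-(D.δ ^ 2 / (2 * D.γ ^ 2)))) := by
          refine (measure_biUnion_finset_le _ _).trans (Finset.sum_le_sum fun t _ => ?_)
          exact (measure_iUnion_fintype_le _ _).trans (Finset.sum_le_sum fun i _ => h1 t i)
      _ = _ := by
          rw [show 2 * T * n * Real.exp (-(D.δ ^ 2 / (2 * D.γ ^ 2))) =
            T * (n * (2 * Real.exp (-(D.δ ^ 2 / (2 * D.γ ^ 2))))) by ring,
            ENNReal.ofReal_mul (by positivity), ENNReal.ofReal_mul (by positivity)]
          simp
  have hPJD : drawLaw JD ≤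
      ENNReal.ofReal (2 * T * m * Real.exp (-(c ^ 2 / (2 * (D.γ ^ 2 * n))))) := by
    have h1 : ∀ t (j : Fin m), drawLaw {ω | c ≤ |inner ℝ (D.path ω (t + 1) - D.path ω t)
        (D.v j)|} ≤ ENNReal.ofReal (2 * Real.exp (-(c ^ 2 / (2 * (D.γ ^ 2 * n))))) := by
      intro t j
      refine D.measure_step_ge_le (w := D.v j) (L := n) (u := c) ?_ hnR hγ0 (by linarith) t
      rw [EuclideanSpace.real_norm_sq_eq]
      calc ∑ i, (D.v j i) ^ 2 ≤ ∑ i : Fin n, (1 : ℝ) := by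
            refine Finset.sum_le_sum fun i _ => ?_
            rw [← sq_abs]
            have := hv j i
            nlinarith [abs_nonneg (D.v j i)]
        _ = n := by simp
    calc drawLaw JD ≤ ∑ t ∈ Finset.range T, ∑ j : Fin m,
          ENNReal.ofReal (2 * Real.exp (-(c ^ 2 / (2 * (D.γ ^ 2 * n))))) := by
          refine (measure_biUnion_finset_le _ _).trans (Finset.sum_le_sum fun t _ => ?_)
          exact (measure_iUnion_fintype_le _ _).trans (Finset.sum_le_sum fun i _ => h1 t i)
      _ = _ := by
          rw [show 2 * T * m * Real.exp (-(c ^ 2 / (2 * (D.γ ^ 2 * n)))) =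
            T * (m * (2 * Real.exp (-(c ^ 2 / (2 * (D.γ ^ 2 * n)))))) by ring,
            ENNReal.ofReal_mul (by positivity), ENNReal.ofReal_mul (by positivity)]
          simp
  calc drawLaw {ω | ¬ D.Accepts T ω} ≤ drawLaw ((JV ∪ JD) ∪ (H ∪ N)) := measure_mono hsub
    _ ≤ (drawLaw JV + drawLaw JD) + (drawLaw H + drawLaw N) :=
        (measure_union_le _ _).trans (add_le_add (measure_union_le _ _) (measure_union_le _ _))
    _ ≤ (ENNReal.ofReal (2 * T * n * Real.exp (-(D.δ ^ 2 / (2 * D.γ ^ 2)))) +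
        ENNReal.ofReal (2 * T * m * Real.exp (-(c ^ 2 / (2 * (D.γ ^ 2 * n)))))) +
        (ENNReal.ofReal (1 / 16) + ENNReal.ofReal (1 / 4)) :=
        add_le_add (add_le_add hPJV hPJD) (add_le_add hPH hPN)
    _ ≤ ENNReal.ofReal (1 / 2) := by
        rw [← ENNReal.ofReal_add (by positivity) (by positivity),
          ← ENNReal.ofReal_add (by norm_num) (by norm_num),
          ← ENNReal.ofReal_add (by positivity) (by norm_num)]
        exact ENNReal.ofReal_le_ofReal (by linarith)

end EdgeWalkData

/-! ### Randomized rounding by fair coins -/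

namespace RealRAM

/-- Reflection symmetry together with the absence of an atom at zero. -/
theorem gaussianReal_nonneg : gaussianReal 0 1 {g : ℝ | 0 ≤ g} = 1 / 2 := by
  have hneg : gaussianReal 0 1 {g : ℝ | g ≤ 0} = gaussianReal 0 1 {g : ℝ | 0 ≤ g} := by
    have h := gaussianReal_map_const_mul (μ := 0) (v := 1) (-1)
    have h1 : gaussianReal (-1 * 0) (.mk ((-1) ^ 2) (sq_nonneg _) * 1) = gaussianReal 0 1 := by
      congr 1
      · simp
      · ext; simp
    rw [h1] at h
    have hm : MeasurableSet {g : ℝ | g ≤ 0} := measurableSet_Iic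
    conv_lhs => rw [← h]
    rw [Measure.map_apply (by fun_prop) hm]
    congr 1
    ext g
    simp
  have hlt : gaussianReal 0 1 {g : ℝ | g < 0} = gaussianReal 0 1 {g : ℝ | g ≤ 0} := by
    have := nullSingletonClass_gaussianReal (μ := 0) (v := 1) one_ne_zero
    exact measure_congr Iio_ae_eq_Iic
  have hsum : gaussianReal 0 1 {g : ℝ | 0 ≤ g} + gaussianReal 0 1 {g : ℝ | g < 0} = 1 := by
    rw [← measure_univ (μ := gaussianReal 0 1), ← measure_add_measure_compl measurableSet_Ici]
    congr 2
    ext g; simp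
  rw [hlt, hneg, ← two_mul] at hsum
  rw [ENNReal.eq_div_iff (by norm_num) (by norm_num), hsum]

theorem gaussianReal_neg_half : gaussianReal 0 1 {g : ℝ | 0 ≤ g}ᶜ = 1 / 2 := by
  have hm : MeasurableSet {g : ℝ | 0 ≤ g} := measurableSet_Ici
  rw [measure_compl hm (by simp), measure_univ, gaussianReal_nonneg]
  norm_num

/-- The sign of a standard Gaussian is a fair coin. -/
theorem integral_coin (a b : ℝ) :
    ∫ g, (if 0 ≤ g then a else b) ∂(gaussianReal 0 1) = (a + b) / 2 := by
  have h : (fun g : ℝ => if 0 ≤ g then a else b) = fun g =>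
      Set.indicator {g : ℝ | 0 ≤ g} (fun _ => a) g + Set.indicator {g : ℝ | 0 ≤ g}ᶜ (fun _ => b) g := by
    funext g
    by_cases hg : 0 ≤ g <;> simp [hg]
  have hm : MeasurableSet {g : ℝ | 0 ≤ g} := measurableSet_Ici
  rw [h, integral_add ((integrable_const a).indicator hm) ((integrable_const b).indicator hm.compl),
    integral_indicator_const _ hm, integral_indicator_const _ hm.compl, measureReal_def,
    measureReal_def, gaussianReal_neg_half, gaussianReal_nonneg]
  simp
  ring

/-- One fair step of a coordinate: it moves by its distance to the boundary of `[-1, 1]`. -/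
noncomputable def coinStep (x g : ℝ) : ℝ := if 0 ≤ g then x + (1 - |x|) else x - (1 - |x|)

theorem abs_coinStep_le {x : ℝ} (hx : |x| ≤ 1) (g : ℝ) : |coinStep x g| ≤ 1 := by
  unfold coinStep
  rcases abs_cases x with ⟨h, h'⟩ | ⟨h, h'⟩ <;> rw [h] at hx ⊢ <;> split_ifs <;>
    rw [abs_le] <;> constructor <;> linarith

theorem coinStep_of_abs_eq_one {x : ℝ} (hx : |x| = 1) (g : ℝ) : coinStep x g = x := by
  simp [coinStep, hx]

theorem measurable_coinStep : Measurable (Function.uncurry coinStep) := by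
  unfold coinStep
  refine Measurable.ite (measurableSet_le measurable_const measurable_snd) ?_ ?_ <;> fun_prop

/-- The supermartingale property in one coordinate. A fair step of size `d` lowers `1 - x²` by `d²`
on average, and this gain of `θ² d²` in the exponent pays for the factor `cosh y ≤ exp (y² / 2)`
coming from the fluctuation `y`. -/
theorem integral_exp_coinStep_le {x a θ : ℝ} (hx : |x| ≤ 1) (ha : |a| ≤ 1) (hθ : |θ| ≤ 1 / 8) :
    ∫ g, Real.exp (θ * (coinStep x g * a) + θ ^ 2 * (1 - coinStep x g ^ 2)) ∂(gaussianReal 0 1) ≤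
      Real.exp (θ * (x * a) + θ ^ 2 * (1 - x ^ 2)) := by
  set d := 1 - |x| with hd
  have h1 : ∀ g, Real.exp (θ * (coinStep x g * a) + θ ^ 2 * (1 - coinStep x g ^ 2)) =
      if 0 ≤ g then Real.exp (θ * ((x + d) * a) + θ ^ 2 * (1 - (x + d) ^ 2))
        else Real.exp (θ * ((x - d) * a) + θ ^ 2 * (1 - (x - d) ^ 2)) := by
    intro g
    unfold coinStep
    split_ifs <;> rfl
  simp_rw [h1]
  rw [integral_coin]
  set E := θ * (x * a) + θ ^ 2 * (1 - x ^ 2) with hE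
  set y := θ * d * (a - 2 * θ * x) with hy
  have h2 : θ * ((x + d) * a) + θ ^ 2 * (1 - (x + d) ^ 2) = (E - θ ^ 2 * d ^ 2) + y := by
    rw [hE, hy]; ring
  have h3 : θ * ((x - d) * a) + θ ^ 2 * (1 - (x - d) ^ 2) = (E - θ ^ 2 * d ^ 2) + -y := by
    rw [hE, hy]; ring
  rw [h2, h3, Real.exp_add, Real.exp_add, ← mul_add, mul_div_assoc, ← Real.cosh_eq]
  calc Real.exp (E - θ ^ 2 * d ^ 2) * Real.cosh y
      ≤ Real.exp (E - θ ^ 2 * d ^ 2) * Real.exp (y ^ 2 / 2) := by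
        gcongr
        exact Real.cosh_le_exp_half_sq y
    _ ≤ Real.exp E := by
        rw [← Real.exp_add, Real.exp_le_exp]
        -- Here `|θ| ≤ 1/8` enters: `(5/4)² ≤ 2` makes `y² / 2` at most the gain `θ² d²`.
        have hz : |a - 2 * θ * x| ≤ 5 / 4 := by
          calc |a - 2 * θ * x| ≤ |a| + |2 * θ * x| := abs_sub _ _
            _ ≤ 1 + 2 * (1 / 8) * 1 := by
                rw [abs_mul, abs_mul, abs_two]
                gcongr
            _ = _ := by norm_num
        have hz2 : (a - 2 * θ * x) ^ 2 ≤ 2 := by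
          rw [← sq_abs]
          nlinarith [abs_nonneg (a - 2 * θ * x)]
        have : y ^ 2 = θ ^ 2 * d ^ 2 * (a - 2 * θ * x) ^ 2 := by rw [hy]; ring
        nlinarith [mul_nonneg (sq_nonneg θ) (sq_nonneg d)]

/-- The step away from zero lands exactly on `±1`, so one of the two coin values always finishes the
coordinate. -/
theorem gaussianReal_coinStep_unfinished {x : ℝ} :
    gaussianReal 0 1 {g | |coinStep x g| ≠ 1} ≤ if |x| ≠ 1 then 1 / 2 else 0 := by
  split_ifs with h
  · rcases le_total 0 x with h0 | h0
    · calc _ ≤ gaussianReal 0 1 {g : ℝ | 0 ≤ g}ᶜ := by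
            refine measure_mono fun g hg => ?_
            simp only [Set.mem_compl_iff, Set.mem_ofPred_eq] at hg ⊢
            intro hg0
            apply hg
            simp [coinStep, hg0, abs_of_nonneg h0]
        _ ≤ _ := gaussianReal_neg_half.le
    · calc _ ≤ gaussianReal 0 1 {g : ℝ | 0 ≤ g} := by
            refine measure_mono fun g hg => ?_
            simp only [Set.mem_ofPred_eq] at hg ⊢
            by_contra hg0
            apply hg
            simp [coinStep, hg0, abs_of_nonpos h0]
        _ ≤ _ := gaussianReal_nonneg.le
  · rw [not_not] at h
    simp [coinStep_of_abs_eq_one h, h]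

variable {n : ℕ}

/-- A fair step of every coordinate. -/
noncomputable def sweep (x : EuclideanSpace ℝ (Fin n)) (ω : ℕ → ℝ) : EuclideanSpace ℝ (Fin n) :=
  WithLp.toLp 2 fun i => coinStep (x i) (ω i)

@[simp] theorem sweep_apply (x : EuclideanSpace ℝ (Fin n)) (ω : ℕ → ℝ) (i : Fin n) :
    sweep x ω i = coinStep (x i) (ω i) := rfl

/-- `b` rounds of fair steps. -/
noncomputable def sweeps (x : EuclideanSpace ℝ (Fin n)) (ω : ℕ → ℝ) : ℕ → EuclideanSpace ℝ (Fin n)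
  | 0 => x
  | b + 1 => sweep (sweeps x ω b) (shift (b * n) ω)

theorem measurable_sweep :
    Measurable (Function.uncurry (sweep : EuclideanSpace ℝ (Fin n) → _ → _)) := by
  have h : Measurable fun p : EuclideanSpace ℝ (Fin n) × (ℕ → ℝ) =>
      fun i : Fin n => coinStep (p.1 i) (p.2 i) := by
    refine measurable_pi_iff.2 fun i => ?_
    exact measurable_coinStep.comp (f := fun p : EuclideanSpace ℝ (Fin n) × (ℕ → ℝ) =>
      (p.1 i, p.2 i)) (by fun_prop)
  exact (WithLp.measurable_toLp 2 _).comp h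

theorem measurable_sweeps (b : ℕ) : Measurable fun p : EuclideanSpace ℝ (Fin n) × (ℕ → ℝ) =>
    sweeps p.1 p.2 b := by
  induction b with
  | zero => exact measurable_fst
  | succ b ih =>
    exact measurable_sweep.comp (ih.prodMk ((measurable_shift _).comp measurable_snd))

theorem measurable_sweeps_right (x : EuclideanSpace ℝ (Fin n)) (b : ℕ) :
    Measurable fun ω => sweeps x ω b := (measurable_sweeps b).comp measurable_prodMk_left

theorem usesDraws_sweeps (x : EuclideanSpace ℝ (Fin n)) (b : ℕ) :
    UsesDraws (b * n) fun ω => sweeps x ω b := by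
  induction b with
  | zero => intro ω ω' _; rfl
  | succ b ih =>
    intro ω ω' h
    have h1 : sweeps x ω b = sweeps x ω' b :=
      ih ω ω' fun i hi => h i (hi.trans_le (Nat.mul_le_mul_right n (Nat.le_succ b)))
    ext i
    simp only [sweeps, sweep_apply, h1, shift]
    rw [h (b * n + i) (by rw [Nat.succ_mul]; omega)]

theorem abs_sweeps_le {x : EuclideanSpace ℝ (Fin n)} (hx : ∀ i, |x i| ≤ 1) (ω : ℕ → ℝ) (b : ℕ)
    (i : Fin n) : |sweeps x ω b i| ≤ 1 := by
  induction b with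
  | zero => exact hx i
  | succ b ih => exact abs_coinStep_le ih _

theorem lintegral_sweeps_succ (x : EuclideanSpace ℝ (Fin n)) (b : ℕ)
    {Φ : EuclideanSpace ℝ (Fin n) → ENNReal} (hΦ : Measurable Φ) :
    ∫⁻ ω, Φ (sweeps x ω (b + 1)) ∂drawLaw =
      ∫⁻ ω, ∫⁻ ω', Φ (sweep (sweeps x ω b) ω') ∂drawLaw ∂drawLaw :=
  lintegral_fresh (Φ := fun y ω' => Φ (sweep y ω')) (measurable_sweeps_right x b)
    (usesDraws_sweeps x b) (hΦ.comp measurable_sweep)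

/-- The exponential potential of the rounding. -/
noncomputable def roundPot (θ : ℝ) (w x : EuclideanSpace ℝ (Fin n)) : ℝ :=
  Real.exp (θ * inner ℝ x w + θ ^ 2 * ∑ i, (1 - x i ^ 2))

/-- The potential factorises over coordinates. The independent coins of a sweep can thus be averaged
one at a time. -/
theorem roundPot_eq_prod (θ : ℝ) (w x : EuclideanSpace ℝ (Fin n)) :
    roundPot θ w x = ∏ i, Real.exp (θ * (x i * w i) + θ ^ 2 * (1 - x i ^ 2)) := by
  rw [roundPot, ← Real.exp_sum, Finset.sum_add_distrib, ← Finset.mul_sum, ← Finset.mul_sum,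
    PiLp.inner_apply]
  simp [mul_comm]

theorem measurable_roundPot (θ : ℝ) (w : EuclideanSpace ℝ (Fin n)) :
    Measurable (roundPot θ w) := by
  unfold roundPot
  fun_prop

theorem map_restrict_draws (n : ℕ) :
    drawLaw.map (fun ω (i : Fin n) => ω i) = Measure.pi fun _ : Fin n => gaussianReal 0 1 := by
  rw [← Measure.infinitePi_eq_pi]
  exact Measure.map_infinitePi_infinitePi_of_inj (P := fun _ : ℕ => gaussianReal 0 1)
      (f := fun i : Fin n => (i : ℕ)) Fin.val_injective

theorem map_eval_draws (i : ℕ) : drawLaw.map (fun ω => ω i) = gaussianReal 0 1 :=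
  Measure.infinitePi_map_eval _ i

theorem lintegral_roundPot_sweep_le {θ : ℝ} {w x : EuclideanSpace ℝ (Fin n)}
    (hx : ∀ i, |x i| ≤ 1) (hw : ∀ i, |w i| ≤ 1) (hθ : |θ| ≤ 1 / 8) :
    ∫⁻ ω, ENNReal.ofReal (roundPot θ w (sweep x ω)) ∂drawLaw ≤
      ENNReal.ofReal (roundPot θ w x) := by
  have hms : Measurable fun ω : ℕ → ℝ => sweep x ω := measurable_sweep.comp measurable_prodMk_left
  have hb : ∀ ω, ‖roundPot θ w (sweep x ω)‖ ≤ Real.exp (∑ i : Fin n, (1 / 8 + 1)) := by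
    intro ω
    rw [Real.norm_eq_abs, abs_of_pos (show 0 < roundPot θ w (sweep x ω) from Real.exp_pos _),
      roundPot_eq_prod, Real.exp_sum]
    refine Finset.prod_le_prod (fun i _ => (Real.exp_pos _).le) fun i _ => Real.exp_le_exp.2 ?_
    have h1 := abs_coinStep_le (hx i) (ω i)
    simp only [sweep_apply]
    have h2 : θ * (coinStep (x i) (ω i) * w i) ≤ 1 / 8 := by
      refine (le_abs_self _).trans ?_
      rw [abs_mul, abs_mul]
      calc |θ| * (|coinStep (x i) (ω i)| * |w i|) ≤ 1 / 8 * (1 * 1) := by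
            gcongr
            exact hw i
        _ = 1 / 8 := by norm_num
    have h3 : θ ^ 2 ≤ 1 := by rw [← sq_abs]; nlinarith [abs_nonneg θ]
    nlinarith [sq_nonneg (coinStep (x i) (ω i)), sq_nonneg θ]
  have hint : Integrable (fun ω => roundPot θ w (sweep x ω)) drawLaw :=
    Integrable.of_bound ((measurable_roundPot θ w).comp hms).aestronglyMeasurable _
      (Filter.Eventually.of_forall hb)
  rw [← ofReal_integral_eq_lintegral_ofReal hint
    (Filter.Eventually.of_forall fun _ => (Real.exp_pos _).le)]
  refine ENNReal.ofReal_le_ofReal ?_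
  simp_rw [roundPot_eq_prod, sweep_apply]
  have hcm : ∀ i, Measurable fun g => coinStep (x i) g := fun i =>
    measurable_coinStep.comp measurable_prodMk_left
  have h1 := integral_map (μ := drawLaw) (φ := fun ω (i : Fin n) => ω i)
    (f := fun y : Fin n → ℝ => ∏ i, Real.exp (θ * (coinStep (x i) (y i) * w i) +
      θ ^ 2 * (1 - coinStep (x i) (y i) ^ 2)))
    (measurable_pi_iff.2 fun i => measurable_pi_apply _).aemeasurable
    (by
      refine Measurable.aestronglyMeasurable ?_
      refine Finset.measurable_prod _ fun i _ => ?_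
      have := (hcm i).comp (measurable_pi_apply i : Measurable fun y : Fin n → ℝ => y i)
      simp only [Function.comp_def] at this
      fun_prop)
  rw [← h1, map_restrict_draws, integral_fintype_prod_eq_prod
    (f := fun i g => Real.exp (θ * (coinStep (x i) g * w i) + θ ^ 2 * (1 - coinStep (x i) g ^ 2)))]
  exact Finset.prod_le_prod (fun i _ => integral_nonneg fun g => (Real.exp_pos _).le)
    fun i _ => integral_exp_coinStep_le (hx i) (hw i) hθ

theorem lintegral_roundPot_sweeps_le {θ : ℝ} {w x : EuclideanSpace ℝ (Fin n)}
    (hx : ∀ i, |x i| ≤ 1) (hw : ∀ i, |w i| ≤ 1) (hθ : |θ| ≤ 1 / 8) (b : ℕ) :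
    ∫⁻ ω, ENNReal.ofReal (roundPot θ w (sweeps x ω b)) ∂drawLaw ≤
      ENNReal.ofReal (roundPot θ w x) := by
  induction b with
  | zero => simp [sweeps]
  | succ b ih =>
    rw [lintegral_sweeps_succ x b (measurable_roundPot θ w).ennreal_ofReal]
    refine le_trans (lintegral_mono fun ω => ?_) ih
    exact lintegral_roundPot_sweep_le (fun i => abs_sweeps_le hx ω b i) hw hθ

/-- Conditionally on earlier sweeps, an unfinished coordinate survives a fresh coin with probability
at most one half, and a finished one no longer moves. -/
theorem measure_sweeps_unfinished_le (x : EuclideanSpace ℝ (Fin n)) (b : ℕ) (i : Fin n) :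
    drawLaw {ω | |sweeps x ω b i| ≠ 1} ≤ (1 / 2) ^ b := by
  induction b with
  | zero => simpa using prob_le_one
  | succ b ih =>
    have hS : MeasurableSet {y : EuclideanSpace ℝ (Fin n) | |y i| ≠ 1} :=
      (measurableSet_eq_fun (by fun_prop) measurable_const).compl
    have h1 := lintegral_sweeps_succ x b (measurable_one.indicator hS)
    have h2 : ∀ b, MeasurableSet {ω | |sweeps x ω b i| ≠ 1} := fun b =>
      measurable_sweeps_right x b hS
    rw [← lintegral_indicator_one (h2 _)]
    calc _ = _ := h1
      _ ≤ ∫⁻ ω, (1 / 2) * Set.indicator {ω | |sweeps x ω b i| ≠ 1} 1 ω ∂drawLaw := by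
        refine lintegral_mono fun ω => ?_
        have hm : Measurable fun g => coinStep (sweeps x ω b i) g :=
          measurable_coinStep.comp measurable_prodMk_left
        have hS' : MeasurableSet {g | |coinStep (sweeps x ω b i) g| ≠ 1} :=
          (measurableSet_eq_fun (by fun_prop) measurable_const).compl
        calc ∫⁻ ω', Set.indicator {y : EuclideanSpace ℝ (Fin n) | |y i| ≠ 1} 1
              (sweep (sweeps x ω b) ω') ∂drawLaw
            = ∫⁻ ω', Set.indicator {g | |coinStep (sweeps x ω b i) g| ≠ 1} 1 (ω' (i : ℕ))
                ∂drawLaw := rfl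
          _ = gaussianReal 0 1 {g | |coinStep (sweeps x ω b i) g| ≠ 1} := by
              rw [← lintegral_indicator_one hS', ← map_eval_draws (i : ℕ),
                lintegral_map (measurable_one.indicator hS') (measurable_pi_apply _)]
          _ ≤ _ := gaussianReal_coinStep_unfinished
          _ = _ := by
              by_cases h : |sweeps x ω b i| = 1 <;> simp [h]
      _ = (1 / 2) * drawLaw {ω | |sweeps x ω b i| ≠ 1} := by
        rw [lintegral_const_mul _ (measurable_one.indicator (h2 b)),
          lintegral_indicator_one (h2 b)]
      _ ≤ (1 / 2) * (1 / 2) ^ b := mul_le_mul_right ih _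
      _ = _ := by rw [pow_succ, mul_comm]

/-- Rounding changes a linear form with coefficients in `[-1, 1]` little. -/
theorem measure_sweeps_deviation_le {w x : EuclideanSpace ℝ (Fin n)} (hx : ∀ i, |x i| ≤ 1)
    (hw : ∀ i, |w i| ≤ 1) {θ : ℝ} (hθ0 : 0 ≤ θ) (hθ : θ ≤ 1 / 8) (u : ℝ) (b : ℕ) :
    drawLaw {ω | u < |inner ℝ (sweeps x ω b - x) w|} ≤
      ENNReal.ofReal (2 * Real.exp (-(θ * u) + θ ^ 2 * ∑ i, (1 - x i ^ 2))) := by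
  have hms := measurable_sweeps_right x b
  have key : ∀ η : ℝ, |η| ≤ 1 / 8 → η ^ 2 = θ ^ 2 →
      drawLaw {ω | θ * u ≤ η * inner ℝ (sweeps x ω b - x) w} ≤
      ENNReal.ofReal (Real.exp (-(θ * u) + θ ^ 2 * ∑ i, (1 - x i ^ 2))) := by
    intro η hη hηθ
    have h1 := mul_meas_ge_le_lintegral (μ := drawLaw)
      (f := fun ω => ENNReal.ofReal (roundPot η w (sweeps x ω b)))
      ((measurable_roundPot η w).comp hms).ennreal_ofReal
      (ENNReal.ofReal (Real.exp (θ * u + η * inner ℝ x w)))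
    have h2 : {ω | θ * u ≤ η * inner ℝ (sweeps x ω b - x) w} ⊆
        {ω | ENNReal.ofReal (Real.exp (θ * u + η * inner ℝ x w)) ≤
        ENNReal.ofReal (roundPot η w (sweeps x ω b))} := by
      intro ω hω
      simp only [Set.mem_ofPred_eq, inner_sub_left] at hω ⊢
      refine ENNReal.ofReal_le_ofReal (Real.exp_le_exp.2 ?_)
      -- At the end the quadratic part of the potential is dropped: it is nonnegative inside the
      -- cube. Its initial value is the variance term of the bound.
      have : 0 ≤ η ^ 2 * ∑ i, (1 - (sweeps x ω b i) ^ 2) := by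
        refine mul_nonneg (sq_nonneg _) (Finset.sum_nonneg fun i _ => ?_)
        have := abs_sweeps_le hx ω b i
        rw [← sq_abs]
        nlinarith [abs_nonneg (sweeps x ω b i)]
      linarith
    have h3 : ENNReal.ofReal (Real.exp (θ * u + η * inner ℝ x w)) *
        drawLaw {ω | θ * u ≤ η * inner ℝ (sweeps x ω b - x) w} ≤
        ENNReal.ofReal (roundPot η w x) :=
      ((mul_le_mul_right (measure_mono h2) _).trans h1).trans
        (lintegral_roundPot_sweeps_le hx hw hη b)
    have h4 : ENNReal.ofReal (Real.exp (-(θ * u) + θ ^ 2 * ∑ i, (1 - x i ^ 2))) =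
        ENNReal.ofReal (Real.exp (-(θ * u + η * inner ℝ x w))) *
          ENNReal.ofReal (roundPot η w x) := by
      rw [← ENNReal.ofReal_mul (Real.exp_pos _).le, roundPot, ← Real.exp_add, hηθ]
      congr 2
      ring
    have h5 : ENNReal.ofReal (Real.exp (-(θ * u + η * inner ℝ x w))) *
        ENNReal.ofReal (Real.exp (θ * u + η * inner ℝ x w)) = 1 := by
      rw [← ENNReal.ofReal_mul (Real.exp_pos _).le, ← Real.exp_add]
      simp
    calc drawLaw {ω | θ * u ≤ η * inner ℝ (sweeps x ω b - x) w}
        = ENNReal.ofReal (Real.exp (-(θ * u + η * inner ℝ x w))) *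
          (ENNReal.ofReal (Real.exp (θ * u + η * inner ℝ x w)) *
            drawLaw {ω | θ * u ≤ η * inner ℝ (sweeps x ω b - x) w}) := by
          rw [← mul_assoc, h5, one_mul]
      _ ≤ _ := by rw [h4]; exact mul_le_mul_right h3 _
  have hsub : {ω | u < |inner ℝ (sweeps x ω b - x) w|} ⊆
      {ω | θ * u ≤ θ * inner ℝ (sweeps x ω b - x) w} ∪
      {ω | θ * u ≤ (-θ) * inner ℝ (sweeps x ω b - x) w} := by
    intro ω hω
    have hω' : u ≤ |inner ℝ (sweeps x ω b - x) w| := le_of_lt hω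
    have h1 := mul_le_mul_of_nonneg_left hω' hθ0
    rcases le_total 0 (inner ℝ (sweeps x ω b - x) w) with h0 | h0
    · left
      rwa [abs_of_nonneg h0] at h1
    · right
      rw [abs_of_nonpos h0] at h1
      simp only [Set.mem_ofPred_eq]
      linarith
  calc _ ≤ _ := measure_mono hsub
    _ ≤ _ := measure_union_le _ _
    _ ≤ _ := add_le_add (key θ (by rwa [abs_of_nonneg hθ0]) rfl)
        (key (-θ) (by rwa [abs_neg, abs_of_nonneg hθ0]) (by ring))
    _ = _ := by rw [← ENNReal.ofReal_add (Real.exp_pos _).le (Real.exp_pos _).le, ← two_mul]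

/-- The outcome of the rounding is a colouring close to `x`. -/
def RoundsWell {m : ℕ} (v : Fin m → EuclideanSpace ℝ (Fin n)) (b : ℕ) (u : ℝ)
    (x : EuclideanSpace ℝ (Fin n)) (ω : ℕ → ℝ) : Prop :=
  (∀ i, |sweeps x ω b i| = 1) ∧ ∀ j, |inner ℝ (sweeps x ω b - x) (v j)| ≤ u

theorem measure_not_roundsWell_le {m : ℕ} {v : Fin m → EuclideanSpace ℝ (Fin n)}
    {x : EuclideanSpace ℝ (Fin n)} (hx : ∀ i, |x i| ≤ 1) (hv : ∀ j i, |v j i| ≤ 1) {θ : ℝ}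
    (hθ0 : 0 ≤ θ) (hθ : θ ≤ 1 / 8) (u : ℝ) (b : ℕ) :
    drawLaw {ω | ¬ RoundsWell v b u x ω} ≤ ENNReal.ofReal (n * (1 / 2) ^ b +
      2 * m * Real.exp (-(θ * u) + θ ^ 2 * ∑ i, (1 - x i ^ 2))) := by
  have hsub : {ω | ¬ RoundsWell v b u x ω} ⊆ (⋃ i : Fin n, {ω | |sweeps x ω b i| ≠ 1}) ∪
      ⋃ j : Fin m, {ω | u < |inner ℝ (sweeps x ω b - x) (v j)|} := by
    intro ω hω
    by_contra hcon
    apply hω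
    simp only [Set.mem_union, not_or, Set.mem_iUnion, not_exists, Set.mem_ofPred_eq, not_not,
      not_lt, ne_eq] at hcon
    exact hcon
  refine (measure_mono hsub).trans ((measure_union_le _ _).trans ?_)
  rw [ENNReal.ofReal_add (by positivity) (by positivity)]
  refine add_le_add ?_ ?_
  · refine (measure_iUnion_fintype_le _ _).trans ?_
    calc _ ≤ ∑ i : Fin n, ENNReal.ofReal ((1 / 2) ^ b) := by
          refine Finset.sum_le_sum fun i _ => (measure_sweeps_unfinished_le x b i).trans ?_
          rw [ENNReal.ofReal_pow (by norm_num), ENNReal.ofReal_div_of_pos (by norm_num)]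
          simp
      _ = _ := by rw [ENNReal.ofReal_mul (by positivity)]; simp
  · refine (measure_iUnion_fintype_le _ _).trans ?_
    calc _ ≤ ∑ j : Fin m, ENNReal.ofReal
          (2 * Real.exp (-(θ * u) + θ ^ 2 * ∑ i, (1 - x i ^ 2))) :=
          Finset.sum_le_sum fun j _ => measure_sweeps_deviation_le hx (hv j) hθ0 hθ u b
      _ = _ := by
          rw [mul_comm (2 : ℝ) (m : ℝ), mul_assoc, ENNReal.ofReal_mul (by positivity) (p := (m : ℝ))]
          simp

end RealRAM

/-! ### Iterating the walk -/

namespace EdgeWalkData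

open RealRAM

variable {n m : ℕ} (D : EdgeWalkData n m)

/-- The number of coordinates that are not nearly frozen at `x`. -/
noncomputable def active (x : EuclideanSpace ℝ (Fin n)) : ℕ := (D.nearVar x)ᶜ.card

/-- The walk from `x`, with thresholds depending on the number of active coordinates. -/
noncomputable def restart (f : ℕ → ℝ) (x : EuclideanSpace ℝ (Fin n)) : EdgeWalkData n m :=
  { D with c := fun _ => f (D.active x), x₀ := x }

open Classical in
/-- Move to the end of the walk from `x` if it is usable. -/
noncomputable def attempt (f : ℕ → ℝ) (T : ℕ) (x : EuclideanSpace ℝ (Fin n)) (ω : ℕ → ℝ) :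
    EuclideanSpace ℝ (Fin n) :=
  if (D.restart f x).Accepts T ω then (D.restart f x).path ω T else x

/-- Repeated attempts with fresh draws. -/
noncomputable def attempts (f : ℕ → ℝ) (T : ℕ) (x : EuclideanSpace ℝ (Fin n)) (ω : ℕ → ℝ) :
    ℕ → EuclideanSpace ℝ (Fin n)
  | 0 => x
  | r + 1 => D.attempt f T (attempts f T x ω r) (shift (r * (T * n)) ω)

variable (f : ℕ → ℝ) (T : ℕ)

theorem measurable_threshold : Measurable fun x => f (D.active x) :=
  D.measurable_comp_near (X := id) (F := fun I _ _ => f Iᶜ.card) measurable_id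
    fun _ _ => measurable_const

variable {α : Type*} [MeasurableSpace α] {X Y : α → EuclideanSpace ℝ (Fin n)}

theorem measurableSet_restart_nearDisc_eq (hX : Measurable X) (hY : Measurable Y)
    (J : Finset (Fin m)) : MeasurableSet {a | (D.restart f (X a)).nearDisc (Y a) = J} := by
  have : {a | (D.restart f (X a)).nearDisc (Y a) = J} =
      ⋂ j, {a | f (D.active (X a)) - D.δ ≤ |inner ℝ (Y a - X a) (D.v j)| ↔ j ∈ J} := by
    ext a; simp [nearDisc, restart, Finset.ext_iff]
  rw [this]
  refine MeasurableSet.iInter fun j => ?_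
  have hm : MeasurableSet {a | f (D.active (X a)) - D.δ ≤ |inner ℝ (Y a - X a) (D.v j)|} := by
    refine measurableSet_le (((D.measurable_threshold f).comp hX).sub_const _) ?_
    have : Measurable fun a => inner ℝ (Y a - X a) (D.v j) := (hY.sub hX).inner_const
    exact this.abs
  by_cases hj : j ∈ J
  · simpa [hj] using hm
  · simpa [hj, Set.compl_ofPred] using hm.compl

/-- Joint measurability in starting point and draws is needed because restarts begin at random
points. The thresholds vary with the point too, so the result for a fixed `EdgeWalkData` does not
apply; the argument again splits over the finitely many pairs of near sets. -/
theorem measurable_restart_path (t : ℕ) :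
    Measurable fun p : EuclideanSpace ℝ (Fin n) × (ℕ → ℝ) => (D.restart f p.1).path p.2 t := by
  induction t with
  | zero => exact measurable_fst
  | succ t ih =>
    set Y := fun p : EuclideanSpace ℝ (Fin n) × (ℕ → ℝ) => (D.restart f p.1).path p.2 t with hY
    have h : Measurable fun p : EuclideanSpace ℝ (Fin n) × (ℕ → ℝ) =>
        (D.orthTo (D.nearVar (Y p)) ((D.restart f p.1).nearDisc (Y p))).starProjection
          (vecOf n (shift (t * n) p.2)) := by
      intro S hS
      have : (fun p : EuclideanSpace ℝ (Fin n) × (ℕ → ℝ) =>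
        (D.orthTo (D.nearVar (Y p)) ((D.restart f p.1).nearDisc (Y p))).starProjection
          (vecOf n (shift (t * n) p.2))) ⁻¹' S = ⋃ I, ⋃ J,
          (Y ⁻¹' {x | D.nearVar x = I} ∩ {p | (D.restart f p.1).nearDisc (Y p) = J}) ∩
          (fun p : EuclideanSpace ℝ (Fin n) × (ℕ → ℝ) => (D.orthTo I J).starProjection
            (vecOf n (shift (t * n) p.2))) ⁻¹' S := by
        ext p
        simp only [Set.mem_preimage, Set.mem_iUnion, Set.mem_inter_iff, Set.mem_ofPred_eq]
        constructor
        · intro hh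
          exact ⟨_, _, ⟨rfl, rfl⟩, hh⟩
        · rintro ⟨I, J, ⟨rfl, rfl⟩, hh⟩
          exact hh
      rw [this]
      refine MeasurableSet.iUnion fun I => MeasurableSet.iUnion fun J =>
        ((ih (D.measurableSet_nearVar_eq I)).inter
          (D.measurableSet_restart_nearDisc_eq f measurable_fst ih J)).inter ?_
      have : Measurable fun p : EuclideanSpace ℝ (Fin n) × (ℕ → ℝ) =>
        (D.orthTo I J).starProjection (vecOf n (shift (t * n) p.2)) := by fun_prop
      exact this hS
    exact ih.add (h.const_smul D.γ)

theorem measurableSet_restart_accepts :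
    MeasurableSet {p : EuclideanSpace ℝ (Fin n) × (ℕ → ℝ) | (D.restart f p.1).Accepts T p.2} := by
  have hp := D.measurable_restart_path f
  have hcard : ∀ t, MeasurableSet {p : EuclideanSpace ℝ (Fin n) × (ℕ → ℝ) |
      ((D.restart f p.1).nearDisc ((D.restart f p.1).path p.2 t)).card < n} := by
    intro t
    have : {p : EuclideanSpace ℝ (Fin n) × (ℕ → ℝ) |
        ((D.restart f p.1).nearDisc ((D.restart f p.1).path p.2 t)).card < n} =
        ⋃ J : {J : Finset (Fin m) // J.card < n},
          {p | (D.restart f p.1).nearDisc ((D.restart f p.1).path p.2 t) = J} := by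
      ext p
      simp
    rw [this]
    exact MeasurableSet.iUnion fun J =>
      D.measurableSet_restart_nearDisc_eq f measurable_fst (hp t) J
  have hset : {p : EuclideanSpace ℝ (Fin n) × (ℕ → ℝ) | (D.restart f p.1).Accepts T p.2} =
      (⋂ t ∈ Finset.range T, {p : EuclideanSpace ℝ (Fin n) × (ℕ → ℝ) |
        ((D.restart f p.1).nearDisc ((D.restart f p.1).path p.2 t)).card < n}) ∩
      ((⋂ i, {p | |(D.restart f p.1).path p.2 T i| ≤ 1}) ∩
      ((⋂ j, {p | |inner ℝ ((D.restart f p.1).path p.2 T - p.1) (D.v j)| ≤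
        2 * f (D.active p.1)}) ∩
      {p | 2 * D.active ((D.restart f p.1).path p.2 T) ≤ D.active p.1})) := by
    ext p
    simp only [Accepts, Set.mem_inter_iff, Set.mem_iInter, Finset.mem_range, Set.mem_ofPred_eq]
    rfl
  rw [hset]
  refine (MeasurableSet.biInter (Set.to_countable _) fun t _ => hcard t).inter
    ((MeasurableSet.iInter fun i => ?_).inter ((MeasurableSet.iInter fun j => ?_).inter ?_))
  · have : Measurable fun p : EuclideanSpace ℝ (Fin n) × (ℕ → ℝ) =>
      (D.restart f p.1).path p.2 T i :=
      Measurable.comp (g := fun x : EuclideanSpace ℝ (Fin n) => x i) (by fun_prop) (hp T)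
    exact measurableSet_le this.abs measurable_const
  · have : Measurable fun p : EuclideanSpace ℝ (Fin n) × (ℕ → ℝ) =>
      inner ℝ ((D.restart f p.1).path p.2 T - p.1) (D.v j) :=
      ((hp T).sub measurable_fst).inner_const
    exact measurableSet_le this.abs (((D.measurable_threshold f).comp measurable_fst).const_mul 2)
  · have h1 : ∀ {X : EuclideanSpace ℝ (Fin n) × (ℕ → ℝ) → EuclideanSpace ℝ (Fin n)},
        Measurable X → Measurable fun p => (D.active (X p) : ℝ) := fun hX =>
      (D.measurable_threshold fun a => (a : ℝ)).comp hX
    have h2 := measurableSet_le ((h1 (hp T)).const_mul 2) (h1 measurable_fst)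
    convert h2 using 1
    ext p
    simp only [Set.mem_ofPred_eq]
    exact_mod_cast Iff.rfl

theorem measurable_attempt : Measurable (Function.uncurry (D.attempt f T)) := by
  classical
  exact Measurable.ite (D.measurableSet_restart_accepts f T) (D.measurable_restart_path f T)
    measurable_fst

theorem measurable_attempts (x : EuclideanSpace ℝ (Fin n)) (r : ℕ) :
    Measurable fun ω => D.attempts f T x ω r := by
  induction r with
  | zero => exact measurable_const
  | succ r ih =>
    have h := (D.measurable_attempt f T).comp (ih.prodMk (measurable_shift (r * (T * n))))
    exact h

theorem usesDraws_accepts : UsesDraws (T * n) fun ω => D.Accepts T ω := by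
  intro ω ω' h
  have h1 : ∀ t ≤ T, D.path ω t = D.path ω' t := fun t ht =>
    D.usesDraws_path t ω ω' fun i hi => h i (hi.trans_le (Nat.mul_le_mul_right n ht))
  simp only [Accepts, h1 T le_rfl]
  congr 1
  exact propext (forall₂_congr fun t ht => by rw [h1 t (le_of_lt ht)])

theorem usesDraws_attempt (x : EuclideanSpace ℝ (Fin n)) :
    UsesDraws (T * n) (D.attempt f T x) := by
  classical
  intro ω ω' h
  have h1 := (D.restart f x).usesDraws_accepts T ω ω' h
  have h2 := (D.restart f x).usesDraws_path T ω ω' h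
  simp only at h1 h2
  simp only [attempt, h1, h2]

theorem usesDraws_attempts (x : EuclideanSpace ℝ (Fin n)) (r : ℕ) :
    UsesDraws (r * (T * n)) fun ω => D.attempts f T x ω r := by
  induction r with
  | zero => intro ω ω' _; rfl
  | succ r ih =>
    intro ω ω' h
    have h1 := ih ω ω' fun i hi => h i (hi.trans_le (Nat.mul_le_mul_right _ (Nat.le_succ r)))
    simp only at h1
    simp only [attempts, h1]
    exact D.usesDraws_attempt f T _ _ _ fun i hi => h _ (by rw [Nat.succ_mul]; omega)

variable {f T}

theorem active_le (x : EuclideanSpace ℝ (Fin n)) : D.active x ≤ n := by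
  simpa [active] using Finset.card_le_univ (D.nearVar x)ᶜ

theorem active_attempt_le (x : EuclideanSpace ℝ (Fin n)) (ω : ℕ → ℝ) :
    D.active (D.attempt f T x ω) ≤ D.active x := by
  unfold attempt
  split_ifs with h
  · have h4 : 2 * D.active ((D.restart f x).path ω T) ≤ D.active x := h.2.2.2
    omega
  · exact le_rfl

/-- The deterministic invariants of the attempts. -/
theorem attempts_invariant {g : ℕ → ℝ} {B : ℝ}
    (hg : ∀ a a', 2 * a' ≤ a → a ≤ n → g a' + 2 * f a ≤ g a)
    {x : EuclideanSpace ℝ (Fin n)} (hx : ∀ i, |x i| ≤ 1)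
    (hB : ∀ j, |inner ℝ x (D.v j)| ≤ B - g (D.active x)) (ω : ℕ → ℝ) (r : ℕ) :
    (∀ i, |D.attempts f T x ω r i| ≤ 1) ∧
      ∀ j, |inner ℝ (D.attempts f T x ω r) (D.v j)| ≤ B - g (D.active (D.attempts f T x ω r)) := by
  induction r with
  | zero => exact ⟨hx, hB⟩
  | succ r ih =>
    simp only [attempts]
    set y := D.attempts f T x ω r
    unfold attempt
    split_ifs with h
    · obtain ⟨-, h2, h3, h4⟩ := h
      refine ⟨h2, fun j => ?_⟩
      set z := (D.restart f y).path (shift (r * (T * n)) ω) T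
      have h3 : |inner ℝ (z - y) (D.v j)| ≤ 2 * f (D.active y) := h3 j
      -- The potential `g` prepays all future walks: an accepted walk spends at most `2 f` of it and
      -- halves the number of active coordinates.
      have h5 := hg (D.active y) (D.active z) h4 (D.active_le y)
      have h6 := ih.2 j
      have h7 : inner ℝ z (D.v j) = inner ℝ y (D.v j) + inner ℝ (z - y) (D.v j) := by
        rw [inner_sub_left]; ring
      rw [h7]
      refine (abs_add_le _ _).trans ?_
      linarith
    · exact ih

/-- The number of active coordinates, if it exceeds `s`. -/
noncomputable def excess (s : ℝ) (x : EuclideanSpace ℝ (Fin n)) : ENNReal :=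
  if s < D.active x then (D.active x : ENNReal) else 0

theorem measurable_excess (s : ℝ) : Measurable (D.excess s) :=
  D.measurable_comp_near (X := id)
    (F := fun I _ _ => if s < (Iᶜ.card : ℝ) then (Iᶜ.card : ENNReal) else 0) measurable_id
    fun _ _ => measurable_const

/-- Acceptance halves the active count and rejection keeps it, so the mean factor is at most `1/2 +
1/2 · 1/2 = 3/4`. Once the count is at most `s` the excess stays zero, which matters because
acceptance is only likely above `s`. -/
theorem lintegral_excess_attempt_le {s : ℝ} {x : EuclideanSpace ℝ (Fin n)}
    (hacc : s < D.active x → drawLaw {ω | ¬ (D.restart f x).Accepts T ω} ≤ ENNReal.ofReal (1 / 2)) :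
    ∫⁻ ω, D.excess s (D.attempt f T x ω) ∂drawLaw ≤ ENNReal.ofReal (3 / 4) * D.excess s x := by
  by_cases hs : s < D.active x
  · have hm : MeasurableSet {ω | ¬ (D.restart f x).Accepts T ω} :=
      (measurable_prodMk_left (D.measurableSet_restart_accepts f T)).compl
    have hpt : ∀ ω, D.excess s (D.attempt f T x ω) ≤
        (D.active x : ENNReal) * (ENNReal.ofReal (1 / 2) + ENNReal.ofReal (1 / 2) *
          Set.indicator {ω | ¬ (D.restart f x).Accepts T ω} 1 ω) := by
      intro ω
      by_cases h : (D.restart f x).Accepts T ω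
      · have h4 : 2 * D.active ((D.restart f x).path ω T) ≤ D.active x := h.2.2.2
        have h5 : D.excess s (D.attempt f T x ω) ≤ D.active ((D.restart f x).path ω T) := by
          rw [attempt, if_pos h, excess]
          split_ifs <;> simp
        refine h5.trans ?_
        simp only [Set.mem_ofPred_eq, h, not_true_eq_false, not_false_eq_true, mul_zero,
          add_zero, Set.indicator_of_notMem]
        rw [← ENNReal.ofReal_natCast, ← ENNReal.ofReal_natCast, ← ENNReal.ofReal_mul (by positivity)]
        refine ENNReal.ofReal_le_ofReal ?_
        have : (2 : ℝ) * D.active ((D.restart f x).path ω T) ≤ D.active x := by exact_mod_cast h4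
        linarith
      · rw [attempt, if_neg h, excess, if_pos hs]
        simp only [Set.mem_ofPred_eq, h, not_false_eq_true, Set.indicator_of_mem, Pi.one_apply,
          mul_one]
        rw [← ENNReal.ofReal_add (by norm_num) (by norm_num)]
        norm_num
    calc _ ≤ _ := lintegral_mono hpt
      _ = (D.active x : ENNReal) * (ENNReal.ofReal (1 / 2) + ENNReal.ofReal (1 / 2) *
          drawLaw {ω | ¬ (D.restart f x).Accepts T ω}) := by
        have hi : Measurable fun ω => ENNReal.ofReal (1 / 2) *
          Set.indicator {ω | ¬ (D.restart f x).Accepts T ω} 1 ω :=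
          (measurable_one.indicator hm).const_mul _
        have hi' : Measurable fun ω => ENNReal.ofReal (1 / 2) + ENNReal.ofReal (1 / 2) *
          Set.indicator {ω | ¬ (D.restart f x).Accepts T ω} 1 ω := measurable_const.add hi
        rw [lintegral_const_mul _ hi', lintegral_add_left measurable_const,
          lintegral_const_mul _ (measurable_one.indicator hm), lintegral_indicator_one hm]
        simp
      _ ≤ (D.active x : ENNReal) * (ENNReal.ofReal (1 / 2) + ENNReal.ofReal (1 / 2) *
          ENNReal.ofReal (1 / 2)) := by
        gcongr
        exact hacc hs
      _ = _ := by
        rw [excess, if_pos hs, ← ENNReal.ofReal_mul (by norm_num),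
          ← ENNReal.ofReal_add (by norm_num) (by norm_num), mul_comm]
        norm_num
  · have : ∀ ω, D.excess s (D.attempt f T x ω) = 0 := by
      intro ω
      rw [excess, if_neg]
      have : (D.active (D.attempt f T x ω) : ℝ) ≤ D.active x := by
        exact_mod_cast D.active_attempt_le x ω
      linarith
    simp [this]

/-- The expected excess decays geometrically, and where it is nonzero it is at least 1, so Markov's
inequality applies. The predicate `P` carries the invariants of the current point under which an
attempt is known to succeed. -/
theorem measure_active_attempts_le {s : ℝ} (hs : 1 ≤ s) {x : EuclideanSpace ℝ (Fin n)}
    {P : EuclideanSpace ℝ (Fin n) → Prop} (hP : ∀ ω r, P (D.attempts f T x ω r))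
    (hacc : ∀ y, P y → s < D.active y →
      drawLaw {ω | ¬ (D.restart f y).Accepts T ω} ≤ ENNReal.ofReal (1 / 2)) (r : ℕ) :
    drawLaw {ω | s < D.active (D.attempts f T x ω r)} ≤ ENNReal.ofReal ((3 / 4) ^ r * n) := by
  have hE : ∀ r, ∫⁻ ω, D.excess s (D.attempts f T x ω r) ∂drawLaw ≤
      ENNReal.ofReal ((3 / 4) ^ r * n) := by
    intro r
    induction r with
    | zero =>
      have : ∀ ω, D.excess s (D.attempts f T x ω 0) ≤ n := by
        intro ω
        unfold excess
        split_ifs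
        · exact_mod_cast D.active_le _
        · simp
      calc _ ≤ ∫⁻ _, (n : ENNReal) ∂drawLaw := lintegral_mono this
        _ = _ := by simp
    | succ r ih =>
      have h := lintegral_fresh (Φ := fun y ω' => D.excess s (D.attempt f T y ω'))
        (D.measurable_attempts f T x r) (D.usesDraws_attempts f T x r)
        ((D.measurable_excess s).comp (D.measurable_attempt f T))
      calc _ = _ := h
        _ ≤ ∫⁻ ω, ENNReal.ofReal (3 / 4) * D.excess s (D.attempts f T x ω r) ∂drawLaw :=
          lintegral_mono fun ω => D.lintegral_excess_attempt_le fun h => hacc _ (hP ω r) h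
        _ = ENNReal.ofReal (3 / 4) * ∫⁻ ω, D.excess s (D.attempts f T x ω r) ∂drawLaw :=
          lintegral_const_mul _ ((D.measurable_excess s).comp (D.measurable_attempts f T x r))
        _ ≤ ENNReal.ofReal (3 / 4) * ENNReal.ofReal ((3 / 4) ^ r * n) := by gcongr
        _ = _ := by
          rw [← ENNReal.ofReal_mul (by norm_num), pow_succ]
          congr 1
          ring
  refine le_trans ?_ (hE r)
  have h1 := mul_meas_ge_le_lintegral (μ := drawLaw)
    ((D.measurable_excess s).comp (D.measurable_attempts f T x r)) 1
  rw [one_mul] at h1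
  refine (measure_mono fun ω hω => ?_).trans h1
  simp only [Set.mem_ofPred_eq, Function.comp, excess] at hω ⊢
  rw [if_pos hω]
  have : (1 : ℝ) < D.active (D.attempts f T x ω r) := by linarith
  exact_mod_cast this.le

end EdgeWalkData

/-! ### Choice of the parameters -/

/-- Put `r = √(n / a)`. The tail exponent is at least `8 l r`, whereas the union bound costs a
factor of order `m / a ≤ r² 2^l`, and `32 r² 2^l ≤ exp (4 + 2 r + l) ≤ exp (8 l r)`. -/
theorem hits_bound {m n a δ : ℝ} {l : ℕ} (hm : 0 ≤ m) (ha : 1 ≤ a) (han : a ≤ n) (hl : 1 ≤ l)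
    (hmn : m ≤ n * 2 ^ l) (hδ : δ ≤ 1) :
    2 * m * Real.exp (-((128 * √(l * √(n * a)) - δ) ^ 2 / (512 * a))) ≤ a / 16 := by
  have ha0 : 0 < a := by linarith
  have hl1 : (1 : ℝ) ≤ l := by exact_mod_cast hl
  set r := √(n / a) with hr
  have hn0 : 0 ≤ n := by linarith
  have hr2 : r ^ 2 = n / a := Real.sq_sqrt (by positivity)
  have hr1 : 1 ≤ r := by
    rw [hr, Real.one_le_sqrt, le_div_iff₀ ha0]; linarith
  have hna : n = a * r ^ 2 := by rw [hr2]; field_simp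
  have hsq : √(n * a) = a * r := by
    rw [hna, show a * r ^ 2 * a = (a * r) ^ 2 by ring, Real.sqrt_sq (by positivity)]
  set c := 128 * √(l * √(n * a)) with hc
  have hc2 : c ^ 2 = 16384 * (l * (a * r)) := by
    rw [hc, mul_pow, Real.sq_sqrt (by positivity), hsq]; norm_num
  have hc1 : 2 ≤ c := by
    have : 1 ≤ √(l * √(n * a)) := by
      rw [Real.one_le_sqrt, hsq]
      nlinarith [mul_le_mul hl1 (mul_le_mul ha hr1 zero_le_one ha0.le) (by norm_num) (by linarith)]
    rw [hc]; linarith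
  -- Since `c ≥ 2` and `δ ≤ 1`, subtracting the slack at most halves `c`; then `16384 / 4 / 512 =
  -- 8`.
  have h1 : 8 * (l * r) ≤ (c - δ) ^ 2 / (512 * a) := by
    rw [le_div_iff₀ (by positivity)]
    have : c ^ 2 / 4 ≤ (c - δ) ^ 2 := by nlinarith
    nlinarith
  have h2 : 32 * m ≤ a * Real.exp (8 * (l * r)) := by
    have e1 : (2 : ℝ) ^ l ≤ Real.exp l := by
      rw [← Real.exp_one_pow]
      exact pow_le_pow_left₀ (by norm_num) (by linarith [Real.exp_one_gt_d9]) _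
    have e2 : (32 : ℝ) ≤ Real.exp 4 := by
      rw [show (4 : ℝ) = (4 : ℕ) by norm_num, ← Real.exp_one_pow]
      calc (32 : ℝ) ≤ 2.7 ^ 4 := by norm_num
        _ ≤ _ := pow_le_pow_left₀ (by norm_num) (by linarith [Real.exp_one_gt_d9]) _
    have e3 : r ^ 2 ≤ Real.exp (2 * r) := by
      rw [two_mul, Real.exp_add, ← sq]
      exact pow_le_pow_left₀ (by linarith) (by linarith [Real.add_one_le_exp r]) _
    calc 32 * m ≤ 32 * (n * 2 ^ l) := by gcongr
      _ = a * (32 * r ^ 2 * 2 ^ l) := by rw [hna]; ring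
      _ ≤ a * (Real.exp 4 * Real.exp (2 * r) * Real.exp l) := by gcongr
      _ ≤ a * Real.exp (8 * (l * r)) := by
        rw [← Real.exp_add, ← Real.exp_add]
        gcongr
        nlinarith [mul_nonneg (sub_nonneg.2 hl1) (sub_nonneg.2 hr1)]
  calc 2 * m * Real.exp (-((c - δ) ^ 2 / (512 * a))) ≤ 2 * m * Real.exp (-(8 * (l * r))) := by
        gcongr
    _ ≤ a / 16 := by
        rw [Real.exp_neg, ← div_eq_mul_inv, div_le_iff₀ (Real.exp_pos _)]
        linarith

/-- Both tail exponents are at least `n^(1/4) / 512`. For coordinates this follows from `δ² =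
n^(-1/4)` and `γ² ≤ 256 / √n`; for constraints it uses `a ≥ √n`, which makes `√(n a) ≥ n^(3/4)`. The
union runs over `T (n + m)` events, polynomially many as `m ≤ n^(3/2)`. -/
theorem jumps_bound {m n a T : ℝ} {l : ℕ} (hn : 1 ≤ n) (hm : 0 ≤ m) (ha : √n ≤ a) (hl : 1 ≤ l)
    (hT : √n ≤ T) (hT2 : T ≤ 2 * √n) (hmn : m ^ 2 ≤ n ^ 3)
    (hlarge : 8 * n ^ 2 * Real.exp (-(√(√n) / 512)) ≤ 1 / 16) :
    2 * T * n * Real.exp (-((1 / √(√(√n))) ^ 2 / (2 * (16 / √T) ^ 2))) +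
      2 * T * m * Real.exp (-((128 * √(l * √(n * a))) ^ 2 / (2 * ((16 / √T) ^ 2 * n)))) ≤
      1 / 16 := by
  have hl1 : (1 : ℝ) ≤ l := by exact_mod_cast hl
  set p := √n with hp
  have hp2 : p ^ 2 = n := Real.sq_sqrt (by linarith)
  have hp1 : 1 ≤ p := by rw [hp, Real.one_le_sqrt]; exact hn
  set q := √p with hq
  have hq2 : q ^ 2 = p := Real.sq_sqrt (by linarith)
  have hq1 : 1 ≤ q := by rw [hq, Real.one_le_sqrt]; exact hp1
  have hT0 : 0 < T := by linarith
  have hγ : (16 / √T) ^ 2 = 256 / T := by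
    rw [div_pow, Real.sq_sqrt hT0.le]; norm_num
  have hδ : (1 / √q) ^ 2 = 1 / q := by
    rw [div_pow, Real.sq_sqrt (by linarith)]; norm_num
  have h1 : q / 512 ≤ (1 / √q) ^ 2 / (2 * (16 / √T) ^ 2) := by
    rw [hγ, hδ]
    have : 1 / q / (2 * (256 / T)) = T / q / 512 := by field_simp; norm_num
    rw [this]
    gcongr
    rw [le_div_iff₀ (by linarith)]
    nlinarith
  have h2 : q / 512 ≤ (128 * √(l * √(n * a))) ^ 2 / (2 * ((16 / √T) ^ 2 * n)) := by
    have h3 : p * q ≤ √(n * a) := by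
      apply Real.le_sqrt_of_sq_le
      rw [mul_pow, hp2, hq2]
      gcongr
    have h4 : p * q ≤ l * √(n * a) := by
      nlinarith [Real.sqrt_nonneg (n * a)]
    have h5 : q ≤ l * √(n * a) * T / n := by
      rw [le_div_iff₀ (by linarith)]
      calc q * n = p * q * p := by rw [← hp2]; ring
        _ ≤ l * √(n * a) * T := by gcongr
    rw [hγ, mul_pow, Real.sq_sqrt (by positivity)]
    have : 128 ^ 2 * (l * √(n * a)) / (2 * (256 / T * n)) = 32 * (l * √(n * a) * T / n) := by
      field_simp; ring
    rw [this]
    linarith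
  have h6 : m ≤ n * p := by
    refine (abs_le_of_sq_le_sq' ?_ (by positivity)).2
    rw [mul_pow, hp2]
    linarith
  calc _ ≤ 2 * T * n * Real.exp (-(q / 512)) + 2 * T * m * Real.exp (-(q / 512)) := by
        gcongr
    _ ≤ 2 * (2 * p) * (n * p) * Real.exp (-(q / 512)) +
        2 * (2 * p) * (n * p) * Real.exp (-(q / 512)) := by
        gcongr
        nlinarith
    _ = 8 * n ^ 2 * Real.exp (-(q / 512)) := by rw [← hp2]; ring
    _ ≤ _ := hlarge

theorem exists_large : ∃ n₀ : ℕ, ∀ n : ℕ, n₀ ≤ n →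
    16384 ≤ n ∧ 8 * (n : ℝ) ^ 2 * Real.exp (-(√(√n) / 512)) ≤ 1 / 16 := by
  have h1 : Filter.Tendsto (fun n : ℕ => √(√(n : ℝ)) / 512) Filter.atTop Filter.atTop :=
    Filter.Tendsto.atTop_div_const (by norm_num) (Real.tendsto_sqrt_atTop.comp
      (Real.tendsto_sqrt_atTop.comp tendsto_natCast_atTop_atTop))
  have h2 := ((Real.tendsto_pow_mul_exp_neg_atTop_nhds_zero 8).comp h1).const_mul (8 * 512 ^ 8)
  rw [mul_zero] at h2
  have h3 := (h2.eventually (gt_mem_nhds (show (0 : ℝ) < 1 / 16 by norm_num))).and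
    (Filter.eventually_ge_atTop 16384)
  obtain ⟨n₀, h⟩ := Filter.eventually_atTop.1 h3
  refine ⟨n₀, fun n hn => ⟨(h n hn).2, ?_⟩⟩
  have h4 := (h n hn).1.le
  simp only [Function.comp] at h4
  have h5 : √(√(n : ℝ)) ^ 8 = (n : ℝ) ^ 2 := by
    rw [show 8 = 2 * 4 by norm_num, pow_mul, Real.sq_sqrt (by positivity),
      show 4 = 2 * 2 by norm_num, pow_mul, Real.sq_sqrt (by positivity)]
  calc _ = _ := ?_
    _ ≤ _ := h4
  rw [div_pow, h5]
  ring

/-- The deviation of the rounding, started with few active coordinates. -/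
theorem rounding_bound {m n V : ℝ} (hn : 256 ≤ n) (hmn : m ^ 2 ≤ n ^ 3)
    (hV : V ≤ √n + 2 * (1 / √(√(√n)) * n)) :
    0 ≤ 1 / √(√(√n)) ^ 3 ∧ 1 / √(√(√n)) ^ 3 ≤ 1 / 8 ∧
    2 * m * Real.exp (-(1 / √(√(√n)) ^ 3 * (18 * √n)) + (1 / √(√(√n)) ^ 3) ^ 2 * V) ≤ 1 / 8 := by
  -- With `w = n^(1/8)`: `δ = 1/w`, `√n = w⁴`, `m ≤ w¹²`, `V ≤ 3 w⁷`, and `θ = w⁻³` balances the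
  -- exponent at `-18 w + 3 w`.
  set w := √(√(√n)) with hw
  have hw2 : 2 ≤ w := by
    refine Real.le_sqrt_of_sq_le (Real.le_sqrt_of_sq_le (Real.le_sqrt_of_sq_le ?_))
    norm_num; exact hn
  have h1 : w ^ 4 = √n := by
    rw [show 4 = 2 * 2 by norm_num, pow_mul, Real.sq_sqrt (by positivity),
      Real.sq_sqrt (by positivity)]
  have h2 : w ^ 8 = n := by
    rw [show 8 = 4 * 2 by norm_num, pow_mul, h1, Real.sq_sqrt (by linarith)]
  have h3 : m ≤ w ^ 12 := by
    refine (abs_le_of_sq_le_sq' ?_ (by positivity)).2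
    rw [← h2] at hmn
    calc _ ≤ _ := hmn
      _ = _ := by ring
  have hw0 : 0 < w := by linarith
  have hV2 : V ≤ 3 * w ^ 7 := by
    rw [← h1] at hV
    have h4 : 1 / w * n = w ^ 7 := by rw [← h2]; field_simp
    rw [h4] at hV
    have : w ^ 4 ≤ w ^ 7 := pow_le_pow_right₀ (by linarith) (by norm_num)
    linarith
  refine ⟨by positivity, ?_, ?_⟩
  · rw [div_le_div_iff₀ (by positivity) (by norm_num)]
    calc (1 : ℝ) * 8 = 2 ^ 3 := by norm_num
      _ ≤ w ^ 3 := by gcongr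
      _ = _ := by ring
  · have h5 : -(1 / w ^ 3 * (18 * √n)) + (1 / w ^ 3) ^ 2 * V ≤ -(15 * w) := by
      have : (1 / w ^ 3) ^ 2 * V ≤ (1 / w ^ 3) ^ 2 * (3 * w ^ 7) := by gcongr
      have e1 : (1 / w ^ 3) ^ 2 * (3 * w ^ 7) = 3 * w := by field_simp
      have e2 : 1 / w ^ 3 * (18 * √n) = 18 * w := by rw [← h1]; field_simp
      linarith
    have h6 : 16 * w ^ 12 ≤ Real.exp (15 * w) := by
      have e1 : w ^ 12 ≤ Real.exp (12 * w) := by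
        rw [show 12 * w = (12 : ℕ) * w by norm_num, Real.exp_nat_mul]
        exact pow_le_pow_left₀ hw0.le (by linarith [Real.add_one_le_exp w]) _
      have e2 : 16 ≤ Real.exp (3 * w) := by
        rw [show 3 * w = (3 : ℕ) * w by norm_num, Real.exp_nat_mul]
        calc (16 : ℝ) ≤ 3 ^ 3 := by norm_num
          _ ≤ _ := pow_le_pow_left₀ (by norm_num) (by linarith [Real.add_one_le_exp w]) _
      rw [show 15 * w = 3 * w + 12 * w by ring, Real.exp_add]
      gcongr
    calc _ ≤ 2 * w ^ 12 * Real.exp (-(15 * w)) := by gcongr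
      _ ≤ 1 / 8 := by
        rw [Real.exp_neg, ← div_eq_mul_inv, div_le_iff₀ (Real.exp_pos _)]
        linarith

/-- The deviation of the rounding from the origin, for many constraints. -/
theorem rounding_bound_of_many {m n L : ℝ} (hn : 0 < n) (hm : n ^ 3 ≤ m ^ 2) (hm0 : 0 < m)
    (hL : L = Real.log (Real.exp 1 * m / n)) :
    2 * m * Real.exp (-(√(L / n) * (4 * √(n * L))) + √(L / n) ^ 2 * n) ≤ 1 / 8 ∨ L < 0 := by
  by_cases hL0 : L < 0
  · exact Or.inr hL0
  left
  push Not at hL0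
  have h1 : √(L / n) * √(n * L) = L := by
    rw [← Real.sqrt_mul (by positivity), show L / n * (n * L) = L ^ 2 by field_simp,
      Real.sqrt_sq hL0]
  have h2 : √(L / n) ^ 2 * n = L := by
    rw [Real.sq_sqrt (by positivity)]; field_simp
  -- The resulting `exp (3 L) = (e m / n)³` exceeds `16 m` exactly because `n³ ≤ m²`.
  have h3 : -(√(L / n) * (4 * √(n * L))) + √(L / n) ^ 2 * n = -(3 * L) := by
    rw [h2, show √(L / n) * (4 * √(n * L)) = 4 * (√(L / n) * √(n * L)) by ring, h1]; ring
  rw [h3]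
  have h4 : Real.exp L = Real.exp 1 * m / n := by rw [hL, Real.exp_log (by positivity)]
  have h5 : 16 * m ≤ Real.exp (3 * L) := by
    rw [show 3 * L = (3 : ℕ) * L by norm_num, Real.exp_nat_mul, h4, div_pow, le_div_iff₀ (by positivity)]
    have e : 16 ≤ Real.exp 1 ^ 3 := by
      calc (16 : ℝ) ≤ 2.7 ^ 3 := by norm_num
        _ ≤ _ := pow_le_pow_left₀ (by norm_num) (by linarith [Real.exp_one_gt_d9]) _
    calc 16 * m * n ^ 3 ≤ Real.exp 1 ^ 3 * m * m ^ 2 := by gcongr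
      _ = _ := by ring
  rw [Real.exp_neg, ← div_eq_mul_inv, div_le_iff₀ (Real.exp_pos _)]
  linarith

/-- The potential of the thresholds. -/
theorem threshold_step {n l : ℝ} (hn : 0 ≤ n) (hl : 0 ≤ l) {a a' : ℕ} (h : 2 * a' ≤ a) :
    2048 * √(l * √(n * a')) + 2 * (128 * √(l * √(n * a))) ≤ 2048 * √(l * √(n * a)) := by
  -- Halving `a` gives the factor `2^(-1/4) < 7/8`, which is proved as `1/2 ≤ (49/64)²`. The freed
  -- eighth of 2048 is exactly `2 · 128`.
  have h1 : √(l * √(n * a')) ≤ 7 / 8 * √(l * √(n * a)) := by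
    have h2 : (49 / 64 : ℝ) * √(n * a) = √((49 / 64) ^ 2 * (n * a)) := by
      rw [Real.sqrt_mul (by norm_num) (n * a), Real.sqrt_sq (by norm_num)]
    have h3 : (7 / 8 : ℝ) * √(l * √(n * a)) = √((7 / 8) ^ 2 * (l * √(n * a))) := by
      rw [Real.sqrt_mul (by norm_num) (l * √(n * a)), Real.sqrt_sq (by norm_num)]
    rw [h3, show ((7 : ℝ) / 8) ^ 2 * (l * √(n * a)) = l * (49 / 64 * √(n * a)) by ring, h2]
    have h' : (2 : ℝ) * a' ≤ a := by exact_mod_cast h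
    have h4 : n * a' ≤ (49 / 64) ^ 2 * (n * a) := by
      nlinarith [mul_le_mul_of_nonneg_left h' hn, mul_nonneg hn (Nat.cast_nonneg (α := ℝ) a)]
    gcongr
  linarith [Real.sqrt_nonneg (l * √(n * a))]

/-! ### The colouring as a function of the draws -/

namespace Spencer

open RealRAM

/-- The number of iterations of each walk, about `√n`. -/
noncomputable def walkLength (n : ℕ) : ℕ := sInf {t | n ≤ t * t}

/-- The binary logarithm of `m / n`, rounded up. -/
noncomputable def logRatio (n m : ℕ) : ℕ := sInf {l | m ≤ n * 2 ^ l}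

/-- The number of walks; the walks are only used if `n` is large and `m` is not too large. -/
noncomputable def numWalks (n₀ n m : ℕ) : ℕ :=
  if n₀ ≤ n ∧ m ^ 2 < n ^ 3 then 3 * logRatio 1 n + 8 else 0

/-- The number of rounds of coin tosses. -/
noncomputable def numSweeps (n : ℕ) : ℕ := logRatio 1 n + 3

/-- The thresholds of the walks. -/
noncomputable def threshold (n m a : ℕ) : ℝ := 128 * √((logRatio n m + 1 : ℕ) * √(n * a))

variable {n m : ℕ}

theorem le_walkLength_sq (n : ℕ) : n ≤ walkLength n * walkLength n :=
  Nat.sInf_mem (s := {t | n ≤ t * t}) ⟨n, Nat.le_mul_self n⟩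

theorem walkLength_le {t : ℕ} (h : n ≤ t * t) : walkLength n ≤ t := Nat.sInf_le h

theorem walkLength_sq_le (hn : 0 < n) : walkLength n ^ 2 ≤ 4 * n := by
  by_contra h
  have h1 : 2 ≤ walkLength n := by
    by_contra h'
    have : walkLength n ^ 2 ≤ 1 ^ 2 := Nat.pow_le_pow_left (by omega) 2
    omega
  obtain ⟨t, ht⟩ := Nat.exists_eq_add_of_le' h1
  have h2 : ¬ n ≤ (t + 1) * (t + 1) := fun h' => by
    have := walkLength_le h'
    omega
  rw [ht] at h
  nlinarith

theorem le_mul_two_pow_logRatio (hn : 0 < n) (m : ℕ) : m ≤ n * 2 ^ logRatio n m :=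
  Nat.sInf_mem (s := {l | m ≤ n * 2 ^ l})
    ⟨m, (Nat.lt_two_pow_self).le.trans (Nat.le_mul_of_pos_left _ hn)⟩

theorem logRatio_le {l : ℕ} (h : m ≤ n * 2 ^ l) : logRatio n m ≤ l := Nat.sInf_le h

theorem logRatio_le_log (hn : 0 < n) (hm : n ≤ m) :
    (logRatio n m + 1 : ℝ) ≤ 2 * (1 + Real.log (m / n)) := by
  have hnR : (0 : ℝ) < n := by exact_mod_cast hn
  have hmn : (1 : ℝ) ≤ m / n := by rw [le_div_iff₀ hnR]; simpa using hm
  have hlog := Real.log_nonneg hmn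
  rcases Nat.eq_zero_or_pos (logRatio n m) with h | h
  · rw [h]; push_cast; linarith
  obtain ⟨l, hl⟩ := Nat.exists_eq_add_of_le' h
  have h2 : ¬ m ≤ n * 2 ^ l := fun h' => by
    have := logRatio_le h'
    omega
  have h3 : (2 : ℝ) ^ l ≤ m / n := by
    rw [le_div_iff₀ hnR, mul_comm]
    exact_mod_cast (not_le.1 h2).le
  have h4 := Real.log_le_log (by positivity) h3
  rw [Real.log_pow] at h4
  rw [hl]
  push_cast
  have h5 : (l : ℝ) / 2 ≤ l * Real.log 2 := by
    nlinarith [Real.log_two_gt_d9, Nat.cast_nonneg (α := ℝ) l]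
  linarith

/-- The walks used for the matrix `A`. -/
noncomputable def walkData (A : Matrix (Fin m) (Fin n) ℝ) : EdgeWalkData n m where
  v j := WithLp.toLp 2 (A j)
  -- Thresholds and starting point are placeholders, overwritten by `restart`.
  c _ := 0
  x₀ := 0
  γ := 16 / √(walkLength n)
  δ := 1 / √(√(√n))

/-- The fractional colouring after `r` walks. -/
noncomputable def fractional (A : Matrix (Fin m) (Fin n) ℝ) (ω : ℕ → ℝ) (r : ℕ) :
    EuclideanSpace ℝ (Fin n) :=
  (walkData A).attempts (threshold n m) (walkLength n) 0 ω r

/-- The fractional colouring after all walks and coin tosses. -/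
noncomputable def rounded (n₀ : ℕ) (A : Matrix (Fin m) (Fin n) ℝ) (ω : ℕ → ℝ) :
    EuclideanSpace ℝ (Fin n) :=
  sweeps (fractional A ω (numWalks n₀ n m))
    (shift (numWalks n₀ n m * (walkLength n * n)) ω) (numSweeps n)

/-- The colouring. -/
noncomputable def coloring (n₀ : ℕ) (A : Matrix (Fin m) (Fin n) ℝ) (ω : ℕ → ℝ) (i : Fin n) : ℝ :=
  if 0 ≤ rounded n₀ A ω i then 1 else -1

variable {A : Matrix (Fin m) (Fin n) ℝ} {n₀ : ℕ}

theorem measurable_coloring (n₀ : ℕ) (A : Matrix (Fin m) (Fin n) ℝ) :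
    Measurable (coloring n₀ A) := by
  have h : Measurable (rounded n₀ A) :=
    (measurable_sweeps (numSweeps n)).comp
      (((walkData A).measurable_attempts (threshold n m) (walkLength n) 0 (numWalks n₀ n m)).prodMk
        (measurable_shift (numWalks n₀ n m * (walkLength n * n))))
  refine measurable_pi_iff.2 fun i => ?_
  have hi : Measurable fun ω => rounded n₀ A ω i :=
    Measurable.comp (g := fun x : EuclideanSpace ℝ (Fin n) => x i) (by fun_prop) h
  exact Measurable.ite (measurableSet_le measurable_const hi) measurable_const measurable_const

theorem coloring_eq_or (n₀ : ℕ) (A : Matrix (Fin m) (Fin n) ℝ) (ω : ℕ → ℝ) (i : Fin n) :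
    coloring n₀ A ω i = 1 ∨ coloring n₀ A ω i = -1 := by
  unfold coloring
  split_ifs <;> simp

theorem coloring_eq_rounded {ω : ℕ → ℝ} (h : ∀ i, |rounded n₀ A ω i| = 1) :
    WithLp.toLp 2 (coloring n₀ A ω) = rounded n₀ A ω := by
  ext i
  simp only [coloring]
  rcases (abs_eq zero_le_one).1 (h i) with h' | h' <;> rw [h'] <;> norm_num

theorem discrepancy_le_iff {x : Fin n → ℝ} {K : ℝ} (hK : 0 ≤ K) :
    discrepancy A x ≤ K ↔ ∀ j, |inner ℝ (WithLp.toLp 2 x) ((walkData A).v j)| ≤ K := by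
  rw [discrepancy, pi_norm_le_iff_of_nonneg hK]
  refine forall_congr' fun j => ?_
  rw [Real.norm_eq_abs]
  have : A.mulVec x j = inner ℝ (WithLp.toLp 2 x) ((walkData A).v j) := by
    simp [walkData, Matrix.mulVec, dotProduct, PiLp.inner_apply]
  rw [this]

theorem discrepancy_coloring_le (hA : ∀ j i, |A j i| ≤ 1) (ω : ℕ → ℝ) :
    discrepancy A (coloring n₀ A ω) ≤ n := by
  rw [discrepancy, pi_norm_le_iff_of_nonneg (Nat.cast_nonneg n)]
  intro j
  calc ‖A.mulVec (coloring n₀ A ω) j‖ ≤ ∑ i, ‖A j i * coloring n₀ A ω i‖ := by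
        rw [Matrix.mulVec, dotProduct]
        exact norm_sum_le _ _
    _ ≤ ∑ i : Fin n, (1 : ℝ) := by
      refine Finset.sum_le_sum fun i _ => ?_
      rw [norm_mul]
      rcases coloring_eq_or n₀ A ω i with h | h <;> rw [h] <;> simpa using hA j i
    _ = n := by simp

/-- Three attempts at least halve the expectation, as `(3/4)³ ≤ 1/2`, so `3 log₂ n` of them cancel
`n`; the last eight supply the `1/8`. -/
theorem three_quarters_pow_le (n : ℕ) : (3 / 4 : ℝ) ^ (3 * logRatio 1 n + 8) * n ≤ 1 / 8 := by
  have h1 : (n : ℝ) ≤ 2 ^ logRatio 1 n := by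
    have := le_mul_two_pow_logRatio one_pos n
    rw [one_mul] at this
    exact_mod_cast this
  rw [pow_add, pow_mul]
  calc ((3 / 4 : ℝ) ^ 3) ^ logRatio 1 n * (3 / 4) ^ 8 * n
      ≤ (1 / 2) ^ logRatio 1 n * (1 / 8) * 2 ^ logRatio 1 n := by
        gcongr <;> norm_num
    _ = ((1 / 2) * 2) ^ logRatio 1 n * (1 / 8) := by rw [mul_pow]; ring
    _ = 1 / 8 := by norm_num

theorem half_pow_numSweeps_le (n : ℕ) : (n : ℝ) * (1 / 2) ^ numSweeps n ≤ 1 / 8 := by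
  have h1 : (n : ℝ) ≤ 2 ^ logRatio 1 n := by
    have := le_mul_two_pow_logRatio one_pos n
    rw [one_mul] at this
    exact_mod_cast this
  rw [numSweeps, pow_add]
  calc (n : ℝ) * ((1 / 2) ^ logRatio 1 n * (1 / 2) ^ 3)
      ≤ 2 ^ logRatio 1 n * ((1 / 2) ^ logRatio 1 n * (1 / 2) ^ 3) := by gcongr
    _ = (2 * (1 / 2)) ^ logRatio 1 n * (1 / 8) := by rw [mul_pow]; ring
    _ = 1 / 8 := by norm_num

/-- Holds for every outcome of the draws, since rejected walks are discarded. Only the number of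
remaining active coordinates is random. -/
theorem fractional_invariant (ω : ℕ → ℝ) (r : ℕ) :
    (∀ i, |fractional A ω r i| ≤ 1) ∧
      ∀ j, |inner ℝ (fractional A ω r) ((walkData A).v j)| ≤
        2048 * √((logRatio n m + 1 : ℕ) * n) := by
  have h := (walkData A).attempts_invariant (f := threshold n m) (T := walkLength n)
    (g := fun a => 2048 * √((logRatio n m + 1 : ℕ) * √(n * a)))
    (B := 2048 * √((logRatio n m + 1 : ℕ) * n))
    (fun a a' ha _ => threshold_step (Nat.cast_nonneg n) (Nat.cast_nonneg _) ha)
    (x := 0) (by simp) ?_ ω r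
  · refine ⟨h.1, fun j => (h.2 j).trans ?_⟩
    have := Real.sqrt_nonneg ((logRatio n m + 1 : ℕ) *
      √(n * (walkData A).active (fractional A ω r)))
    simp only [fractional] at this ⊢
    linarith
  · intro j
    have h1 : ((walkData A).active 0 : ℝ) ≤ n := by exact_mod_cast (walkData A).active_le 0
    have h2 : √(n * (walkData A).active 0) ≤ n := by
      rw [Real.sqrt_le_left (Nat.cast_nonneg n)]
      nlinarith [Nat.cast_nonneg (α := ℝ) n]
    rw [inner_zero_left, abs_zero, sub_nonneg]
    gcongr

theorem sqrt_le_walkLength (n : ℕ) : √(n : ℝ) ≤ walkLength n := by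
  rw [Real.sqrt_le_left (Nat.cast_nonneg _), sq]
  exact_mod_cast le_walkLength_sq n

theorem walkLength_le_sqrt (hn : 0 < n) : (walkLength n : ℝ) ≤ 2 * √n := by
  refine (abs_le_of_sq_le_sq' ?_ (by positivity)).2
  rw [mul_pow, Real.sq_sqrt (Nat.cast_nonneg n)]
  have := walkLength_sq_le hn
  norm_num
  exact_mod_cast this

theorem measure_not_accepts_le (hA : ∀ j i, |A j i| ≤ 1) (hn : 16384 ≤ n) (hm : m ^ 2 < n ^ 3)
    (hlarge : 8 * (n : ℝ) ^ 2 * Real.exp (-(√(√n) / 512)) ≤ 1 / 16)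
    {x : EuclideanSpace ℝ (Fin n)} (hx : ∀ i, |x i| ≤ 1) (ha : √n < (walkData A).active x) :
    drawLaw {ω | ¬ ((walkData A).restart (threshold n m) x).Accepts (walkLength n) ω} ≤
      ENNReal.ofReal (1 / 2) := by
  have hnR : (16384 : ℝ) ≤ n := by exact_mod_cast hn
  have hs1 : (128 : ℝ) ≤ √n := Real.le_sqrt_of_sq_le (by linarith)
  have hT1 := sqrt_le_walkLength n
  have hT0 : (0 : ℝ) < walkLength n := by linarith
  have hw1 : (1 : ℝ) ≤ √(√(√n)) := by
    rw [Real.one_le_sqrt, Real.one_le_sqrt]; linarith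
  have hδ : 1 / √(√(√(n : ℝ))) ≤ 1 := by
    rw [div_le_one (by linarith)]; exact hw1
  have hγ : (16 / √(walkLength n : ℝ)) ^ 2 = 256 / walkLength n := by
    rw [div_pow, Real.sq_sqrt hT0.le]; norm_num
  have ha1 : (1 : ℝ) ≤ (walkData A).active x := by linarith
  have han : ((walkData A).active x : ℝ) ≤ n := by exact_mod_cast (walkData A).active_le x
  have hc1 : 1 ≤ threshold n m ((walkData A).active x) := by
    have : 1 ≤ √((logRatio n m + 1 : ℕ) * √(n * (walkData A).active x)) := by
      have h1 : (1 : ℝ) ≤ √(n * (walkData A).active x) := by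
        rw [Real.one_le_sqrt]; nlinarith
      have h2 : (1 : ℝ) ≤ (logRatio n m + 1 : ℕ) := by norm_cast; omega
      rw [Real.one_le_sqrt]
      nlinarith
    rw [threshold]
    linarith
  refine ((walkData A).restart (threshold n m) x).measure_not_accepts_le
    (c := threshold n m ((walkData A).active x)) (by omega) ?_ ?_ ?_ (fun _ => rfl) ?_ hx hA ?_ ?_ ?_
  · change (16 / √(walkLength n : ℝ)) ^ 2 * walkLength n = 256
    rw [hγ]; field_simp
  · change (16 / √(walkLength n : ℝ)) ^ 2 ≤ 2
    rw [hγ, div_le_iff₀ hT0]; linarith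
  · change 0 < 1 / √(√(√(n : ℝ)))
    positivity
  · exact hδ.trans hc1
  · exact_mod_cast ha1
  · refine hits_bound (l := logRatio n m + 1) (Nat.cast_nonneg m) ha1 han (by omega) ?_ hδ
    have h1 := le_mul_two_pow_logRatio (n := n) (by omega) m
    have h2 : m ≤ n * 2 ^ (logRatio n m + 1) :=
      h1.trans (Nat.mul_le_mul_left _ (Nat.pow_le_pow_right (by norm_num) (Nat.le_succ _)))
    exact_mod_cast h2
  · exact jumps_bound (l := logRatio n m + 1) (by linarith) (Nat.cast_nonneg m) ha.le (by omega) hT1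
      (walkLength_le_sqrt (by omega)) (by exact_mod_cast hm.le) hlarge

/-- An active coordinate contributes at most 1, a nearly frozen one at most `1 - (1 - δ)² ≤ 2 δ`. -/
theorem sum_one_sub_sq_le {x : EuclideanSpace ℝ (Fin n)} (D : EdgeWalkData n m) (hδ : 0 ≤ D.δ)
    (hδ1 : D.δ ≤ 1) :
    ∑ i, (1 - x i ^ 2) ≤ D.active x + 2 * (D.δ * n) := by
  classical
  have h1 : ∀ i, 1 - x i ^ 2 ≤ (if i ∈ (D.nearVar x)ᶜ then 1 else 0) + 2 * D.δ := by
    intro i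
    split_ifs with h
    · nlinarith [sq_nonneg (x i)]
    · rw [Finset.mem_compl, not_not, D.mem_nearVar] at h
      rw [← sq_abs]
      nlinarith [abs_nonneg (x i)]
  calc _ ≤ _ := Finset.sum_le_sum fun i _ => h1 i
    _ = _ := by
      rw [Finset.sum_add_distrib, Finset.sum_ite_mem, Finset.univ_inter]
      simp [EdgeWalkData.active]
      ring

theorem measurableSet_roundsWell (v : Fin m → EuclideanSpace ℝ (Fin n)) (b : ℕ) (u : ℝ) :
    MeasurableSet {p : EuclideanSpace ℝ (Fin n) × (ℕ → ℝ) | RoundsWell v b u p.1 p.2} := by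
  have hs := measurable_sweeps (n := n) b
  have : {p : EuclideanSpace ℝ (Fin n) × (ℕ → ℝ) | RoundsWell v b u p.1 p.2} =
      (⋂ i, {p | |sweeps p.1 p.2 b i| = 1}) ∩
      ⋂ j, {p | |inner ℝ (sweeps p.1 p.2 b - p.1) (v j)| ≤ u} := by
    ext p
    simp [RoundsWell]
  rw [this]
  refine (MeasurableSet.iInter fun i => ?_).inter (MeasurableSet.iInter fun j => ?_)
  · have : Measurable fun p : EuclideanSpace ℝ (Fin n) × (ℕ → ℝ) => sweeps p.1 p.2 b i :=
      Measurable.comp (g := fun x : EuclideanSpace ℝ (Fin n) => x i) (by fun_prop) hs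
    exact measurableSet_eq_fun this.abs measurable_const
  · have : Measurable fun p : EuclideanSpace ℝ (Fin n) × (ℕ → ℝ) =>
      inner ℝ (sweeps p.1 p.2 b - p.1) (v j) := (hs.sub measurable_fst).inner_const
    exact measurableSet_le this.abs measurable_const

/-- If rounding succeeds the discrepancy is that of the fractional colouring, up to the deviation
of the rounding. -/
theorem discrepancy_le_of_roundsWell {u K : ℝ} (hK : 0 ≤ K) {ω : ℕ → ℝ}
    (h : RoundsWell (walkData A).v (numSweeps n) u (fractional A ω (numWalks n₀ n m))
      (shift (numWalks n₀ n m * (walkLength n * n)) ω))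
    (hfr : ∀ j, |inner ℝ (fractional A ω (numWalks n₀ n m)) ((walkData A).v j)| + u ≤ K) :
    discrepancy A (coloring n₀ A ω) ≤ K := by
  rw [discrepancy_le_iff hK, coloring_eq_rounded h.1]
  intro j
  have h1 : inner ℝ (rounded n₀ A ω) ((walkData A).v j) =
      inner ℝ (fractional A ω (numWalks n₀ n m)) ((walkData A).v j) +
      inner ℝ (rounded n₀ A ω - fractional A ω (numWalks n₀ n m)) ((walkData A).v j) := by
    rw [inner_sub_left]; ring
  have h2 : |inner ℝ (rounded n₀ A ω - fractional A ω (numWalks n₀ n m)) ((walkData A).v j)| ≤ u :=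
    h.2 j
  rw [h1]
  refine (abs_add_le _ _).trans ?_
  linarith [hfr j]

/-- More than `√n` coordinates remain active with probability at most `1/8`. Otherwise the rounding,
which uses draws independent of the walks, fails with probability at most `1/8` for unfinished
coordinates plus `1/8` for deviations. -/
theorem measure_walks_fail_le (hA : ∀ j i, |A j i| ≤ 1) (hn : 16384 ≤ n) (hm : m ^ 2 < n ^ 3)
    (hlarge : 8 * (n : ℝ) ^ 2 * Real.exp (-(√(√n) / 512)) ≤ 1 / 16) (hn₀ : n₀ ≤ n) :
    drawLaw {ω | ¬ RoundsWell (walkData A).v (numSweeps n) (18 * √n)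
      (fractional A ω (numWalks n₀ n m)) (shift (numWalks n₀ n m * (walkLength n * n)) ω)} ≤
      ENNReal.ofReal (1 / 2) := by
  have hnR : (16384 : ℝ) ≤ n := by exact_mod_cast hn
  have hs1 : (128 : ℝ) ≤ √n := Real.le_sqrt_of_sq_le (by linarith)
  have hw1 : (1 : ℝ) ≤ √(√(√n)) := by
    rw [Real.one_le_sqrt, Real.one_le_sqrt]; linarith
  set R := numWalks n₀ n m with hR
  have hR' : R = 3 * logRatio 1 n + 8 := by rw [hR, numWalks, if_pos ⟨hn₀, hm⟩]
  set S : Set (EuclideanSpace ℝ (Fin n) × (ℕ → ℝ)) :=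
    {p | (∀ i, |p.1 i| ≤ 1) ∧ ((walkData A).active p.1 : ℝ) ≤ √n ∧
      ¬ RoundsWell (walkData A).v (numSweeps n) (18 * √n) p.1 p.2} with hS
  have hSm : MeasurableSet S := by
    have h1 : MeasurableSet {p : EuclideanSpace ℝ (Fin n) × (ℕ → ℝ) | ∀ i, |p.1 i| ≤ 1} := by
      rw [show {p : EuclideanSpace ℝ (Fin n) × (ℕ → ℝ) | ∀ i, |p.1 i| ≤ 1} =
        ⋂ i, {p | |p.1 i| ≤ 1} by ext; simp]
      exact MeasurableSet.iInter fun i => measurableSet_le (by fun_prop) measurable_const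
    have h2 : MeasurableSet {p : EuclideanSpace ℝ (Fin n) × (ℕ → ℝ) |
        ((walkData A).active p.1 : ℝ) ≤ √n} :=
      measurableSet_le (((walkData A).measurable_threshold fun a => (a : ℝ)).comp measurable_fst)
        measurable_const
    exact h1.inter (h2.inter (measurableSet_roundsWell _ _ _).compl)
  have hinv := fun ω r => (fractional_invariant (A := A) ω r).1
  have hfr : Measurable fun ω => fractional A ω R := (walkData A).measurable_attempts _ _ 0 R
  have hP1 : drawLaw {ω | √n < (walkData A).active (fractional A ω R)} ≤
      ENNReal.ofReal (1 / 8) := by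
    refine ((walkData A).measure_active_attempts_le (f := threshold n m) (T := walkLength n)
      (s := √n) (by linarith) (x := 0) (P := fun x => ∀ i, |x i| ≤ 1) hinv
      (fun y hy ha => measure_not_accepts_le hA hn hm hlarge hy ha) R).trans ?_
    rw [hR']
    exact ENNReal.ofReal_le_ofReal (three_quarters_pow_le n)
  have hP2 : drawLaw {ω | (fractional A ω R, shift (R * (walkLength n * n)) ω) ∈ S} ≤
      ENNReal.ofReal (1 / 4) := by
    have hpre : MeasurableSet {ω | (fractional A ω R, shift (R * (walkLength n * n)) ω) ∈ S} :=
      (hfr.prodMk (measurable_shift (R * (walkLength n * n)))) hSm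
    rw [← lintegral_indicator_one hpre]
    have h := lintegral_fresh (g := fun ω => fractional A ω R)
      (Φ := fun y ω' => S.indicator (fun _ => (1 : ENNReal)) (y, ω')) hfr
      ((walkData A).usesDraws_attempts _ _ 0 R) (measurable_const.indicator hSm)
    calc _ = _ := h
      _ ≤ ∫⁻ ω, ENNReal.ofReal (1 / 4) ∂drawLaw := by
        refine lintegral_mono fun ω => ?_
        by_cases ha : ((walkData A).active (fractional A ω R) : ℝ) ≤ √n
        · have hV := sum_one_sub_sq_le (x := fractional A ω R) (walkData A)
            (by change (0 : ℝ) ≤ 1 / _; positivity)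
            (by change 1 / √(√(√(n : ℝ))) ≤ 1; rw [div_le_one (by linarith)]; exact hw1)
          obtain ⟨h1, h2, h3⟩ := rounding_bound (m := m) (n := n) (by linarith)
            (by exact_mod_cast hm.le) (hV.trans (add_le_add_left ha _))
          have h4 := measure_not_roundsWell_le (v := (walkData A).v) (hinv ω R) hA h1 h2
            (18 * √n) (numSweeps n)
          have h5 : ∫⁻ ω', S.indicator (fun _ => (1 : ENNReal)) (fractional A ω R, ω') ∂drawLaw ≤
              drawLaw {ω' | ¬ RoundsWell (walkData A).v (numSweeps n) (18 * √n)
                (fractional A ω R) ω'} := by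
            have hm' : MeasurableSet {ω' | ¬ RoundsWell (walkData A).v (numSweeps n) (18 * √n)
                (fractional A ω R) ω'} :=
              (measurable_prodMk_left (measurableSet_roundsWell (walkData A).v (numSweeps n)
                (18 * √n))).compl
            rw [← lintegral_indicator_one hm']
            refine lintegral_mono fun ω' => ?_
            by_cases hω' : (fractional A ω R, ω') ∈ S
            · have hmem : ω' ∈ {ω' | ¬ RoundsWell (walkData A).v (numSweeps n) (18 * √n)
                  (fractional A ω R) ω'} := hω'.2.2
              rw [Set.indicator_of_mem hω', Set.indicator_of_mem hmem]
              exact le_rfl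
            · rw [Set.indicator_of_notMem hω']
              exact zero_le
          refine h5.trans (h4.trans (ENNReal.ofReal_le_ofReal ?_))
          linarith [half_pow_numSweeps_le n]
        · have : ∀ ω', (fractional A ω R, ω') ∉ S := fun ω' h => ha h.2.1
          simp [this]
      _ = _ := by simp
  calc _ ≤ drawLaw ({ω | √n < (walkData A).active (fractional A ω R)} ∪
        {ω | (fractional A ω R, shift (R * (walkLength n * n)) ω) ∈ S}) := by
        refine measure_mono fun ω hω => ?_
        by_cases h : √n < (walkData A).active (fractional A ω R)
        · exact Or.inl h
        · exact Or.inr ⟨hinv ω R, not_lt.1 h, hω⟩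
    _ ≤ _ := measure_union_le _ _
    _ ≤ _ := add_le_add hP1 hP2
    _ ≤ _ := by
        rw [← ENNReal.ofReal_add (by norm_num) (by norm_num)]
        exact ENNReal.ofReal_le_ofReal (by norm_num)

theorem half_le_measure_of_compl_le {S G : Set (ℕ → ℝ)} (hS : MeasurableSet S)
    (h : drawLaw Sᶜ ≤ ENNReal.ofReal (1 / 2)) (hSG : S ⊆ G) : 1 / 2 ≤ drawLaw G := by
  refine le_trans ?_ (measure_mono hSG)
  have h1 := measure_add_measure_compl (μ := drawLaw) hS
  rw [measure_univ] at h1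
  have h2 : (1 : ENNReal) ≤ drawLaw S + 1 / 2 := by
    refine h1.symm.le.trans (add_le_add_right (h.trans (le_of_eq ?_)) _)
    rw [ENNReal.ofReal_div_of_pos (by norm_num)]
    simp
  have h3 := tsub_le_iff_right.2 h2
  refine le_trans (le_of_eq ?_) h3
  norm_num

/-- The colouring has small discrepancy with probability at least one half. -/
theorem half_le_measure_discrepancy_le
    (hn₀ : ∀ n : ℕ, n₀ ≤ n →
      16384 ≤ n ∧ 8 * (n : ℝ) ^ 2 * Real.exp (-(√(√n) / 512)) ≤ 1 / 16)
    (hn : 0 < n) (hm : n ≤ m) (hA : ∀ j i, |A j i| ≤ 1) :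
    1 / 2 ≤ drawLaw {ω | discrepancy A (coloring n₀ A ω) ≤
      (3000 + n₀) * √(n * Real.log (Real.exp 1 * m / n))} := by
  have hnR : (1 : ℝ) ≤ n := by exact_mod_cast hn
  have hmR : (n : ℝ) ≤ m := by exact_mod_cast hm
  have hn0 : (0 : ℝ) < n := by linarith
  have hm0 : (0 : ℝ) < m := by linarith
  set L := Real.log (Real.exp 1 * m / n) with hL
  have hL' : L = 1 + Real.log (m / n) := by
    rw [hL, mul_div_assoc, Real.log_mul (Real.exp_ne_zero 1) (by positivity), Real.log_exp]
  have hlog : 0 ≤ Real.log (m / n) :=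
    Real.log_nonneg (by rw [le_div_iff₀ (by linarith)]; linarith)
  have hL1 : 1 ≤ L := by rw [hL']; linarith
  have hsn : √n ≤ √(n * L) := Real.sqrt_le_sqrt (by nlinarith)
  have hs1 : 1 ≤ √(n : ℝ) := by rw [Real.one_le_sqrt]; exact hnR
  have hs2 : √(n : ℝ) * √n = n := Real.mul_self_sqrt (by linarith)
  have hK0 : 0 ≤ (3000 + n₀) * √(n * L) := by positivity
  have htriv : (n : ℝ) ≤ (3000 + n₀) * √(n * L) → 1 / 2 ≤ drawLaw {ω |
      discrepancy A (coloring n₀ A ω) ≤ (3000 + n₀) * √(n * L)} := by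
    intro h
    rw [show {ω | discrepancy A (coloring n₀ A ω) ≤ (3000 + n₀) * √(n * L)} = Set.univ from
      Set.eq_univ_of_forall fun ω => (discrepancy_coloring_le hA ω).trans h, measure_univ]
    norm_num
  rcases lt_or_ge n n₀ with hsmall | hlarge
  -- For `n < n₀` the trivial bound `n = √n · √n ≤ n₀ √n` suffices; this is why `n₀` is part of the
  -- constant.
  · refine htriv ?_
    have h1 : √(n : ℝ) ≤ n₀ := by
      have : (n : ℝ) ≤ n₀ := by exact_mod_cast hsmall.le
      nlinarith
    calc (n : ℝ) = √n * √n := hs2.symm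
      _ ≤ (3000 + n₀) * √(n * L) := by
        gcongr
        linarith
  obtain ⟨hn1, hn2⟩ := hn₀ n hlarge
  have hmeas : ∀ u : ℝ, MeasurableSet {ω | RoundsWell (walkData A).v (numSweeps n) u
      (fractional A ω (numWalks n₀ n m)) (shift (numWalks n₀ n m * (walkLength n * n)) ω)} := by
    intro u
    have hfr : Measurable fun ω => fractional A ω (numWalks n₀ n m) :=
      (walkData A).measurable_attempts _ _ 0 _
    exact (hfr.prodMk (measurable_shift (numWalks n₀ n m * (walkLength n * n))))
      (measurableSet_roundsWell (walkData A).v (numSweeps n) u)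
  rcases lt_or_ge (m ^ 2) (n ^ 3) with hfew | hmany
  · refine half_le_measure_of_compl_le (hmeas (18 * √n))
      (measure_walks_fail_le hA hn1 hfew hn2 hlarge) fun ω hω =>
      discrepancy_le_of_roundsWell hK0 hω fun j => ?_
    have h1 := (fractional_invariant (A := A) ω (numWalks n₀ n m)).2 j
    have h2 := logRatio_le_log hn hm
    -- From `logRatio + 1 ≤ 2 L` and `1.45² ≥ 2`; the total `2048 · 1.45 + 18` stays below 3000.
    have h3 : √((logRatio n m + 1 : ℕ) * n) ≤ 1.45 * √(n * L) := by
      rw [show (1.45 : ℝ) = √(1.45 ^ 2) from (Real.sqrt_sq (by norm_num)).symm,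
        ← Real.sqrt_mul (by norm_num)]
      refine Real.sqrt_le_sqrt ?_
      push_cast
      rw [← hL'] at h2
      nlinarith
    nlinarith [Real.sqrt_nonneg (n * L), mul_nonneg (Nat.cast_nonneg (α := ℝ) n₀)
      (Real.sqrt_nonneg (n * L))]
  · have hR : numWalks n₀ n m = 0 := by
      rw [numWalks, if_neg]
      rintro ⟨-, h⟩
      omega
    -- The rounding estimate needs `θ = √(L / n) ≤ 1/8`. If this fails then `n < 8 √(n L)` and every
    -- colouring is good enough.
    by_cases hθ : √(L / n) ≤ 1 / 8
    · have hb := (rounding_bound_of_many (m := m) (n := n) (by linarith)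
        (by exact_mod_cast hmany) (by linarith) hL).resolve_right (by linarith)
      have hmeas := hmeas (4 * √(n * L))
      have h4 := measure_not_roundsWell_le (v := (walkData A).v) (x := 0) (by simp) hA
        (Real.sqrt_nonneg (L / n)) hθ (4 * √(n * L)) (numSweeps n)
      refine half_le_measure_of_compl_le hmeas ?_ fun ω hω =>
        discrepancy_le_of_roundsWell hK0 hω fun j => ?_
      · have h0 : ∀ ω, shift 0 ω = ω := fun ω => by funext i; simp [shift]
        have h5 : {ω | RoundsWell (walkData A).v (numSweeps n) (4 * √(n * L))
            (fractional A ω (numWalks n₀ n m))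
            (shift (numWalks n₀ n m * (walkLength n * n)) ω)}ᶜ =
            {ω | ¬ RoundsWell (walkData A).v (numSweeps n) (4 * √(n * L)) 0 ω} := by
          rw [hR, zero_mul]
          simp only [h0]
          rfl
        rw [h5]
        refine h4.trans (ENNReal.ofReal_le_ofReal ?_)
        simp only [PiLp.zero_apply, ne_eq, OfNat.ofNat_ne_zero, not_false_eq_true, zero_pow,
          sub_zero, Finset.sum_const, Finset.card_univ, Fintype.card_fin, nsmul_eq_mul, mul_one]
        linarith [half_pow_numSweeps_le n]
      · have h6 : fractional A ω (numWalks n₀ n m) = 0 := by rw [hR]; rfl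
        rw [h6, inner_zero_left, abs_zero, zero_add]
        gcongr
        linarith [Nat.cast_nonneg (α := ℝ) n₀]
    · refine htriv ?_
      push Not at hθ
      have h7 : n / 8 ≤ √(n * L) := by
        have : √(n * L) = n * √(L / n) := by
          rw [show (n : ℝ) * L = n ^ 2 * (L / n) by field_simp, Real.sqrt_mul (by positivity),
            Real.sqrt_sq (by linarith)]
        rw [this]
        nlinarith
      nlinarith [Nat.cast_nonneg (α := ℝ) n₀]

end Spencer

/-! ### The colouring program -/

namespace RealRAM

open Spencer

variable {ω : ℕ → ℝ} {p q : Prog} {s : Store} {Q Q' : ℕ → Store → Prop} {n m : ℕ}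

/-- Index register `r` gets the least `l` such that `2 ^ l` times the value of `e` is at least the
value of register `rm`. -/
def logP (r : ℕ) (e : IExpr) (rm : ℕ) : Prog :=
  .seq (.setI r (.lit 0)) <| .seq (.setI 12 e) <|
    .loop (.idxLt (.reg 12) (.reg rm))
      (.seq (.setI 12 (.add (.reg 12) (.reg 12))) (.setI r (.add (.reg r) (.lit 1))))

/-- Register `12` runs through `y * 2 ^ i` by adding itself to itself; the least `i` reaching `M` is
the logarithm sought. -/
theorem wp_logP {r rm y M : ℕ} {e : IExpr} (hr : r ≠ 12) (hrm : rm ≠ 12) (hrr : rm ≠ r)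
    (he : e.eval (s.setI r 0) = y) (hy : 0 < y) (hM : s.idx rm = M)
    (hQ : ∀ k s', Frame (logP r e rm) s s' → k ≤ 11 * logRatio y M + e.cost + 6 →
      s'.idx r = logRatio y M → Q k s') : WP ω (logP r e rm) s Q := by
  suffices h : WP ω (logP r e rm) s fun k s' => k ≤ 11 * logRatio y M + e.cost + 6 ∧
      s'.idx r = logRatio y M from h.mono_frame fun k s' hF h => hQ k s' hF h.1 h.2
  refine wp_seq (wp_setI (wp_seq (wp_setI ?_)))
  have he' : e.eval (s.setI r (IExpr.eval s (.lit 0))) = y := he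
  rw [he']
  simp only [IExpr.eval, IExpr.cost]
  refine wp_loop (fun i K s' => K = 11 * i ∧ s'.idx r = i ∧ s'.idx 12 = y * 2 ^ i ∧
    s'.idx rm = M ∧ i ≤ logRatio y M) (logRatio y M) ?_ ?_ ?_
  · simp [hr, hrm, hrr, hM]
  · rintro i K s₁ - ⟨hK, h1, h2, h3, h4⟩ hb
    simp only [Test.eval, IExpr.eval, h2, h3] at hb
    have hlt : i < logRatio y M := by
      refine lt_of_le_of_ne h4 fun h => ?_
      have := le_mul_two_pow_logRatio hy M
      rw [← h] at this
      omega
    refine ⟨hlt, wp_seq (wp_setI (wp_setI ⟨?_, ?_, ?_, ?_, hlt⟩))⟩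
    · simp [Test.cost, IExpr.cost, hK]; ring
    · simp [IExpr.eval, h1, hr]
    · simp [IExpr.eval, h2, Ne.symm hr, pow_succ]; ring
    · simp [hrm, hrr, h3]
  · rintro i K s₁ - ⟨hK, h1, h2, h3, h4⟩ hb -
    simp only [Test.eval, IExpr.eval, h2, h3, not_lt] at hb
    have h5 : logRatio y M = i := le_antisymm (logRatio_le hb) h4
    refine ⟨?_, h5 ▸ h1⟩
    simp only [Test.cost, IExpr.cost]
    omega

/-- Index register `2` gets the length of the walks. -/
def walkLengthP : Prog :=
  .seq (.setI 2 (.lit 0)) <|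
    .loop (.not (.realLe (.ofIdx (.reg 0)) (.mul (.ofIdx (.reg 2)) (.ofIdx (.reg 2)))))
      (.setI 2 (.add (.reg 2) (.lit 1)))

/-- Index expressions have no product, so `n ≤ t * t` is tested after conversion to reals. Trying
all `t` upwards costs only `O(n)`. -/
theorem wp_walkLengthP (hn : s.idx 0 = n)
    (hQ : ∀ k s', Frame walkLengthP s s' → k ≤ 13 * n + 11 → s'.idx 2 = walkLength n → Q k s') :
    WP ω walkLengthP s Q := by
  suffices h : WP ω walkLengthP s fun k s' => k ≤ 13 * n + 11 ∧ s'.idx 2 = walkLength n from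
    h.mono_frame fun k s' hF h => hQ k s' hF h.1 h.2
  have hle : walkLength n ≤ n := walkLength_le (Nat.le_mul_self n)
  refine wp_seq (wp_setI ?_)
  simp only [IExpr.eval, IExpr.cost]
  refine wp_loop (fun i K s' => K = 13 * i ∧ s'.idx 2 = i ∧ i ≤ walkLength n) (walkLength n)
    (by simp) ?_ ?_
  · rintro i K s₁ hF ⟨hK, h1, h2⟩ hb
    have h0 : s₁.idx 0 = n := (hF.idx 0 rfl).trans (by simp [hn])
    simp only [Test.eval, IExpr.eval, RExpr.eval, h0, h1] at hb
    have hb' : ¬ n ≤ i * i := by exact_mod_cast hb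
    have hlt : i < walkLength n := by
      refine lt_of_le_of_ne h2 fun h => ?_
      have := le_walkLength_sq n
      rw [← h] at this
      exact hb' this
    refine ⟨hlt, wp_setI ⟨?_, by simp [IExpr.eval, h1], hlt⟩⟩
    simp [Test.cost, IExpr.cost, RExpr.cost, hK]
    ring
  · rintro i K s₁ hF ⟨hK, h1, h2⟩ hb -
    have h0 : s₁.idx 0 = n := (hF.idx 0 rfl).trans (by simp [hn])
    simp only [Test.eval, IExpr.eval, RExpr.eval, h0, h1, not_not] at hb
    have hb' : n ≤ i * i := by exact_mod_cast hb
    have h5 : walkLength n = i := le_antisymm (walkLength_le hb') h2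
    refine ⟨?_, h5 ▸ h1⟩
    simp only [Test.cost, IExpr.cost, RExpr.cost]
    omega

/-- Index register `r` gets the number of active coordinates of the vector in the array `a`. -/
def activeP (a r : ℕ) : Prog :=
  .seq (.setI r (.lit 0)) <| .forTo 18 0 <|
    .ite (.realLe (.sub (.lit 1) (.reg 1))
      (.sqrt (.mul (.get a (.reg 18) (.lit 0)) (.get a (.reg 18) (.lit 0)))))
      .skip (.setI r (.add (.reg r) (.lit 1)))

theorem wp_activeP {a r : ℕ} (D : EdgeWalkData n m) (hr : r ≠ 0) (hr' : r ≠ 18)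
    (hn : s.idx 0 = n) (hδ : s.real 1 = D.δ)
    (hQ : ∀ k s', Frame (activeP a r) s s' → k ≤ 23 * n + 7 →
      s'.idx r = D.active (s.vec a n) → Q k s') : WP ω (activeP a r) s Q := by
  classical
  suffices h : WP ω (activeP a r) s fun k s' => k ≤ 23 * n + 7 ∧
      s'.idx r = D.active (s.vec a n) from h.mono_frame fun k s' hF h => hQ k s' hF h.1 h.2
  refine wp_seq (wp_setI ?_)
  simp only [IExpr.eval, IExpr.cost]
  have hF18 : (Prog.ite (.realLe (.sub (.lit 1) (.reg 1))
      (.sqrt (.mul (.get a (.reg 18) (.lit 0)) (.get a (.reg 18) (.lit 0)))))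
      .skip (.setI r (.add (.reg r) (.lit 1)))).setsI 18 = false := by
    simp [Prog.setsI, hr']
  refine wp_forTo (N := n) (fun i K s' => K ≤ 23 * i + 2 ∧
    s'.idx r = ∑ l ∈ Finset.range i, if 1 - D.δ ≤ |s.arr a l 0| then 0 else 1)
    (by simp [Ne.symm hr, hn]) hF18 (by simp [Prog.forTo, Prog.setsI, hr]) (by simp [hr']) ?_ ?_
  · rintro i K s₁ hi hir hF ⟨hK, hs⟩
    have hA : s₁.arr a = s.arr a := hF.arr a rfl
    have hR : s₁.real 1 = D.δ := (hF.real 1 rfl).trans hδ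
    have hev : Test.eval s₁ (.realLe (.sub (.lit 1) (.reg 1))
      (.sqrt (.mul (.get a (.reg 18) (.lit 0)) (.get a (.reg 18) (.lit 0))))) ↔
        1 - D.δ ≤ |s.arr a i 0| := by
      simp only [Test.eval, RExpr.eval, IExpr.eval, hir, hA, hR, Real.sqrt_mul_self_eq_abs,
        Rat.cast_one]
    refine wp_ite (fun h => wp_skip ⟨?_, ?_⟩) (fun h => wp_setI ⟨?_, ?_⟩)
    · simp only [Test.cost, RExpr.cost, IExpr.cost]; omega
    · rw [hev] at h
      rw [Finset.sum_range_succ, if_pos h]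
      simp [hr', hs]
    · simp only [Test.cost, RExpr.cost, IExpr.cost]; omega
    · rw [hev] at h
      rw [Finset.sum_range_succ, if_neg h]
      simp [hr', hs, IExpr.eval]
  · rintro K s₁ - hF ⟨hK, hs⟩
    refine ⟨by omega, ?_⟩
    rw [hs, Finset.sum_range, EdgeWalkData.active, Finset.card_eq_sum_ones,
      ← Finset.sum_filter_add_sum_filter_not Finset.univ (· ∈ D.nearVar (s.vec a n))]
    rw [Finset.sum_eq_zero, zero_add]
    · rw [show (D.nearVar (s.vec a n))ᶜ = Finset.univ.filter (· ∉ D.nearVar (s.vec a n)) by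
        ext; simp]
      refine Finset.sum_congr rfl fun i hi => if_neg ?_
      have := (Finset.mem_filter.1 hi).2
      rwa [D.mem_nearVar] at this
    · intro i hi
      have := (Finset.mem_filter.1 hi).2
      rw [D.mem_nearVar] at this
      exact if_pos this

/-- `for ri < rN: p; check t`; a failed check sets index register `17`. -/
def Prog.checkTo (ri rN : ℕ) (p : Prog) (t : Test) : Prog :=
  .forTo ri rN (.seq p (.ite t .skip (.setI 17 (.lit 1))))

/-- The loop sets the flag but never clears it, so successive checks accumulate a conjunction. -/
theorem wp_checkTo {ri rN N c : ℕ} {t : Test} (P : ℕ → Prop) (hN : s.idx rN = N)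
    (hri : ri ≠ 17) (hrN : rN ≠ 17) (hrr : ri ≠ rN) (hpi : p.setsI ri = false)
    (hpN : p.setsI rN = false) (hp : p.setsI 17 = false)
    (hstep : ∀ i < N, ∀ s', Frame (.checkTo ri rN p t) s s' → s'.idx ri = i →
      WP ω p s' fun k s'' => k ≤ c ∧ (t.eval s'' ↔ P i))
    (hQ : ∀ k s', Frame (.checkTo ri rN p t) s s' → k ≤ N * (c + t.cost + 9) + 5 →
      (s'.idx 17 = 0 ↔ s.idx 17 = 0 ∧ ∀ i < N, P i) → Q k s') :
    WP ω (.checkTo ri rN p t) s Q := by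
  refine wp_forTo (N := N) (fun i K s' => K ≤ i * (c + t.cost + 9) + 2 ∧
    (s'.idx 17 = 0 ↔ s.idx 17 = 0 ∧ ∀ l < i, P l)) hN
    (by simp [Prog.setsI, hpi, Ne.symm hri]) (by simp [Prog.forTo, Prog.setsI, hpN, hrr, Ne.symm hrN])
    (by simp [Ne.symm hri]) ?_ ?_
  · rintro i K s₁ hi hir hF ⟨hK, hs⟩
    have hmul : (i + 1) * (c + t.cost + 9) = i * (c + t.cost + 9) + (c + t.cost + 9) := by ring
    have hall : (∀ l < i + 1, P l) ↔ (∀ l < i, P l) ∧ P i := Nat.forall_lt_succ_right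
    refine wp_seq ((hstep i hi s₁ hF hir).mono_frame ?_)
    rintro k s₂ hF₂ ⟨hk, ht⟩
    have h17 : s₂.idx 17 = s₁.idx 17 := hF₂.idx 17 hp
    refine wp_ite (fun h => wp_skip ⟨by omega, ?_⟩) (fun h => wp_setI ⟨?_, ?_⟩)
    · rw [ht] at h
      simp only [Store.setI_idx, Ne.symm hri, if_false, h17, hs, hall, h, and_true]
    · simp only [IExpr.cost]; omega
    · rw [ht] at h
      simp [Ne.symm hri, IExpr.eval]
      exact fun _ => ⟨i, le_rfl, h⟩
  · rintro K s₁ - hF ⟨hK, hs⟩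
    exact hQ _ s₁ hF (by omega) hs

/-- Check whether the walk is usable; index register `17` is `0` in this case. -/
def acceptP : Prog :=
  .seq (.setI 17 (.lit 0)) <|
  .seq (.checkTo 18 0 .skip (.realLe
    (.sqrt (.mul (.get 3 (.reg 18) (.lit 0)) (.get 3 (.reg 18) (.lit 0)))) (.lit 1))) <|
  .seq (.checkTo 19 1 (.sumTo 18 0 5 (.mul (.sub (.get 3 (.reg 18) (.lit 0))
      (.get 2 (.reg 18) (.lit 0))) (.get 0 (.reg 19) (.reg 18))))
    (.realLe (.sqrt (.mul (.reg 5) (.reg 5))) (.mul (.lit 2) (.reg 4)))) <|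
  .seq (activeP 3 16) <|
  .ite (.idxLt (.reg 15) (.add (.reg 16) (.reg 16))) (.setI 17 (.lit 1)) .skip

/-- Covers every clause of `Accepts` except the bound on the number of hits, which the walk itself
reports in index register `3`. -/
theorem wp_acceptP {D : EdgeWalkData n m} {T : ℕ} {c : ℝ} {y : EuclideanSpace ℝ (Fin n)}
    (hn : 0 < n) (hm : 0 < m) (hE : Encodes s D T) (h4 : s.real 4 = c)
    (h15 : s.idx 15 = D.active D.x₀) (hy : s.vec 3 n = y)
    (hQ : ∀ k s', Frame acceptP s s' → k ≤ 150 * (m * n) →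
      (s'.idx 17 = 0 ↔ (∀ i, |y i| ≤ 1) ∧ (∀ j, |inner ℝ (y - D.x₀) (D.v j)| ≤ 2 * c) ∧
        2 * D.active y ≤ D.active D.x₀) → Q k s') : WP ω acceptP s Q := by
  suffices h : WP ω acceptP s fun k s' => k ≤ 150 * (m * n) ∧
      (s'.idx 17 = 0 ↔ (∀ i, |y i| ≤ 1) ∧ (∀ j, |inner ℝ (y - D.x₀) (D.v j)| ≤ 2 * c) ∧
        2 * D.active y ≤ D.active D.x₀) from h.mono_frame fun k s' hF h => hQ k s' hF h.1 h.2
  refine wp_seq (wp_setI ?_)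
  simp only [IExpr.eval, IExpr.cost]
  refine wp_seq (wp_checkTo (N := n) (c := 1) (fun i => |s.arr 3 i 0| ≤ 1)
    (by simp [hE.idx0]) (by decide) (by decide) (by decide) rfl rfl rfl ?_ ?_)
  · intro i _ s₁ hF hi
    refine wp_skip ⟨le_rfl, ?_⟩
    simp only [Test.eval, RExpr.eval, IExpr.eval, hi, hF.arr 3 rfl, Real.sqrt_mul_self_eq_abs,
      Rat.cast_one, Store.setI_arr]
  intro k₁ s₁ hF₁ hk₁ h₁
  have hE₁ : Encodes s₁ D T := Encodes.of_frame (p := acceptP) hE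
    ((Frame.setI_right (Frame.refl _ _) rfl).trans (hF₁.weaken (by
      intro r h; simp only [acceptP, Prog.setsI, Bool.or_eq_false_iff] at h; exact h.2.1)
      (by intro r h; simp only [acceptP, Prog.setsR, Bool.or_eq_false_iff] at h; exact h.2.1)
      (by intro r h; simp only [acceptP, Prog.setsA, Bool.or_eq_false_iff] at h; exact h.2.1)
      (by intro _; rfl)))
    rfl rfl rfl rfl rfl rfl rfl rfl
  have ha₁ : ∀ a, s₁.arr a = s.arr a := fun a => hF₁.arr a rfl
  have hi₁ : s₁.idx 15 = s.idx 15 := by rw [hF₁.idx 15 rfl]; simp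
  have hr₁ : s₁.real 4 = c := (hF₁.real 4 rfl).trans h4
  have hyv : y - D.x₀ = vecOf n fun l => s.arr 3 l 0 - s.arr 2 l 0 := by
    ext l
    rw [← hy]
    simp [Store.vec, hE.arr2]
  refine wp_seq (wp_checkTo (N := m) (c := 21 * n + 7)
    (fun j => |∑ l ∈ Finset.range n, (s.arr 3 l 0 - s.arr 2 l 0) * s.arr 0 j l| ≤ 2 * c)
    hE₁.idx1 (by decide) (by decide) (by decide) rfl rfl rfl ?_ ?_)
  · intro j _ s₂ hF₂ hj
    have ha₂ : ∀ a, s₂.arr a = s.arr a := fun a => (hF₂.arr a rfl).trans (ha₁ a)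
    refine wp_sumTo (N := n) (fun l => (s.arr 3 l 0 - s.arr 2 l 0) * s.arr 0 j l)
      ((hF₂.idx 0 rfl).trans hE₁.idx0) (by decide) ?_ ?_
    · intro l _ s₃ hF₃ hl
      simp only [RExpr.eval, IExpr.eval, hl, hF₃.arr 3 rfl, hF₃.arr 2 rfl, hF₃.arr 0 rfl,
        hF₃.idx 19 rfl, hj, ha₂]
    · intro k₃ s₃ hF₃ hk₃ hs₃
      have hr₃ : s₃.real 4 = c := by rw [hF₃.real 4 rfl, hF₂.real 4 rfl, hr₁]
      refine ⟨?_, ?_⟩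
      · simp only [RExpr.cost, IExpr.cost] at hk₃
        omega
      · simp only [Test.eval, RExpr.eval, hs₃, hr₃, Real.sqrt_mul_self_eq_abs, Rat.cast_ofNat]
  intro k₂ s₂ hF₂ hk₂ h₂
  have hE₂ : Encodes s₂ D T := hE₁.of_frame hF₂ rfl rfl rfl rfl rfl rfl rfl rfl
  have hi₂ : s₂.idx 15 = s.idx 15 := (hF₂.idx 15 rfl).trans hi₁
  have hv₂ : s₂.vec 3 n = y := by rw [← hy, Store.vec, hF₂.arr 3 rfl, ha₁]; rfl
  refine wp_seq (wp_activeP D (by decide) (by decide) hE₂.idx0 hE₂.real1 ?_)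
  intro k₃ s₃ hF₃ hk₃ h₃
  rw [hv₂] at h₃
  have hi₃ : s₃.idx 15 = D.active D.x₀ := by rw [hF₃.idx 15 rfl, hi₂, h15]
  have htest : Test.eval s₃ (.idxLt (.reg 15) (.add (.reg 16) (.reg 16))) ↔
      ¬ 2 * D.active y ≤ D.active D.x₀ := by
    simp only [Test.eval, IExpr.eval, hi₃, h₃]
    omega
  have h17 : s₃.idx 17 = 0 ↔ (∀ i, |y i| ≤ 1) ∧ ∀ j, |inner ℝ (y - D.x₀) (D.v j)| ≤ 2 * c := by
    rw [hF₃.idx 17 rfl, h₂, h₁]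
    simp only [Store.setI_idx, if_true, true_and]
    refine and_congr ?_ ?_
    · rw [← hy]
      exact ⟨fun h i => h i i.2, fun h i hi => h ⟨i, hi⟩⟩
    · have hin : ∀ j : Fin m, inner ℝ (y - D.x₀) (D.v j) =
          ∑ l ∈ Finset.range n, (s.arr 3 l 0 - s.arr 2 l 0) * s.arr 0 j l := by
        intro j
        have : D.v j = vecOf n (s.arr 0 j) := by
          ext l
          exact (hE.arr0 j l).symm
        rw [hyv, this, inner_vecOf]
      simp_rw [hin]
      exact ⟨fun h j => h j j.2, fun h j hj => h ⟨j, hj⟩⟩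
  have hcost : 2 + (k₁ + (k₂ + (k₃ + 20))) ≤ 150 * (m * n) := by
    simp only [Test.cost, RExpr.cost, IExpr.cost] at hk₁ hk₂
    have e1 : m ≤ m * n := Nat.le_mul_of_pos_right m hn
    have e2 : n ≤ m * n := Nat.le_mul_of_pos_left n hm
    have e3 : m * (21 * n + 7 + (1 + 1 + 1 + 1 + (1 + 1 + 1) + 1) + 9) = 21 * (m * n) + 24 * m := by
      ring
    nlinarith
  refine wp_ite (fun h => wp_setI ⟨?_, ?_⟩) (fun h => wp_skip ⟨?_, ?_⟩)
  · simp only [Test.cost, IExpr.cost]; omega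
  · rw [htest] at h
    simp [IExpr.eval, h]
  · simp only [Test.cost, IExpr.cost]; omega
  · rw [htest, not_not] at h
    rw [h17]
    simp [h]

end RealRAM

/-! ### Programs for one attempt, one round of coins and the final signs. -/

namespace RealRAM

open Spencer

variable {ω : ℕ → ℝ} {p q : Prog} {s : Store} {Q Q' : ℕ → Store → Prop} {n m : ℕ}

/-- The parameters for the matrix `A` and the fractional colouring `x` are stored in `s`. -/
structure ColorState (s : Store) (A : Matrix (Fin m) (Fin n) ℝ) (x : EuclideanSpace ℝ (Fin n)) :
    Prop where
  idx0 : s.idx 0 = n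
  idx1 : s.idx 1 = m
  idx2 : s.idx 2 = walkLength n
  idx11 : s.idx 11 = logRatio n m
  real0 : s.real 0 = (walkData A).γ
  real1 : s.real 1 = (walkData A).δ
  arr0 : ∀ (j : Fin m) (i : Fin n), s.arr 0 j i = A j i
  vec2 : s.vec 2 n = x

theorem ColorState.of_frame {s s' : Store} {A : Matrix (Fin m) (Fin n) ℝ}
    {x : EuclideanSpace ℝ (Fin n)} (h : ColorState s A x)
    (hF : Frame p s s') (h0 : p.setsI 0 = false) (h1 : p.setsI 1 = false)
    (h2 : p.setsI 2 = false) (h11 : p.setsI 11 = false) (h3 : p.setsR 0 = false)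
    (h4 : p.setsR 1 = false) (h5 : p.setsA 0 = false) {y : EuclideanSpace ℝ (Fin n)}
    (hy : s'.vec 2 n = y) : ColorState s' A y where
  idx0 := (hF.idx 0 h0).trans h.idx0
  idx1 := (hF.idx 1 h1).trans h.idx1
  idx2 := (hF.idx 2 h2).trans h.idx2
  idx11 := (hF.idx 11 h11).trans h.idx11
  real0 := (hF.real 0 h3).trans h.real0
  real1 := (hF.real 1 h4).trans h.real1
  arr0 := by rw [hF.arr 0 h5]; exact h.arr0
  vec2 := hy

theorem ColorState.setI {s : Store} {A : Matrix (Fin m) (Fin n) ℝ}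
    {x : EuclideanSpace ℝ (Fin n)} (h : ColorState s A x) {r v : ℕ} (hr : 11 < r) :
    ColorState (s.setI r v) A x := by
  refine ⟨?_, ?_, ?_, ?_, h.real0, h.real1, h.arr0, h.vec2⟩
  · rw [Store.setI_idx, if_neg (by omega), h.idx0]
  · rw [Store.setI_idx, if_neg (by omega), h.idx1]
  · rw [Store.setI_idx, if_neg (by omega), h.idx2]
  · rw [Store.setI_idx, if_neg (by omega), h.idx11]

/-- Compute the thresholds from the number of active coordinates. -/
def thresholdP : Prog :=
  .seq (activeP 2 15) <|
  .seq (.setR 4 (.mul (.lit 128) (.sqrt (.mul (.ofIdx (.add (.reg 11) (.lit 1)))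
    (.sqrt (.mul (.ofIdx (.reg 0)) (.ofIdx (.reg 15)))))))) <|
  .fillVec 18 1 1 (.reg 4)

/-- The current fractional colouring is kept in the array `2`, where Edge-Walk expects its starting
point. Writing the thresholds therefore already turns the memory into the input of the restarted
walk. -/
theorem wp_thresholdP {A : Matrix (Fin m) (Fin n) ℝ} {x : EuclideanSpace ℝ (Fin n)}
    (hS : ColorState s A x)
    (hQ : ∀ k s', Frame thresholdP s s' → k ≤ 23 * n + 11 * m + 40 →
      s'.real 4 = threshold n m ((walkData A).active x) → s'.idx 15 = (walkData A).active x →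
      Encodes s' ((walkData A).restart (threshold n m) x) (walkLength n) → Q k s') :
    WP ω thresholdP s Q := by
  suffices h : WP ω thresholdP s fun k s' => k ≤ 23 * n + 11 * m + 40 ∧
      s'.real 4 = threshold n m ((walkData A).active x) ∧ s'.idx 15 = (walkData A).active x ∧
      ∀ j < m, s'.arr 1 j 0 = threshold n m ((walkData A).active x) from
    h.mono_frame fun k s' hF h => hQ k s' hF h.1 h.2.1 h.2.2.1
      ⟨(hF.idx 0 rfl).trans hS.idx0, (hF.idx 1 rfl).trans hS.idx1, (hF.idx 2 rfl).trans hS.idx2,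
        (hF.real 0 rfl).trans hS.real0, (hF.real 1 rfl).trans hS.real1,
        fun j i => by rw [hF.arr 0 rfl]; exact hS.arr0 j i, fun j => h.2.2.2 j j.2,
        fun i => by
          rw [hF.arr 2 rfl]
          change _ = x i
          rw [← hS.vec2]
          rfl⟩
  refine wp_seq (wp_activeP (walkData A) (by decide) (by decide) hS.idx0 hS.real1 ?_)
  intro k₁ s₁ hF₁ hk₁ h₁
  rw [hS.vec2] at h₁
  refine wp_seq (wp_setR ?_)
  have hval : RExpr.eval s₁ (.mul (.lit 128) (.sqrt (.mul (.ofIdx (.add (.reg 11) (.lit 1)))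
      (.sqrt (.mul (.ofIdx (.reg 0)) (.ofIdx (.reg 15))))))) =
      threshold n m ((walkData A).active x) := by
    simp only [RExpr.eval, IExpr.eval, h₁, hF₁.idx 0 rfl, hF₁.idx 11 rfl, hS.idx0, hS.idx11,
      threshold, Rat.cast_ofNat]
  rw [hval]
  refine wp_fillVec (N := m) (fun _ => threshold n m ((walkData A).active x))
    ((hF₁.idx 1 rfl).trans hS.idx1) (by decide) ?_ ?_
  · intro j _ s₂ hF₂ _ _
    simp only [RExpr.eval, hF₂.real 4 rfl, Store.setR_real, if_true]
  · intro k₂ s₂ hF₂ hk₂ h₂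
    refine ⟨?_, ?_, ?_, h₂⟩
    · simp only [RExpr.cost, IExpr.cost] at hk₂ ⊢
      omega
    · rw [hF₂.real 4 rfl]; simp
    · rw [hF₂.idx 15 rfl]; exact h₁

/-- One attempt. -/
def attemptP : Prog :=
  .seq thresholdP <| .seq edgeWalkP <|
    .ite (.idxLt (.reg 3) (.lit 1))
      (.seq acceptP (.ite (.idxLt (.reg 17) (.lit 1))
        (.fillVec 18 0 2 (.get 3 (.reg 18) (.lit 0))) .skip)) .skip

/-- Every outcome consumes exactly `walkLength n * n` draws, so the position in the random sequence
stays aligned with `attempts`. -/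
theorem wp_attemptP {A : Matrix (Fin m) (Fin n) ℝ} {x : EuclideanSpace ℝ (Fin n)}
    (hn : 0 < n) (hm : 0 < m) (hS : ColorState s A x)
    (hQ : ∀ k s', Frame attemptP s s' →
      k ≤ 500 * (walkLength n * m * n + n ^ 3 + walkLength n * n ^ 2) + 300 * (m * n) →
      s'.drawn = s.drawn + walkLength n * n →
      ColorState s' A ((walkData A).attempt (threshold n m) (walkLength n) x
        (shift s.drawn ω)) → Q k s') : WP ω attemptP s Q := by
  suffices h : WP ω attemptP s fun k s' =>
      k ≤ 500 * (walkLength n * m * n + n ^ 3 + walkLength n * n ^ 2) + 300 * (m * n) ∧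
      s'.drawn = s.drawn + walkLength n * n ∧
      s'.vec 2 n = (walkData A).attempt (threshold n m) (walkLength n) x (shift s.drawn ω) from
    h.mono_frame fun k s' hF h => hQ k s' hF h.1 h.2.1
      (hS.of_frame hF rfl rfl rfl rfl rfl rfl rfl h.2.2)
  have e1 : m ≤ m * n := Nat.le_mul_of_pos_right m hn
  have e2 : n ≤ m * n := Nat.le_mul_of_pos_left n hm
  set D := (walkData A).restart (threshold n m) x with hD
  refine wp_seq (wp_thresholdP hS ?_)
  intro k₁ s₁ hF₁ hk₁ h4 h15 hE₁
  refine wp_seq (wp_edgeWalkP hn hE₁ ?_)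
  rw [hF₁.drawn rfl]
  intro k₂ s₂ hF₂ hk₂ hd₂ hfail hok
  have hω : (fun k => ω (s.drawn + k)) = shift s.drawn ω := rfl
  rw [hω] at hfail hok
  have hv₂ : s₂.vec 2 n = x := by
    rw [Store.vec, hF₂.arr 2 rfl, hF₁.arr 2 rfl]; exact hS.vec2
  by_cases hf : ∃ t < walkLength n, n ≤ (D.nearDisc (D.path (shift s.drawn ω) t)).card
  · refine wp_ite (fun h => absurd (hfail hf) (by
      simp only [Test.eval, IExpr.eval] at h; omega)) (fun _ => wp_skip ⟨?_, hd₂, ?_⟩)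
    · simp only [Test.cost, IExpr.cost]; omega
    · rw [EdgeWalkData.attempt, if_neg, hv₂]
      rintro ⟨h1, -⟩
      obtain ⟨t, ht, h2⟩ := hf
      exact absurd (h1 t ht) (not_lt.2 h2)
  obtain ⟨h3, hv₃⟩ := hok hf
  refine wp_ite (fun _ => ?_) (fun h => absurd h3 (by
      simp only [Test.eval, IExpr.eval] at h; omega))
  refine wp_seq (wp_acceptP (D := D) hn hm
    (hE₁.of_frame hF₂ rfl rfl rfl rfl rfl rfl rfl rfl) ((hF₂.real 4 rfl).trans h4)
    ((hF₂.idx 15 rfl).trans h15) hv₃ ?_)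
  intro k₃ s₃ hF₃ hk₃ h17
  have hacc : s₃.idx 17 = 0 ↔ D.Accepts (walkLength n) (shift s.drawn ω) := by
    rw [h17]
    have h1 : ∀ t < walkLength n, (D.nearDisc (D.path (shift s.drawn ω) t)).card < n :=
      fun t ht => by
        by_contra h
        exact hf ⟨t, ht, not_lt.1 h⟩
    exact ⟨fun h => ⟨h1, h⟩, fun h => h.2⟩
  have hd₃ : s₃.drawn = s.drawn + walkLength n * n := (hF₃.drawn rfl).trans hd₂
  have hv₃' : s₃.vec 2 n = x := by rw [Store.vec, hF₃.arr 2 rfl]; exact hv₂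
  refine wp_ite (fun h => ?_) (fun h => wp_skip ⟨?_, hd₃, ?_⟩)
  · have h' : s₃.idx 17 = 0 := by simp only [Test.eval, IExpr.eval] at h; omega
    refine wp_fillVec (N := n) (fun i => s₂.arr 3 i 0)
      (by rw [hF₃.idx 0 rfl, hF₂.idx 0 rfl]; exact hE₁.idx0) (by decide) ?_ ?_
    · intro i _ s₄ hF₄ hi _
      simp only [RExpr.eval, IExpr.eval, hi, hF₄.arr 3 rfl, hF₃.arr 3 rfl]
    · intro k₄ s₄ hF₄ hk₄ h₄
      refine ⟨?_, (hF₄.drawn rfl).trans hd₃, ?_⟩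
      · simp only [Test.cost, IExpr.cost, RExpr.cost] at hk₄ ⊢
        omega
      · rw [EdgeWalkData.attempt, if_pos (hacc.1 h'), ← hv₃]
        exact vecOf_congr h₄
  · simp only [Test.cost, IExpr.cost]; omega
  · have h' : s₃.idx 17 ≠ 0 := by simp only [Test.eval, IExpr.eval] at h; omega
    rw [EdgeWalkData.attempt, if_neg fun ha => h' (hacc.2 ha), hv₃']

/-- One round of coin tosses. -/
def sweepP : Prog :=
  .forTo 18 0 <| .seq (.gauss 6) <|
    .seq (.setR 5 (.sub (.lit 1)
      (.sqrt (.mul (.get 2 (.reg 18) (.lit 0)) (.get 2 (.reg 18) (.lit 0)))))) <|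
    .ite (.realLe (.lit 0) (.reg 6))
      (.put 2 (.reg 18) (.lit 0) (.add (.get 2 (.reg 18) (.lit 0)) (.reg 5)))
      (.put 2 (.reg 18) (.lit 0) (.sub (.get 2 (.reg 18) (.lit 0)) (.reg 5)))

theorem wp_sweepP (hn : s.idx 0 = n)
    (hQ : ∀ k s', Frame sweepP s s' → k ≤ 30 * n + 5 → s'.drawn = s.drawn + n →
      s'.vec 2 n = sweep (s.vec 2 n) (shift s.drawn ω) → Q k s') : WP ω sweepP s Q := by
  refine wp_forTo (N := n) (fun i K s' => K ≤ 30 * i + 2 ∧ s'.drawn = s.drawn + i ∧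
    ∀ l, s'.arr 2 l 0 = if l < i then coinStep (s.arr 2 l 0) (ω (s.drawn + l)) else s.arr 2 l 0)
    hn rfl rfl (by simp) ?_ ?_
  · rintro i K s₁ hi hir hF ⟨hK, hd, ha⟩
    refine wp_seq (wp_gauss (wp_seq (wp_setR ?_)))
    have hai : s₁.arr 2 i 0 = s.arr 2 i 0 := by rw [ha, if_neg (lt_irrefl i)]
    have hstep : ∀ (e : RExpr) (v : ℝ) (s₂ : Store), s₂.idx 18 = i → s₂.arr 2 = s₁.arr 2 →
        s₂.drawn = s₁.drawn + 1 → e.eval s₂ = v →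
        v = coinStep (s.arr 2 i 0) (ω (s.drawn + i)) → e.cost = 5 →
        WP ω (.put 2 (.reg 18) (.lit 0) e) s₂ fun k s' => K + (1 + (11 + (3 + k))) + 7 ≤
          30 * (i + 1) + 2 ∧ (s'.setI 18 (i + 1)).drawn = s.drawn + (i + 1) ∧
          ∀ l, (s'.setI 18 (i + 1)).arr 2 l 0 =
            if l < i + 1 then coinStep (s.arr 2 l 0) (ω (s.drawn + l)) else s.arr 2 l 0 := by
      intro e v s₂ h18 harr hdr he hv hcost
      refine wp_put ⟨?_, ?_, fun l => ?_⟩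
      · simp only [IExpr.cost, hcost]; omega
      · simp [hdr, hd]; ring
      · simp only [Store.setI_arr, Store.put_arr, IExpr.eval, h18, true_and, and_true, he, hv]
        split_ifs with h1 h2 h2
        · rw [h1]
        · omega
        · rw [harr, ha, if_pos (by omega)]
        · rw [harr, ha, if_neg (by omega)]
    set s₂ : Store := { s₁.setR 6 (ω s₁.drawn) with drawn := s₁.drawn + 1 } with hs₂
    have h5 : RExpr.eval s₂ (.sub (.lit 1)
        (.sqrt (.mul (.get 2 (.reg 18) (.lit 0)) (.get 2 (.reg 18) (.lit 0))))) =
        1 - |s.arr 2 i 0| := by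
      simp only [RExpr.eval, IExpr.eval, hs₂, Store.setR_idx, Store.setR_arr, hir, hai,
        Real.sqrt_mul_self_eq_abs, Rat.cast_one]
    rw [h5]
    have hev : Test.eval (s₂.setR 5 (1 - |s.arr 2 i 0|)) (.realLe (.lit 0) (.reg 6)) ↔
        0 ≤ ω (s.drawn + i) := by
      simp [Test.eval, RExpr.eval, hs₂, hd]
    refine wp_ite (fun h => ?_) (fun h => ?_)
    · rw [hev] at h
      refine hstep _ _ (s₂.setR 5 (1 - |s.arr 2 i 0|)) hir rfl rfl rfl ?_ rfl
      simp only [RExpr.eval, IExpr.eval, Store.setR_real, if_true, Store.setR_arr, coinStep, h]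
      rw [show (s₂.setR 5 (1 - |s.arr 2 i 0|)).idx 18 = i from hir,
        show s₂.arr 2 i 0 = s.arr 2 i 0 from hai]
    · rw [hev] at h
      refine hstep _ _ (s₂.setR 5 (1 - |s.arr 2 i 0|)) hir rfl rfl rfl ?_ rfl
      simp only [RExpr.eval, IExpr.eval, Store.setR_real, if_true, Store.setR_arr, coinStep, h,
        if_false]
      rw [show (s₂.setR 5 (1 - |s.arr 2 i 0|)).idx 18 = i from hir,
        show s₂.arr 2 i 0 = s.arr 2 i 0 from hai]
  · rintro K s₁ - hF ⟨hK, hd, ha⟩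
    refine hQ _ s₁ hF (by omega) hd ?_
    ext i
    rw [Store.vec, vecOf_apply, ha, if_pos i.2]
    rfl

/-- Write the signs of the coordinates to the array `1`. -/
def signP : Prog :=
  .forTo 18 0 <| .ite (.realLe (.lit 0) (.get 2 (.reg 18) (.lit 0)))
    (.put 1 (.reg 18) (.lit 0) (.lit 1)) (.put 1 (.reg 18) (.lit 0) (.lit (-1)))

theorem wp_signP (hn : s.idx 0 = n)
    (hQ : ∀ k s', Frame signP s s' → k ≤ 16 * n + 5 →
      (∀ i < n, s'.arr 1 i 0 = if 0 ≤ s.arr 2 i 0 then 1 else -1) → Q k s') : WP ω signP s Q := by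
  refine wp_forTo (N := n) (fun i K s' => K ≤ 16 * i + 2 ∧
    ∀ l < i, s'.arr 1 l 0 = if 0 ≤ s.arr 2 l 0 then 1 else -1) hn rfl rfl (by simp) ?_ ?_
  · rintro i K s₁ hi hir hF ⟨hK, ha⟩
    have hev : Test.eval s₁ (.realLe (.lit 0) (.get 2 (.reg 18) (.lit 0))) ↔ 0 ≤ s.arr 2 i 0 := by
      simp [Test.eval, RExpr.eval, IExpr.eval, hir, hF.arr 2 rfl]
    refine wp_ite (fun h => wp_put ⟨?_, fun l hl => ?_⟩) (fun h => wp_put ⟨?_, fun l hl => ?_⟩)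
    · simp only [Test.cost, RExpr.cost, IExpr.cost]; omega
    · rw [hev] at h
      simp only [Store.setI_arr, Store.put_arr, IExpr.eval, RExpr.eval, hir, true_and, and_true]
      split_ifs with h1 h2 h2
      · simp
      · exact absurd (h1 ▸ h) h2
      · rw [ha l (by omega), if_pos h2]
      · rw [ha l (by omega), if_neg h2]
    · simp only [Test.cost, RExpr.cost, IExpr.cost]; omega
    · rw [hev] at h
      simp only [Store.setI_arr, Store.put_arr, IExpr.eval, RExpr.eval, hir, true_and, and_true]
      split_ifs with h1 h2 h2
      · exact absurd (h1 ▸ h2) h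
      · simp
      · rw [ha l (by omega), if_pos h2]
      · rw [ha l (by omega), if_neg h2]
  · rintro K s₁ - hF ⟨hK, ha⟩
    exact hQ _ s₁ hF (by omega) ha

end RealRAM

/-! ### The complete colouring program and its running time. -/

namespace RealRAM

open Spencer

variable {ω : ℕ → ℝ} {p q : Prog} {s : Store} {Q Q' : ℕ → Store → Prop} {n m : ℕ}

/-- Compute the parameters of the walks. -/
def paramsP (n₀ : ℕ) : Prog :=
  .seq (logP 10 (.lit 1) 0) <| .seq (logP 11 (.reg 0) 1) <| .seq walkLengthP <|
  .seq (.setR 0 (.div (.lit 16) (.sqrt (.ofIdx (.reg 2))))) <|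
  .seq (.setR 1 (.div (.lit 1) (.sqrt (.sqrt (.sqrt (.ofIdx (.reg 0))))))) <|
  .seq (.setI 13 (.lit 0)) <|
  .seq (.ite (.idxLt (.reg 0) (.lit n₀)) .skip
    (.ite (.realLe (.mul (.mul (.ofIdx (.reg 0)) (.ofIdx (.reg 0))) (.ofIdx (.reg 0)))
      (.mul (.ofIdx (.reg 1)) (.ofIdx (.reg 1)))) .skip
      (.setI 13 (.add (.add (.add (.reg 10) (.reg 10)) (.reg 10)) (.lit 8))))) <|
  .setI 20 (.add (.reg 10) (.lit 3))

theorem wp_paramsP {A : Matrix (Fin m) (Fin n) ℝ} {n₀ : ℕ} (hn : 0 < n) (hm : n ≤ m)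
    (hs : s = matrixInput A)
    (hQ : ∀ k s', k ≤ 150 * m → s'.drawn = 0 → s'.idx 13 = numWalks n₀ n m →
      s'.idx 20 = numSweeps n → ColorState s' A 0 → Q k s') : WP ω (paramsP n₀) s Q := by
  have hlog : ∀ y, 0 < y → ∀ M, logRatio y M ≤ M := fun y hy M =>
    logRatio_le (Nat.lt_two_pow_self.le.trans (Nat.le_mul_of_pos_left _ hy))
  suffices h : WP ω (paramsP n₀) s fun k s' => k ≤ 150 * m ∧ s'.idx 2 = walkLength n ∧
      s'.idx 11 = logRatio n m ∧ s'.real 0 = (walkData A).γ ∧ s'.real 1 = (walkData A).δ ∧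
      s'.idx 13 = numWalks n₀ n m ∧ s'.idx 20 = numSweeps n by
    refine h.mono_frame fun k s' hF h => hQ k s' h.1 ?_ h.2.2.2.2.2.1 h.2.2.2.2.2.2
      ⟨?_, ?_, h.2.1, h.2.2.1, h.2.2.2.1, h.2.2.2.2.1, ?_, ?_⟩
    · rw [hF.drawn rfl, hs]; rfl
    · rw [hF.idx 0 rfl, hs]; rfl
    · rw [hF.idx 1 rfl, hs]; rfl
    · intro j i
      rw [hF.arr 0 rfl, hs]
      simp [matrixInput, padMat, padVec]
    · ext i
      rw [Store.vec, hF.arr 2 rfl, hs]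
      simp [matrixInput]
  have hi0 : s.idx 0 = n := by rw [hs]; rfl
  have hi1 : s.idx 1 = m := by rw [hs]; rfl
  have hl1 := hlog 1 one_pos n
  have hl2 := hlog n hn m
  refine wp_seq (wp_logP (y := 1) (M := n) (by decide) (by decide) (by decide) rfl one_pos hi0 ?_)
  intro k₁ s₁ hF₁ hk₁ h₁
  refine wp_seq (wp_logP (y := n) (M := m) (by decide) (by decide) (by decide) ?_ hn ?_ ?_)
  · simp [IExpr.eval, hF₁.idx 0 rfl, hi0]
  · rw [hF₁.idx 1 rfl, hi1]
  intro k₂ s₂ hF₂ hk₂ h₂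
  refine wp_seq (wp_walkLengthP (n := n) (by rw [hF₂.idx 0 rfl, hF₁.idx 0 rfl, hi0]) ?_)
  intro k₃ s₃ hF₃ hk₃ h₃
  have h0 : s₃.idx 0 = n := by rw [hF₃.idx 0 rfl, hF₂.idx 0 rfl, hF₁.idx 0 rfl, hi0]
  have h1 : s₃.idx 1 = m := by rw [hF₃.idx 1 rfl, hF₂.idx 1 rfl, hF₁.idx 1 rfl, hi1]
  have h10 : s₃.idx 10 = logRatio 1 n := by rw [hF₃.idx 10 rfl, hF₂.idx 10 rfl, h₁]
  have h11 : s₃.idx 11 = logRatio n m := by rw [hF₃.idx 11 rfl, h₂]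
  refine wp_seq (wp_setR (wp_seq (wp_setR (wp_seq (wp_setI ?_)))))
  simp only [RExpr.eval, IExpr.eval, h₃, h0, Store.setR_idx, RExpr.cost, IExpr.cost,
    Rat.cast_ofNat, Rat.cast_one]
  set s₄ := ((s₃.setR 0 (16 / √(walkLength n))).setR 1 (1 / √(√(√n)))).setI 13 0 with hs₄
  have hR : WP ω (.ite (.idxLt (.reg 0) (.lit n₀)) .skip
    (.ite (.realLe (.mul (.mul (.ofIdx (.reg 0)) (.ofIdx (.reg 0))) (.ofIdx (.reg 0)))
      (.mul (.ofIdx (.reg 1)) (.ofIdx (.reg 1)))) .skip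
      (.setI 13 (.add (.add (.add (.reg 10) (.reg 10)) (.reg 10)) (.lit 8))))) s₄
      fun k s' => k ≤ 30 ∧ s'.idx 13 = numWalks n₀ n m := by
    have e1 : Test.eval s₄ (.idxLt (.reg 0) (.lit n₀)) ↔ n < n₀ := by
      simp [Test.eval, IExpr.eval, hs₄, h0]
    have e2 : Test.eval s₄
        (.realLe (.mul (.mul (.ofIdx (.reg 0)) (.ofIdx (.reg 0))) (.ofIdx (.reg 0)))
        (.mul (.ofIdx (.reg 1)) (.ofIdx (.reg 1)))) ↔ n ^ 3 ≤ m ^ 2 := by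
      simp only [Test.eval, RExpr.eval, IExpr.eval, hs₄, Store.setI_idx, Store.setR_idx]
      norm_num [h0, h1]
      rw [pow_succ, sq, sq]
      exact_mod_cast Iff.rfl
    refine wp_ite (fun h => wp_skip ⟨?_, ?_⟩) (fun h => wp_ite (fun h' => wp_skip ⟨?_, ?_⟩)
      (fun h' => wp_setI ⟨?_, ?_⟩))
    · simp [Test.cost, IExpr.cost]
    · rw [e1] at h
      rw [numWalks, if_neg (by omega)]
      simp [hs₄]
    · simp [Test.cost, IExpr.cost, RExpr.cost]
    · rw [e2] at h'
      rw [numWalks, if_neg (by omega)]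
      simp [hs₄]
    · simp [Test.cost, IExpr.cost, RExpr.cost]
    · rw [e1] at h
      rw [e2] at h'
      rw [numWalks, if_pos (by omega)]
      simp [hs₄, IExpr.eval, h10]
      ring
  refine wp_seq (hR.mono_frame fun k₅ s₅ hF₅ h₅ => wp_setI ?_)
  refine ⟨?_, ?_, ?_, ?_, ?_, ?_, ?_⟩
  · simp only [IExpr.cost] at hk₁ hk₂ ⊢
    have := h₅.1
    omega
  · simp [hF₅.idx 2 rfl, hs₄, h₃]
  · simp [hF₅.idx 11 rfl, hs₄, h11]
  · simp [hF₅.real 0 rfl, hs₄, walkData]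
  · simp [hF₅.real 1 rfl, hs₄, walkData]
  · simp [h₅.2]
  · simp [IExpr.eval, hF₅.idx 10 rfl, hs₄, h10, numSweeps]

/-- The colouring program. -/
def colorP (n₀ : ℕ) : Prog :=
  .seq (paramsP n₀) <| .seq (.forTo 14 13 attemptP) <| .seq (.forTo 21 20 sweepP) signP

/-- Walks run only if `m² < n³`. With `walkLength n ^ 2 ≤ 4 n`, comparing squares gives `walkLength
n * m * n ≤ 2 n³`, so the number of iterations of a walk is absorbed by the cubic term. -/
theorem numWalks_cost (n₀ : ℕ) (hn : 0 < n) :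
    numWalks n₀ n m * (500 * (walkLength n * m * n + n ^ 3 + walkLength n * n ^ 2) +
      300 * (m * n) + 7) ≤ 20000 * ((logRatio 1 n + 1) * (m * n + n ^ 3)) := by
  unfold numWalks
  split_ifs with h
  · have h1 : walkLength n ≤ n := walkLength_le (Nat.le_mul_self n)
    have h2 := walkLength_sq_le hn
    have h3 : walkLength n * m * n ≤ 2 * n ^ 3 := by
      have : (walkLength n * m * n) ^ 2 ≤ (2 * n ^ 3) ^ 2 := by
        calc (walkLength n * m * n) ^ 2 = walkLength n ^ 2 * m ^ 2 * n ^ 2 := by ring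
          _ ≤ 4 * n * n ^ 3 * n ^ 2 := Nat.mul_le_mul_right _ (Nat.mul_le_mul h2 h.2.le)
          _ = _ := by ring
      exact (Nat.pow_le_pow_iff_left (by norm_num)).1 this
    have h4 : walkLength n * n ^ 2 ≤ n ^ 3 := by
      calc walkLength n * n ^ 2 ≤ n * n ^ 2 := by gcongr
        _ = _ := by ring
    have h5 : 1 ≤ n ^ 3 := Nat.one_le_pow _ _ hn
    calc _ ≤ (8 * (logRatio 1 n + 1)) * (2500 * (m * n + n ^ 3)) := by
          gcongr <;> omega
      _ = _ := by ring
  · simp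

theorem wp_colorP {A : Matrix (Fin m) (Fin n) ℝ} (n₀ : ℕ) (hn : 0 < n) (hm : n ≤ m) :
    WP ω (colorP n₀) (matrixInput A) fun k s' =>
      k ≤ 21000 * ((logRatio 1 n + 1) * (m * n + n ^ 3)) ∧
      ∀ i : Fin n, s'.arr 1 i 0 = coloring n₀ A ω i := by
  have hm0 : 0 < m := by omega
  refine wp_seq (wp_paramsP (n₀ := n₀) hn hm rfl ?_)
  intro k₁ s₁ hk₁ hd₁ h13 h20 hS₁
  set c := 500 * (walkLength n * m * n + n ^ 3 + walkLength n * n ^ 2) + 300 * (m * n) + 7 with hc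
  refine wp_seq (wp_forTo (N := numWalks n₀ n m) (fun r K s' => K ≤ r * c + 2 ∧
    s'.drawn = r * (walkLength n * n) ∧ ColorState s' A (fractional A ω r)) h13 rfl rfl ?_ ?_ ?_)
  · exact ⟨by omega, by simp [hd₁], hS₁.setI (by decide)⟩
  · rintro r K s₂ hr - hF ⟨hK, hd, hS⟩
    refine wp_attemptP hn hm0 hS ?_
    intro k₃ s₃ hF₃ hk₃ hd₃ hS₃
    have : (r + 1) * c = r * c + c := by ring
    refine ⟨by omega, ?_, ?_⟩
    · rw [Store.setI_drawn, hd₃, hd]; ring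
    · rw [hd] at hS₃
      exact hS₃.setI (by decide)
  intro K₂ s₂ _ hF₂ hI₂
  obtain ⟨hK₂, hd₂, hS₂⟩ := hI₂
  refine wp_seq (wp_forTo (N := numSweeps n) (fun b K s' => K ≤ b * (30 * n + 12) + 2 ∧
    s'.drawn = numWalks n₀ n m * (walkLength n * n) + b * n ∧
    s'.vec 2 n = sweeps (fractional A ω (numWalks n₀ n m))
      (shift (numWalks n₀ n m * (walkLength n * n)) ω) b)
    ((hF₂.idx 20 rfl).trans h20) rfl rfl ?_ ?_ ?_)
  · exact ⟨by omega, by simp [hd₂], hS₂.vec2⟩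
  · rintro b K s₃ hb - hF ⟨hK, hd, hv⟩
    refine wp_sweepP (n := n) ((hF.idx 0 rfl).trans hS₂.idx0) ?_
    intro k₄ s₄ hF₄ hk₄ hd₄ hv₄
    have : (b + 1) * (30 * n + 12) = b * (30 * n + 12) + (30 * n + 12) := by ring
    refine ⟨by omega, ?_, ?_⟩
    · rw [Store.setI_drawn, hd₄, hd]; ring
    · change s₄.vec 2 n = _
      rw [hv₄, hv, hd, ← shift_shift]
      rfl
  intro K₃ s₃ _ hF₃ hI₃
  obtain ⟨hK₃, -, hv₃⟩ := hI₃
  refine wp_signP (n := n) ((hF₃.idx 0 rfl).trans hS₂.idx0) ?_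
  intro k₄ s₄ _ hk₄ h₄
  refine ⟨?_, fun i => ?_⟩
  · have h1 := numWalks_cost (m := m) n₀ hn
    rw [← hc] at h1
    have h2 : numSweeps n * (30 * n + 12) ≤ 126 * ((logRatio 1 n + 1) * (m * n + n ^ 3)) := by
      have e1 : n ≤ m * n := Nat.le_mul_of_pos_left n hm0
      have e2 : 1 ≤ n ^ 3 := Nat.one_le_pow _ _ hn
      calc numSweeps n * (30 * n + 12) ≤ (3 * (logRatio 1 n + 1)) * (42 * (m * n + n ^ 3)) := by
            unfold numSweeps
            gcongr <;> omega
        _ = _ := by ring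
    have h3 : m ≤ (logRatio 1 n + 1) * (m * n + n ^ 3) := by
      have e1 : m ≤ m * n := Nat.le_mul_of_pos_right m hn
      calc m ≤ m * n + n ^ 3 := by omega
        _ ≤ _ := Nat.le_mul_of_pos_left _ (by omega)
    omega
  · rw [h₄ i i.2]
    have : s₃.arr 2 i 0 = rounded n₀ A ω i := by
      rw [rounded, ← hv₃]
      rfl
    rw [this]
    rfl

end RealRAM

/-- Colourings of small discrepancy are found in time `Õ(mn + n³)`. -/
theorem spencer_program :
    ∃ (p : RealRAM.Prog) (C d : ℕ) (K : ℝ), ∀ (n m : ℕ) (A : Matrix (Fin m) (Fin n) ℝ),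
      0 < n → n ≤ m → (∀ j i, |A j i| ≤ 1) →
      ∃ x : (ℕ → ℝ) → Fin n → ℝ,
        Measurable x ∧ (∀ ω i, x ω i = 1 ∨ x ω i = -1) ∧
        (∀ ω : ℕ → ℝ, ∃ (k : ℕ) (s : RealRAM.Store),
          RealRAM.Exec ω p (matrixInput A) k s ∧
          (k : ℝ) ≤ C * (m * n + n ^ 3) * (1 + Real.log (m * n)) ^ d ∧
          ∀ i : Fin n, s.arr 1 i 0 = x ω i) ∧
        1 / 2 ≤ RealRAM.drawLaw
          {ω | discrepancy A (x ω) ≤ K * Real.sqrt (n * Real.log (Real.exp 1 * m / n))} := by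
  obtain ⟨n₀, hn₀⟩ := exists_large
  refine ⟨RealRAM.colorP n₀, 42000, 1, 3000 + n₀, fun n m A hn hm hA =>
    ⟨Spencer.coloring n₀ A, Spencer.measurable_coloring n₀ A, Spencer.coloring_eq_or n₀ A,
      fun ω => ?_, Spencer.half_le_measure_discrepancy_le hn₀ hn hm hA⟩⟩
  obtain ⟨k, s, he, hk, hx⟩ := RealRAM.wp_colorP (ω := ω) (A := A) n₀ hn hm
  refine ⟨k, s, he, ?_, hx⟩
  -- The only logarithmic factor is the number of attempts and sweeps, at most a multiple of `1 +
  -- log n`; hence the exponent 1.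
  have h1 := Spencer.logRatio_le_log (n := 1) (m := n) one_pos hn
  rw [Nat.cast_one, div_one] at h1
  have hnR : (1 : ℝ) ≤ n := by exact_mod_cast hn
  have hmR : (1 : ℝ) ≤ m := by exact_mod_cast hn.trans_le hm
  have h2 : Real.log n ≤ Real.log (m * n) := Real.log_le_log (by linarith) (by nlinarith)
  have hk' : (k : ℝ) ≤ 21000 * ((Spencer.logRatio 1 n + 1) * (m * n + n ^ 3)) := by
    exact_mod_cast hk
  calc (k : ℝ) ≤ _ := hk'
    _ ≤ 21000 * ((2 * (1 + Real.log (m * n))) * (m * n + n ^ 3)) := by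
      gcongr
      linarith
    _ = _ := by push_cast; ring
theorem mainTheorem7 :
    -- Edge-Walk in time `O(Tmn + n³ + Tn²)`
    (∃ (p : RealRAM.Prog) (C : ℕ), ∀ (n m T : ℕ) (D : EdgeWalkData n m), 0 < n →
      ∃ X : (ℕ → ℝ) → Fin (T + 1) → EuclideanSpace ℝ (Fin n),
        Measurable X ∧ RealRAM.drawLaw.map X = D.walkLaw T ∧
        ∀ ω : ℕ → ℝ, ∃ (k : ℕ) (s : RealRAM.Store),
          RealRAM.Exec ω p (D.input T) k s ∧
          k ≤ C * (T * m * n + n ^ 3 + T * n ^ 2) ∧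
          -- index register `3` reports failure, the array `3` holds the final point
          ((∃ t : Fin T, n ≤ (D.nearDisc (X ω t.castSucc)).card) → s.idx 3 = 1) ∧
          ((¬ ∃ t : Fin T, n ≤ (D.nearDisc (X ω t.castSucc)).card) →
            s.idx 3 = 0 ∧ ∀ i : Fin n, s.arr 3 i 0 = X ω (Fin.last T) i)) ∧
    -- Spencer colourings in time `Õ(mn + n³)`
    (∃ (p : RealRAM.Prog) (C d : ℕ) (K : ℝ), ∀ (n m : ℕ) (A : Matrix (Fin m) (Fin n) ℝ),
      0 < n → n ≤ m → (∀ j i, |A j i| ≤ 1) →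
      ∃ x : (ℕ → ℝ) → Fin n → ℝ,
        Measurable x ∧ (∀ ω i, x ω i = 1 ∨ x ω i = -1) ∧
        (∀ ω : ℕ → ℝ, ∃ (k : ℕ) (s : RealRAM.Store),
          RealRAM.Exec ω p (matrixInput A) k s ∧
          (k : ℝ) ≤ C * (m * n + n ^ 3) * (1 + Real.log (m * n)) ^ d ∧
          ∀ i : Fin n, s.arr 1 i 0 = x ω i) ∧
        1 / 2 ≤ RealRAM.drawLaw
          {ω | discrepancy A (x ω) ≤ K * Real.sqrt (n * Real.log (Real.exp 1 * m / n))}) :=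
  ⟨edgeWalk_program, spencer_program⟩
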